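/- Let $G$ be a finite graph whose edges are each coloured red or blue. For a graph $H$, two edges $uv,uw$ of $H$ are triangle-connected if $vw$ is an edge of $H$; extend this to an equivalence relation on the edges of $H$ by transitive closure (with each edge triangle-connected to itself), and call the equivalence classes triangle components. A triangle-connected triangle factor (TCTF) in $H$ is a collection of pairwise vertex-disjoint triangles of $H$ (not necessarily covering all vertices) all of whose edges lie in a single triangle component of $H$. A monochromatic TCTF in $G$ is a TCTF in the graph of red edges of $G$ or in the graph of blue edges of $G$. For $r\in\mathbb{R}$, a set $A\subseteq V(G)$ and a vertex $v\notin A$, say that $v$ is $r$-blue to $A$ if $va$ is a blue edge of $G$ for all but at most $r$ vertices $a\in A$. For disjoint $A,B\subseteq V(G)$, say that $(A,B)$ is $r$-blue if all but at most $r$ vertices of $A$ are $r$-blue to $B$ and all but at most $r$ vertices of $B$ are $r$-blue to $A$. Define $r$-red similarly. **Lemma.** There exists $\delta_0>0$ such that for any $0<h,\lambda<\delta_0$ there exist $\varepsilon_0>0$ and $t_0\in\mathbb{N}$ such that for any real $t\ge t_0$ and any $0<\varepsilon<\varepsilon_0$ the following holds. Let $G$ be a $2$-edge-coloured graph on exactly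 $(9-\varepsilon)t$ vertices with minimum degree at least $(9-2\varepsilon)t$. Then either $G$ contains a monochromatic TCTF on at least $3(1+\varepsilon)t$ vertices, or $V(G)$ can be partitioned into sets $B_1,B_2,R_1,R_2,Z,T$ (where $T$ may be empty) such that: (a) $(2-h)t\le |B_1|,|B_2|,|R_1|,|R_2|\le(2+h)t$; (b) $(1-h)t\le|Z|\le(1+h)t$; (c) all edges of $G[B_1]$ and $G[B_2]$ are blue, and all edges of $G[R_1]$ and $G[R_2]$ are red; (d) all edges of $G$ between the pairs $(B_1,R_1)$, $(B_2,R_2)$, $(R_1,Z)$ and $(R_2,Z)$ are blue, and all edges of $G$ between the pairs $(B_1,R_2)$, $(B_2,R_1)$, $(B_1,Z)$ and $(B_2,Z)$ are red; (e) the pair $(B_1,B_2)$ is $\lambda t$-red, and the pair $(R_1,R_2)$ is $\lambda t$-blue; and (f) $|T|\le ht$. -/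

import Mathlib

/-- The two colours used on the edges. -/
inductive EdgeColour
  | red
  | blue

/-- The subgraph formed by the edges of colour `k`; a `2`-edge-colouring of `G` is a map that gives
each edge of `G` exactly one of the two colours. -/
abbrev colourGraph {V : Type*} {G : SimpleGraph V} (C : G.EdgeLabeling EdgeColour)
    (k : EdgeColour) : SimpleGraph V :=
  SimpleGraph.EdgeLabeling.labelGraph C k

/-- One step of triangle connection: the edges are `uv` and `uw`, and `vw` is an edge too. -/
def TriangleStep {V : Type*} (G : SimpleGraph V) (e f : Sym2 V) : Prop :=
  ∃ u v w : V, G.Adj u v ∧ G.Adj u w ∧ G.Adj v w ∧ e = s(u, v) ∧ f = s(u, w)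

/-- The equivalence relation on the edges of `G` generated by `TriangleStep`. -/
def TriangleConnected {V : Type*} (G : SimpleGraph V) : G.edgeSet → G.edgeSet → Prop :=
  Relation.EqvGen (fun e f : G.edgeSet => TriangleStep G e f)

/-- The triangle components of `G`: the equivalence classes of triangle connection. -/
def IsTriangleComponent {V : Type*} (G : SimpleGraph V) (S : Set G.edgeSet) : Prop :=
  ∃ e : G.edgeSet, S = {f | TriangleConnected G e f}

/-- A triangle factor: a collection of vertex-disjoint triangles of `G`, each given by its set of
three vertices. It need not cover all vertices of `G`. -/
def IsTriangleFactor {V : Type*} (G : SimpleGraph V) (F : Finset (Finset V)) : Prop :=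
  (∀ s ∈ F, G.IsNClique 3 s) ∧ (F : Set (Finset V)).PairwiseDisjoint id

/-- A triangle-connected triangle factor (TCTF): all edges of its triangles lie in one triangle
component of `G`. -/
def IsTCTF {V : Type*} (G : SimpleGraph V) (F : Finset (Finset V)) : Prop :=
  IsTriangleFactor G F ∧
    ∃ S : Set G.edgeSet, IsTriangleComponent G S ∧
      ∀ s ∈ F, ∀ e : G.edgeSet, (∀ v ∈ (e : Sym2 V), v ∈ s) → e ∈ S

/-- `G` has a TCTF that covers at least `x` vertices. -/
def HasTCTFOn {V : Type*} [DecidableEq V] (G : SimpleGraph V) (x : ℝ) : Prop :=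
  ∃ F : Finset (Finset V), IsTCTF G F ∧ x ≤ ((F.biUnion id).card : ℝ)

/-- With `H` the graph of the edges of one colour: `va` is an edge of that colour for all but at
most `r` vertices `a` of `A`. -/
def VertexAlmostAll {V : Type*} (H : SimpleGraph V) (r : ℝ) (v : V) (A : Finset V) : Prop :=
  ((A : Set V) ∩ {a | ¬ H.Adj v a}).ncard ≤ r

/-- With `H` the graph of the edges of one colour: the pair `(A, B)` is `r`-red, or `r`-blue (used
for disjoint `A` and `B`). -/
def PairAlmostAll {V : Type*} (H : SimpleGraph V) (r : ℝ) (A B : Finset V) : Prop :=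
  ((A : Set V) ∩ {a | ¬ VertexAlmostAll H r a B}).ncard ≤ r ∧
  ((B : Set V) ∩ {b | ¬ VertexAlmostAll H r b A}).ncard ≤ r

/-- All edges of `G` inside `A` have colour `k`. -/
def AllInside {V : Type*} {G : SimpleGraph V} (C : G.EdgeLabeling EdgeColour) (k : EdgeColour)
    (A : Finset V) : Prop :=
  ∀ a ∈ A, ∀ b ∈ A, G.Adj a b → (colourGraph C k).Adj a b

/-- All edges of `G` between `A` and `B` have colour `k`. -/
def AllBetween {V : Type*} {G : SimpleGraph V} (C : G.EdgeLabeling EdgeColour) (k : EdgeColour)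
    (A B : Finset V) : Prop :=
  ∀ a ∈ A, ∀ b ∈ B, G.Adj a b → (colourGraph C k).Adj a b

/-- `B₁, B₂, R₁, R₂, Z, T` partition the vertex set (a part may be empty) and have the sizes and the
colour pattern of the extremal colouring, up to the error parameters `h` and `lam`. -/
structure IsExtremalPartition {V : Type*} {G : SimpleGraph V} (C : G.EdgeLabeling EdgeColour)
    (h lam t : ℝ) (B₁ B₂ R₁ R₂ Z T : Finset V) : Prop where
  disjoint : [B₁, B₂, R₁, R₂, Z, T].Pairwise Disjoint
  cover : ∀ v : V, v ∈ B₁ ∨ v ∈ B₂ ∨ v ∈ R₁ ∨ v ∈ R₂ ∨ v ∈ Z ∨ v ∈ T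
  card_B₁ : (2 - h) * t ≤ B₁.card ∧ B₁.card ≤ (2 + h) * t
  card_B₂ : (2 - h) * t ≤ B₂.card ∧ B₂.card ≤ (2 + h) * t
  card_R₁ : (2 - h) * t ≤ R₁.card ∧ R₁.card ≤ (2 + h) * t
  card_R₂ : (2 - h) * t ≤ R₂.card ∧ R₂.card ≤ (2 + h) * t
  card_Z : (1 - h) * t ≤ Z.card ∧ Z.card ≤ (1 + h) * t
  card_T : T.card ≤ h * t
  inside_B₁ : AllInside C .blue B₁
  inside_B₂ : AllInside C .blue B₂
  inside_R₁ : AllInside C .red R₁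
  inside_R₂ : AllInside C .red R₂
  between_B₁_R₁ : AllBetween C .blue B₁ R₁
  between_B₂_R₂ : AllBetween C .blue B₂ R₂
  between_R₁_Z : AllBetween C .blue R₁ Z
  between_R₂_Z : AllBetween C .blue R₂ Z
  between_B₁_R₂ : AllBetween C .red B₁ R₂
  between_B₂_R₁ : AllBetween C .red B₂ R₁
  between_B₁_Z : AllBetween C .red B₁ Z
  between_B₂_Z : AllBetween C .red B₂ Z
  pair_B₁_B₂ : PairAlmostAll (colourGraph C .red) (lam * t) B₁ B₂
  pair_R₁_R₂ : PairAlmostAll (colourGraph C .blue) (lam * t) R₁ R₂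

/-! Suppose that no monochromatic TCTF is large enough. By Ramsey's theorem almost all vertices lie
in disjoint monochromatic cliques of a large constant size `M`. Each clique lies in one triangle
component, which becomes the home of its vertices. Two edges of the clique's colour from a vertex to
the clique lie in the component of the clique. Hence, apart from few bad pairs, vertices with
different homes of the same colour are joined in the other colour, and an edge between homes of
different colours lies in the home component of one of its ends. `CleanColouring` records this.
Since any `κ` vertices of one home contain a triangle of it, a packing can always be completed
greedily inside a home: `n` triangles that leave `a` vertices of the home unused satisfy `3 * n + a
≤ 3 * t` up to an error (`Pk.three_mul_add_le`). The size estimates come from confronting suitable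
packings with this inequality.

Call a colour rich if no two homes contain almost all of its vertices. Some colour `k` is rich
(`rich_or_rich`): otherwise four homes with sizes near `3 * t, 2 * t, 2 * t, 2 * t` would contain
too large a packing. Richness forces all good pairs between different homes of colour `k` into one
component `Q` of the other colour, the hub (`exists_hub`). The hub and a single further home cannot
exhaust the other colour (`hub_case`), so there are two vertices outside the hub with different
homes. Comparing them shows that almost all of colour `k` lies in three homes `a, b, c`, and that
each of the two vertices has a type: the one home of colour `k` that it sees in its own component
(`exists_types`).

Once mixtures of types are excluded (`no_mixture`), the configuration `Pure` remains, in which `A₀`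
and `B₀` together play the role of `Z`. Packings in the two components `Q` and `c` force the sizes
`2 * t, 2 * t, 2 * t, 2 * t, t` (`Pure.sizes`), and removing few more vertices makes the colours
exact (`Pure.exists_prune`). Errors live on two scales: `κ` for bad pairs and `δ` for sizes, with
`κ` far below `δ`, `δ` far below `t`, and `κ * t` far below `δ ^ 2`. -/

section Auxiliary

open scoped Classical

/-! ### Colours, cardinalities and clean colourings. -/

/-- The other colour. -/
def EdgeColour.other : EdgeColour → EdgeColour
  | .red => .blue
  | .blue => .red

@[simp] theorem EdgeColour.other_other (k : EdgeColour) : k.other.other = k := by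
  cases k <;> rfl

theorem EdgeColour.other_ne (k : EdgeColour) : k.other ≠ k := by
  cases k <;> simp [EdgeColour.other]

theorem EdgeColour.eq_or_eq_other (k j : EdgeColour) : j = k ∨ j = k.other := by
  cases k <;> cases j <;> simp [EdgeColour.other]

theorem EdgeColour.eq_other_of_ne {k j : EdgeColour} (h : j ≠ k) : j = k.other :=
  (k.eq_or_eq_other j).resolve_left h

theorem Finset.cast_card_sdiff_ge {V : Type*} (A B : Finset V) :
    (A.card : ℝ) - B.card ≤ (A \ B).card := by
  have := Finset.le_card_sdiff B A
  have h : A.card ≤ (A \ B).card + B.card := by omega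
  have : (A.card : ℝ) ≤ (A \ B).card + B.card := by exact_mod_cast h
  linarith

theorem Finset.cast_card_union_le {V : Type*} (A B : Finset V) :
    ((A ∪ B).card : ℝ) ≤ A.card + B.card := by
  exact_mod_cast Finset.card_union_le A B

theorem Finset.cast_card_mono {V : Type*} {A B : Finset V} (h : A ⊆ B) :
    (A.card : ℝ) ≤ B.card := by
  exact_mod_cast Finset.card_le_card h

theorem Finset.exists_mem_notMem_of_card {V : Type*} {A B : Finset V} (h : (B.card : ℝ) < A.card) :
    ∃ v ∈ A, v ∉ B := by
  by_contra hc
  push Not at hc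
  have := Finset.cast_card_mono (show A ⊆ B from hc)
  linarith

/-- A nearly complete `2`-edge-coloured graph in which each vertex `v` has a home: a colour `col v`
and a triangle component `hm v` of that colour. `E k c u v` says that `uv` is an edge of colour `k`
in the component `c`. Edges between different homes behave as expected for good pairs, each vertex
is in at most `κ` bad pairs, each set of `κ` vertices with the same home contains a triangle of this
component, and no component has a triangle factor of more than `t + κ` triangles. -/
structure CleanColouring (V ι : Type*) [Fintype V] (t κ : ℝ) where
  E : EdgeColour → ι → V → V → Prop
  symm : ∀ {k c u v}, E k c u v → E k c v u
  uniq : ∀ {k c j d u v}, E k c u v → E j d u v → k = j ∧ c = d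
  tri : ∀ {k c d e u v w}, E k c u v → E k d u w → E k e v w → c = d ∧ c = e
  col : V → EdgeColour
  hm : V → ι
  Good : V → V → Prop
  good_symm : ∀ {u v}, Good u v → Good v u
  good_same : ∀ {u v}, Good u v → col u = col v → hm u ≠ hm v → ∃ d, E (col u).other d u v
  good_diff : ∀ {u v}, Good u v → col u ≠ col v → E (col u) (hm u) u v ∨ E (col v) (hm v) u v
  bad_le : ∀ v, ((Finset.univ.filter fun w => ¬ Good v w).card : ℝ) ≤ κ
  dense : ∀ k c (A : Finset V), (∀ v ∈ A, col v = k ∧ hm v = c) → κ ≤ A.card →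
    ∃ x ∈ A, ∃ y ∈ A, ∃ z ∈ A, E k c x y ∧ E k c x z ∧ E k c y z
  pack : ∀ k c (F : Finset (Finset V)),
    (∀ s ∈ F, ∃ x y z, E k c x y ∧ E k c x z ∧ E k c y z ∧ s = {x, y, z}) →
    (F : Set (Finset V)).PairwiseDisjoint id → (F.card : ℝ) ≤ t + κ
  card_ge : 9 * t - κ ≤ Fintype.card V

/-! ### Greedy triangle packings. -/

namespace CleanColouring

variable {V ι : Type*} [Fintype V] {t κ : ℝ} (S : CleanColouring V ι t κ)

/-- A triangle in the component `c` of colour `k`. -/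
def T (k : EdgeColour) (c : ι) (x y z : V) : Prop := S.E k c x y ∧ S.E k c x z ∧ S.E k c y z

/-- The vertices with home `c` of colour `k`. -/
noncomputable def U (k : EdgeColour) (c : ι) : Finset V :=
  Finset.univ.filter fun v => S.col v = k ∧ S.hm v = c

/-- The vertices with a home of colour `k`. -/
noncomputable def Cl (k : EdgeColour) : Finset V := Finset.univ.filter fun v => S.col v = k

/-- The vertices in `Y` that are not joined to `x` by an edge of the component `c` of colour `k`. -/
noncomputable def miss (k : EdgeColour) (c : ι) (x : V) (Y : Finset V) : Finset V :=
  Y.filter fun y => ¬ S.E k c x y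

/-- Every vertex of `X` misses at most `5 * κ` vertices of `Y`. -/
def Full (k : EdgeColour) (c : ι) (X Y : Finset V) : Prop :=
  ∀ x ∈ X, ((S.miss k c x Y).card : ℝ) ≤ 5 * κ

/-- Some packing of `n` triangles in the component `c` of colour `k` covers exactly `W`. -/
inductive Pk (k : EdgeColour) (c : ι) : ℕ → Finset V → Prop
  | nil : Pk k c 0 ∅
  | cons {n W x y z} : Pk k c n W → S.T k c x y z → x ∉ W → y ∉ W → z ∉ W →
      Pk k c (n + 1) (W ∪ {x, y, z})

variable {S}

@[simp] theorem mem_U {k : EdgeColour} {c : ι} {v : V} :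
    v ∈ S.U k c ↔ S.col v = k ∧ S.hm v = c := by simp [U]

@[simp] theorem mem_Cl {k : EdgeColour} {v : V} : v ∈ S.Cl k ↔ S.col v = k := by simp [Cl]

@[simp] theorem mem_miss {k : EdgeColour} {c : ι} {x y : V} {Y : Finset V} :
    y ∈ S.miss k c x Y ↔ y ∈ Y ∧ ¬ S.E k c x y := by simp [miss]

theorem U_subset_Cl (k : EdgeColour) (c : ι) : S.U k c ⊆ S.Cl k := by
  intro v hv; simp at hv ⊢; exact hv.1

theorem disjoint_U {k : EdgeColour} {c d : ι} (h : c ≠ d) : Disjoint (S.U k c) (S.U k d) := by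
  rw [Finset.disjoint_left]; intro v hv hv'; simp at hv hv'; exact h (hv.2.symm.trans hv'.2)

theorem disjoint_Cl {k : EdgeColour} : Disjoint (S.Cl k) (S.Cl k.other) := by
  rw [Finset.disjoint_left]; intro v hv hv'; simp at hv hv'
  exact k.other_ne (hv'.symm.trans hv)

theorem T.comm₂ {k : EdgeColour} {c : ι} {x y z : V} (h : S.T k c x y z) : S.T k c x z y :=
  ⟨h.2.1, h.1, S.symm h.2.2⟩

theorem T.of_E {k : EdgeColour} {c d e : ι} {x y z : V} (h : S.E k c x y) (h' : S.E k d x z)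
    (h'' : S.E k e y z) : S.T k c x y z := by
  obtain ⟨rfl, rfl⟩ := S.tri h h' h''
  exact ⟨h, h', h''⟩

theorem Pk.le {k : EdgeColour} {c : ι} {n : ℕ} {W : Finset V} (h : S.Pk k c n W) :
    (n : ℝ) ≤ t + κ := by
  suffices h : ∃ F : Finset (Finset V), (∀ s ∈ F, ∃ x y z, S.E k c x y ∧ S.E k c x z ∧
      S.E k c y z ∧ s = {x, y, z}) ∧ (F : Set (Finset V)).PairwiseDisjoint id ∧ F.card = n ∧
      ∀ s ∈ F, s ⊆ W by
    obtain ⟨F, h1, h2, rfl, -⟩ := h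
    exact S.pack k c F h1 h2
  induction h with
  | nil => exact ⟨∅, by simp⟩
  | @cons n W x y z _ hT hx hy hz ih =>
    obtain ⟨F, h1, h2, h3, h4⟩ := ih
    have hd : ∀ s ∈ F, Disjoint s {x, y, z} := fun s hs => by
      rw [Finset.disjoint_left]
      intro v hv hv'
      have := h4 s hs hv
      simp only [Finset.mem_insert, Finset.mem_singleton] at hv'
      rcases hv' with rfl | rfl | rfl <;> contradiction
    have hn : ({x, y, z} : Finset V) ∉ F := fun h => by
      have := hd _ h
      simp at this
    refine ⟨insert {x, y, z} F, ?_, ?_, ?_, ?_⟩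
    · intro s hs
      rcases Finset.mem_insert.1 hs with rfl | hs
      · exact ⟨x, y, z, hT.1, hT.2.1, hT.2.2, rfl⟩
      · exact h1 s hs
    · rw [Finset.coe_insert]
      refine h2.insert fun s hs _ => (hd s hs).symm
    · rw [Finset.card_insert_of_notMem hn, h3]
    · intro s hs
      rcases Finset.mem_insert.1 hs with rfl | hs
      · exact Finset.subset_union_right
      · exact (h4 s hs).trans Finset.subset_union_left

/-- Greedy packing of triangles with one vertex in each of `A`, `B` and `C`: there are `n` of them,
or fewer in a packing that cannot be extended. -/
theorem Pk.greedy_or {k : EdgeColour} {c : ι} {n₀ : ℕ} {W₀ : Finset V} (h0 : S.Pk k c n₀ W₀)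
    (A B C : Finset V) (n : ℕ) :
    (∃ X ⊆ A, ∃ Y ⊆ B, ∃ Z ⊆ C, X.card = n ∧ Y.card = n ∧ Z.card = n ∧
      S.Pk k c (n₀ + n) (W₀ ∪ X ∪ Y ∪ Z)) ∨
    ∃ m < n, ∃ X ⊆ A, ∃ Y ⊆ B, ∃ Z ⊆ C, X.card = m ∧ Y.card = m ∧ Z.card = m ∧
      S.Pk k c (n₀ + m) (W₀ ∪ X ∪ Y ∪ Z) ∧ ∀ x ∈ A, ∀ y ∈ B, ∀ z ∈ C, S.T k c x y z →
        x ∈ W₀ ∪ X ∪ Y ∪ Z ∨ y ∈ W₀ ∪ X ∪ Y ∪ Z ∨ z ∈ W₀ ∪ X ∪ Y ∪ Z := by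
  induction n with
  | zero => exact Or.inl ⟨∅, by simp, ∅, by simp, ∅, by simp, by simp, by simp, by simp, by simpa⟩
  | succ n ih =>
    rcases ih with ⟨X, hX, Y, hY, Z, hZ, cX, cY, cZ, hP⟩ | ⟨m, hm, h⟩
    · by_cases hmax : ∀ x ∈ A, ∀ y ∈ B, ∀ z ∈ C, S.T k c x y z →
        x ∈ W₀ ∪ X ∪ Y ∪ Z ∨ y ∈ W₀ ∪ X ∪ Y ∪ Z ∨ z ∈ W₀ ∪ X ∪ Y ∪ Z
      · exact Or.inr ⟨n, by omega, X, hX, Y, hY, Z, hZ, cX, cY, cZ, hP, hmax⟩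
      · push Not at hmax
        obtain ⟨x, hx, y, hy, z, hz, hT, nx, ny, nz⟩ := hmax
        refine Or.inl ⟨insert x X, Finset.insert_subset hx hX, insert y Y,
          Finset.insert_subset hy hY, insert z Z, Finset.insert_subset hz hZ, ?_, ?_, ?_, ?_⟩
        · rw [Finset.card_insert_of_notMem (fun h => nx (by simp [h])), cX]
        · rw [Finset.card_insert_of_notMem (fun h => ny (by simp [h])), cY]
        · rw [Finset.card_insert_of_notMem (fun h => nz (by simp [h])), cZ]
        · have := hP.cons hT nx ny nz
          have hW : W₀ ∪ insert x X ∪ insert y Y ∪ insert z Z = W₀ ∪ X ∪ Y ∪ Z ∪ {x, y, z} := by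
            ext v; simp; tauto
          rw [hW]
          exact this
    · exact Or.inr ⟨m, by omega, h⟩

theorem Pk.greedy {k : EdgeColour} {c : ι} {n₀ : ℕ} {W₀ : Finset V} (h0 : S.Pk k c n₀ W₀)
    (A B C : Finset V) (n : ℕ)
    (H : ∀ X ⊆ A, ∀ Y ⊆ B, ∀ Z ⊆ C, X.card < n → Y.card < n → Z.card < n →
      ∃ x ∈ A, ∃ y ∈ B, ∃ z ∈ C, S.T k c x y z ∧ x ∉ W₀ ∪ X ∪ Y ∪ Z ∧ y ∉ W₀ ∪ X ∪ Y ∪ Z ∧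
        z ∉ W₀ ∪ X ∪ Y ∪ Z) :
    ∃ X ⊆ A, ∃ Y ⊆ B, ∃ Z ⊆ C, X.card = n ∧ Y.card = n ∧ Z.card = n ∧
      S.Pk k c (n₀ + n) (W₀ ∪ X ∪ Y ∪ Z) := by
  rcases h0.greedy_or A B C n with h | ⟨m, hm, X, hX, Y, hY, Z, hZ, cX, cY, cZ, -, h⟩
  · exact h
  · obtain ⟨x, hx, y, hy, z, hz, hT, nx, ny, nz⟩ :=
      H X hX Y hY Z hZ (cX ▸ hm) (cY ▸ hm) (cZ ▸ hm)
    rcases h x hx y hy z hz hT with h | h | h <;> contradiction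

theorem Pk.greedy_max {k : EdgeColour} {c : ι} {n₀ : ℕ} {W₀ : Finset V} (h0 : S.Pk k c n₀ W₀)
    (A B C : Finset V) :
    ∃ m : ℕ, ∃ X ⊆ A, ∃ Y ⊆ B, ∃ Z ⊆ C, X.card = m ∧ Y.card = m ∧ Z.card = m ∧
      S.Pk k c (n₀ + m) (W₀ ∪ X ∪ Y ∪ Z) ∧ ∀ x ∈ A, ∀ y ∈ B, ∀ z ∈ C, S.T k c x y z →
        x ∈ W₀ ∪ X ∪ Y ∪ Z ∨ y ∈ W₀ ∪ X ∪ Y ∪ Z ∨ z ∈ W₀ ∪ X ∪ Y ∪ Z := by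
  -- No packing has more than `t + κ` triangles, so asking for more forces the maximal alternative.
  obtain ⟨N, hN⟩ := exists_nat_gt (t + κ)
  rcases h0.greedy_or A B C N with ⟨X, -, Y, -, Z, -, -, -, -, h⟩ | ⟨m, -, h⟩
  · have := h.le
    push_cast at this
    have : (0 : ℝ) ≤ n₀ := by positivity
    linarith
  · exact ⟨m, h⟩

variable (S) in
/-- The vertices that do not form a good pair with `v`. -/
noncomputable def bad (v : V) : Finset V := Finset.univ.filter fun w => ¬ S.Good v w

@[simp] theorem mem_bad {v w : V} : w ∈ S.bad v ↔ ¬ S.Good v w := by simp [bad]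

theorem card_bad (v : V) : ((S.bad v).card : ℝ) ≤ κ := S.bad_le v

theorem good_other {k : EdgeColour} {c : ι} {x y : V} (h : S.Good x y) (hx : x ∈ S.U k c)
    (hy : S.col y = k.other) (hn : ¬ S.E k c x y) : S.E k.other (S.hm y) x y := by
  simp at hx
  have := S.good_diff h (by rw [hx.1, hy]; exact k.other_ne.symm)
  rw [hx.1, hx.2, hy] at this
  exact this.resolve_left hn

end CleanColouring

/-! ### Basic packing bounds in one component. -/

namespace CleanColouring

variable {V ι : Type*} [Fintype V] {t κ : ℝ} {S : CleanColouring V ι t κ}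

/-- As long as `κ` vertices of the home are unused they contain a triangle of the component, so the
packing extends inside the home until only about `κ` vertices are left. The extended packing obeys
`pack`. -/
theorem Pk.three_mul_add_le (hκ : 10 ≤ κ) {k : EdgeColour} {c : ι} {n : ℕ} {W : Finset V}
    (h : S.Pk k c n W) : 3 * (n : ℝ) + (S.U k c \ W).card ≤ 3 * t + 5 * κ := by
  have hn := h.le
  set D := S.U k c \ W with hD
  rcases lt_or_ge (D.card : ℝ) κ with hlt | hge
  · linarith
  set m := ⌊((D.card : ℝ) - κ) / 3⌋₊ with hm
  have hm1 : (m : ℝ) ≤ ((D.card : ℝ) - κ) / 3 := Nat.floor_le (by linarith)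
  have hm2 : ((D.card : ℝ) - κ) / 3 < m + 1 := Nat.lt_floor_add_one _
  obtain ⟨X, -, Y, -, Z, -, -, -, -, hP⟩ := h.greedy D D D m (by
    intro X hX Y hY Z hZ cX cY cZ
    have c1 : (X.card : ℝ) + 1 ≤ m := by exact_mod_cast cX
    have c2 : (Y.card : ℝ) + 1 ≤ m := by exact_mod_cast cY
    have c3 : (Z.card : ℝ) + 1 ≤ m := by exact_mod_cast cZ
    have h1 := Finset.cast_card_sdiff_ge D (X ∪ Y ∪ Z)
    have h2 := Finset.cast_card_union_le (X ∪ Y) Z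
    have h3 := Finset.cast_card_union_le X Y
    obtain ⟨x, hx, y, hy, z, hz, hT⟩ := S.dense k c (D \ (X ∪ Y ∪ Z)) (by
      intro v hv; simp [hD] at hv; tauto) (by linarith)
    simp only [Finset.mem_sdiff, hD] at hx hy hz
    refine ⟨x, by simp [hD]; simpa using hx.1, y, by simp [hD]; simpa using hy.1,
      z, by simp [hD]; simpa using hz.1, hT, ?_, ?_, ?_⟩ <;> simp at hx hy hz ⊢ <;> tauto)
  have := hP.le
  push_cast at this
  linarith

/-- Of the triangle that `dense` finds among the unused neighbours of `x` in `D`, only one edge is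
kept; together with `x` it forms the wanted triangle. -/
theorem Pk.pair_of_full {k : EdgeColour} {c : ι} {n₀ : ℕ} {W₀ : Finset V}
    (h0 : S.Pk k c n₀ W₀) {D X : Finset V} (hD : D ⊆ S.U k c) (hXD : Disjoint X D)
    (hXW : Disjoint X W₀) (hDW : Disjoint D W₀) (hf : S.Full k c X D) {n : ℕ} (hn : n ≤ X.card)
    (hn' : 2 * (n : ℝ) + 6 * κ ≤ D.card) :
    ∃ D₁ ⊆ D, ∃ D₂ ⊆ D, ∃ X' ⊆ X, D₁.card = n ∧ D₂.card = n ∧ X'.card = n ∧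
      S.Pk k c (n₀ + n) (W₀ ∪ D₁ ∪ D₂ ∪ X') := by
  apply h0.greedy D D X n
  intro D₁ h₁ D₂ h₂ X' hX' c1 c2 c3
  have c1' : (D₁.card : ℝ) + 1 ≤ n := by exact_mod_cast c1
  have c2' : (D₂.card : ℝ) + 1 ≤ n := by exact_mod_cast c2
  obtain ⟨x, hx, hxX⟩ := Finset.exists_mem_notMem_of_card (A := X) (B := X') (by
    exact_mod_cast lt_of_lt_of_le c3 hn)
  have e1 := Finset.cast_card_sdiff_ge D (D₁ ∪ D₂ ∪ S.miss k c x D)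
  have e2 := Finset.cast_card_union_le (D₁ ∪ D₂) (S.miss k c x D)
  have e3 := Finset.cast_card_union_le D₁ D₂
  have e4 := hf x hx
  obtain ⟨y, hy, z, hz, -, -, hyz, -⟩ := S.dense k c (D \ (D₁ ∪ D₂ ∪ S.miss k c x D)) (by
    intro v hv; simp at hv; simpa using hD hv.1) (by linarith)
  simp only [Finset.mem_sdiff, Finset.mem_union, mem_miss, not_or, not_and, not_not] at hy hz
  have := Finset.disjoint_left.1 hXD
  have := Finset.disjoint_left.1 hXW
  have := Finset.disjoint_left.1 hDW
  refine ⟨y, hy.1, z, hz.1, x, hx, ⟨hyz, S.symm (hy.2.2 hy.1), S.symm (hz.2.2 hz.1)⟩, ?_, ?_, ?_⟩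
  · simp only [Finset.mem_union, not_or]
    exact ⟨⟨⟨this hy.1, hy.2.1.1⟩, hy.2.1.2⟩, fun h => Finset.disjoint_left.1 hXD (hX' h) hy.1⟩
  · simp only [Finset.mem_union, not_or]
    exact ⟨⟨⟨this hz.1, hz.2.1.1⟩, hz.2.1.2⟩, fun h => Finset.disjoint_left.1 hXD (hX' h) hz.1⟩
  · simp only [Finset.mem_union, not_or]
    exact ⟨⟨⟨Finset.disjoint_left.1 hXW hx, fun h => Finset.disjoint_left.1 hXD hx (h₁ h)⟩,
      fun h => Finset.disjoint_left.1 hXD hx (h₂ h)⟩, hxX⟩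

/-- If each vertex of `D` has `ρ` neighbours in `X`, then some vertex of `X` has many neighbours
in `D`. -/
theorem exists_many_neighbours {k : EdgeColour} {c : ι} {D X : Finset V} {ρ m : ℝ}
    (h : ∀ d ∈ D, ρ ≤ ((X.filter fun x => S.E k c d x).card : ℝ))
    (hm : m * X.card < ρ * D.card) :
    ∃ x ∈ X, m < ((D.filter fun d => S.E k c d x).card : ℝ) := by
  by_contra hc
  push Not at hc
  have h1 : ∑ d ∈ D, ((X.filter fun x => S.E k c d x).card : ℝ) =
      ∑ x ∈ X, ((D.filter fun d => S.E k c d x).card : ℝ) := by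
    exact_mod_cast Finset.sum_card_bipartiteAbove_eq_sum_card_bipartiteBelow (fun d x => S.E k c d x)
  have h2 := Finset.sum_le_sum h
  have h3 := Finset.sum_le_sum hc
  simp only [Finset.sum_const, nsmul_eq_mul] at h2 h3
  linarith

/-- Single vertices of `X` may have few neighbours in `D`. Double counting still finds, at each
step, an unused vertex of `X` with more than `κ` unused neighbours in `D`, and these span an edge.
-/
theorem Pk.pair_of_partial {k : EdgeColour} {c : ι} {n₀ : ℕ} {W₀ : Finset V}
    (h0 : S.Pk k c n₀ W₀) {D X : Finset V} (hD : D ⊆ S.U k c) (hXD : Disjoint X D)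
    (hXW : Disjoint X W₀) (hDW : Disjoint D W₀) {ρ : ℝ}
    (hf : ∀ d ∈ D, ρ ≤ ((X.filter fun x => S.E k c d x).card : ℝ)) (hκ : 0 ≤ κ) {n : ℕ}
    (hρ : (n : ℝ) ≤ ρ) (hn : κ * X.card < (ρ - n) * (D.card - 2 * n)) :
    ∃ D₁ ⊆ D, ∃ D₂ ⊆ D, ∃ X' ⊆ X, D₁.card = n ∧ D₂.card = n ∧ X'.card = n ∧
      S.Pk k c (n₀ + n) (W₀ ∪ D₁ ∪ D₂ ∪ X') := by
  apply h0.greedy D D X n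
  intro D₁ h₁ D₂ h₂ X' hX' c1 c2 c3
  have c1' : (D₁.card : ℝ) + 1 ≤ n := by exact_mod_cast c1
  have c2' : (D₂.card : ℝ) + 1 ≤ n := by exact_mod_cast c2
  have c3' : (X'.card : ℝ) + 1 ≤ n := by exact_mod_cast c3
  have e1 := Finset.cast_card_sdiff_ge D (D₁ ∪ D₂)
  have e3 := Finset.cast_card_union_le D₁ D₂
  obtain ⟨x, hx, hx'⟩ := exists_many_neighbours (S := S) (k := k) (c := c) (D := D \ (D₁ ∪ D₂))
    (X := X \ X') (ρ := ρ - n) (m := κ) (by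
      intro d hd
      have h1 := hf d (Finset.mem_sdiff.1 hd).1
      have h2 := Finset.cast_card_sdiff_ge (X.filter fun x => S.E k c d x) X'
      have h3 : (X.filter fun x => S.E k c d x) \ X' ⊆
        (X \ X').filter fun x => S.E k c d x := by intro v; simp; tauto
      have h4 := Finset.cast_card_mono h3
      linarith) (by
      have h1 := Finset.cast_card_mono (Finset.sdiff_subset (s := X) (t := X'))
      have h2 : κ * (X \ X').card ≤ κ * X.card := by gcongr
      have h3 : (ρ - n) * (D.card - 2 * n) ≤ (ρ - n) * (D \ (D₁ ∪ D₂)).card := by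
        apply mul_le_mul_of_nonneg_left <;> linarith
      linarith)
  obtain ⟨y, hy, z, hz, -, -, hyz, -⟩ := S.dense k c
    ((D \ (D₁ ∪ D₂)).filter fun d => S.E k c d x) (by
    intro v hv; simp at hv; simpa using hD hv.1.1) hx'.le
  simp only [Finset.mem_sdiff, Finset.mem_union, Finset.mem_filter, not_or] at hy hz hx
  refine ⟨y, hy.1.1, z, hz.1.1, x, hx.1, ⟨hyz, hy.2, hz.2⟩, ?_, ?_, ?_⟩
  · simp only [Finset.mem_union, not_or]
    exact ⟨⟨⟨Finset.disjoint_left.1 hDW hy.1.1, hy.1.2.1⟩, hy.1.2.2⟩,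
      fun h => Finset.disjoint_left.1 hXD (hX' h) hy.1.1⟩
  · simp only [Finset.mem_union, not_or]
    exact ⟨⟨⟨Finset.disjoint_left.1 hDW hz.1.1, hz.1.2.1⟩, hz.1.2.2⟩,
      fun h => Finset.disjoint_left.1 hXD (hX' h) hz.1.1⟩
  · simp only [Finset.mem_union, not_or]
    exact ⟨⟨⟨Finset.disjoint_left.1 hXW hx.1, fun h => Finset.disjoint_left.1 hXD hx.1 (h₁ h)⟩,
      fun h => Finset.disjoint_left.1 hXD hx.1 (h₂ h)⟩, hx.2⟩

variable (S) in
/-- Every vertex of `X` is joined to all but at most `5 * κ` vertices of `Y` by edges of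
colour `k`. -/
def FullCol (k : EdgeColour) (X Y : Finset V) : Prop :=
  ∀ x ∈ X, ((Y.filter fun y => ¬ ∃ d, S.E k d x y).card : ℝ) ≤ 5 * κ

theorem Full.fullCol {k : EdgeColour} {c : ι} {X Y : Finset V} (h : S.Full k c X Y) :
    S.FullCol k X Y := fun x hx => (Finset.cast_card_mono (by
      intro y hy; simp at hy ⊢; exact ⟨hy.1, hy.2 c⟩)).trans (h x hx)

theorem Full.mono {k : EdgeColour} {c : ι} {X Y X' Y' : Finset V} (h : S.Full k c X Y)
    (hX : X' ⊆ X) (hY : Y' ⊆ Y) : S.Full k c X' Y' := fun x hx => (Finset.cast_card_mono (by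
      intro y hy; simp at hy ⊢; exact ⟨hY hy.1, hy.2⟩)).trans (h x (hX hx))

/-- Only the edges between `A` and `B` have to be known to lie in `c`; each triangle then pulls its
other two edges into the same component. -/
theorem Pk.tripartite {k : EdgeColour} {c : ι} {n₀ : ℕ} {W₀ : Finset V}
    (h0 : S.Pk k c n₀ W₀) {A B C : Finset V} (hAB : Disjoint A B) (hAC : Disjoint A C)
    (hBC : Disjoint B C) (hA : Disjoint A W₀) (hB : Disjoint B W₀) (hC : Disjoint C W₀)
    (fAB : S.Full k c A B) (fAC : S.FullCol k A C) (fBC : S.FullCol k B C) {n : ℕ}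
    (nA : n ≤ A.card) (nB : (n : ℝ) + 5 * κ ≤ B.card) (nC : (n : ℝ) + 10 * κ ≤ C.card) :
    ∃ X ⊆ A, ∃ Y ⊆ B, ∃ Z ⊆ C, X.card = n ∧ Y.card = n ∧ Z.card = n ∧
      S.Pk k c (n₀ + n) (W₀ ∪ X ∪ Y ∪ Z) := by
  apply h0.greedy A B C n
  intro X hX Y hY Z hZ cX cY cZ
  have c2' : (Y.card : ℝ) + 1 ≤ n := by exact_mod_cast cY
  have c3' : (Z.card : ℝ) + 1 ≤ n := by exact_mod_cast cZ
  obtain ⟨x, hx, hxX⟩ := Finset.exists_mem_notMem_of_card (A := A) (B := X) (by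
    exact_mod_cast lt_of_lt_of_le cX nA)
  obtain ⟨y, hy, hy'⟩ := Finset.exists_mem_notMem_of_card (A := B) (B := Y ∪ S.miss k c x B) (by
    have := fAB x hx
    have := Finset.cast_card_union_le Y (S.miss k c x B)
    linarith)
  obtain ⟨z, hz, hz'⟩ := Finset.exists_mem_notMem_of_card (A := C)
      (B := Z ∪ ((C.filter fun y => ¬ ∃ d, S.E k d x y) ∪ (C.filter fun z => ¬ ∃ d, S.E k d y z)))
      (by
    have := fAC x hx
    have := fBC y hy
    have := Finset.cast_card_union_le Z
      ((C.filter fun y => ¬ ∃ d, S.E k d x y) ∪ (C.filter fun z => ¬ ∃ d, S.E k d y z))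
    have := Finset.cast_card_union_le (C.filter fun y => ¬ ∃ d, S.E k d x y)
      (C.filter fun z => ¬ ∃ d, S.E k d y z)
    linarith)
  simp only [Finset.mem_union, mem_miss, not_or, not_and, not_not, Finset.mem_filter] at hy' hz'
  obtain ⟨d, hd⟩ := hz'.2.1 hz
  obtain ⟨e, he⟩ := hz'.2.2 hz
  refine ⟨x, hx, y, hy, z, hz, T.of_E (hy'.2 hy) hd he, ?_, ?_, ?_⟩ <;>
    simp only [Finset.mem_union, not_or]
  · exact ⟨⟨⟨Finset.disjoint_left.1 hA hx, hxX⟩, fun h => Finset.disjoint_left.1 hAB hx (hY h)⟩,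
      fun h => Finset.disjoint_left.1 hAC hx (hZ h)⟩
  · exact ⟨⟨⟨Finset.disjoint_left.1 hB hy, fun h => Finset.disjoint_left.1 hAB (hX h) hy⟩, hy'.1⟩,
      fun h => Finset.disjoint_left.1 hBC hy (hZ h)⟩
  · exact ⟨⟨⟨Finset.disjoint_left.1 hC hz, fun h => Finset.disjoint_left.1 hAC (hX h) hz⟩,
      fun h => Finset.disjoint_left.1 hBC (hY h) hz⟩, hz'.1⟩

theorem exists_nat_near {x : ℝ} (hx : 0 ≤ x) : ∃ n : ℕ, (n : ℝ) ≤ x ∧ x - 1 ≤ n :=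
  ⟨⌊x⌋₊, Nat.floor_le hx, by have := Nat.lt_floor_add_one x; linarith⟩

/-- A part that is fully joined to a disjoint set within its component. -/
theorem card_le_of_full (hκ : 10 ≤ κ) {k : EdgeColour} {c : ι} {D X : Finset V}
    (hD : D ⊆ S.U k c) (hXD : Disjoint X D) (hf : S.Full k c X D) :
    (D.card : ℝ) ≤ 2 * t + 20 * κ ∨ (D.card : ℝ) + X.card ≤ 3 * t + 20 * κ := by
  by_contra hc
  push Not at hc
  have h00 := Pk.three_mul_add_le hκ (Pk.nil (S := S) (k := k) (c := c))
  have hDU := Finset.cast_card_mono hD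
  simp at h00
  obtain ⟨n, h1, h2⟩ := exists_nat_near (x := min (X.card : ℝ) ((D.card - 6 * κ) / 2)) (by
    apply le_min
    · positivity
    · linarith)
  have hx := h1.trans (min_le_left _ _)
  have hd := h1.trans (min_le_right _ _)
  obtain ⟨D₁, hD₁, D₂, hD₂, X', hX', c1, c2, c3, hP⟩ :=
    Pk.pair_of_full Pk.nil hD hXD (by simp) (by simp) hf (n := n) (by exact_mod_cast hx) (by linarith)
  have h3 := hP.three_mul_add_le hκ
  have h4 : D \ (D₁ ∪ D₂) ⊆ S.U k c \ (∅ ∪ D₁ ∪ D₂ ∪ X') := by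
    intro v hv
    simp only [Finset.mem_sdiff, Finset.mem_union, not_or] at hv ⊢
    exact ⟨hD hv.1, ⟨⟨by simp, hv.2.1⟩, hv.2.2⟩, fun h => Finset.disjoint_left.1 hXD (hX' h) hv.1⟩
  have h5 := Finset.cast_card_mono h4
  have h6 := Finset.cast_card_sdiff_ge D (D₁ ∪ D₂)
  have h7 := Finset.cast_card_union_le D₁ D₂
  rw [c1, c2] at h7
  push_cast at h3
  rcases min_choice (X.card : ℝ) ((D.card - 6 * κ) / 2) with h | h <;> rw [h] at h2 <;> linarith

theorem card_U_le (hκ : 10 ≤ κ) (k : EdgeColour) (c : ι) :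
    ((S.U k c).card : ℝ) ≤ 3 * t + 5 * κ := by
  have h00 := Pk.three_mul_add_le hκ (Pk.nil (S := S) (k := k) (c := c))
  simpa using h00

end CleanColouring

theorem Finset.exists_mem_notMem₂ {V : Type*} {A B C : Finset V}
    (h : (B.card : ℝ) + C.card < A.card) : ∃ v ∈ A, v ∉ B ∧ v ∉ C := by
  obtain ⟨v, hv, hv'⟩ := Finset.exists_mem_notMem_of_card (A := A) (B := B ∪ C)
    ((Finset.cast_card_union_le B C).trans_lt h)
  exact ⟨v, hv, by simpa using hv'⟩

theorem Finset.exists_mem_notMem₃ {V : Type*} {A B C D : Finset V}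
    (h : (B.card : ℝ) + C.card + D.card < A.card) : ∃ v ∈ A, v ∉ B ∧ v ∉ C ∧ v ∉ D := by
  obtain ⟨v, hv, hv', hv''⟩ := Finset.exists_mem_notMem₂ (A := A) (B := B) (C := C ∪ D) (by
    have := Finset.cast_card_union_le C D
    linarith)
  exact ⟨v, hv, hv', by simpa using hv''⟩

/-! ### Residues of maximal packings, and the hub of a rich colour. -/

namespace CleanColouring

variable {V ι : Type*} [Fintype V] {t κ : ℝ} {S : CleanColouring V ι t κ}

theorem card_Cl_add (S : CleanColouring V ι t κ) (k : EdgeColour) :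
    9 * t - κ ≤ ((S.Cl k).card : ℝ) + (S.Cl k.other).card := by
  have h : (S.Cl k) ∪ (S.Cl k.other) = Finset.univ := by
    ext v; simpa using k.eq_or_eq_other (S.col v)
  have := Finset.cast_card_union_le (S.Cl k) (S.Cl k.other)
  rw [h, Finset.card_univ] at this
  linarith [S.card_ge]

theorem card_Cl_eq (S : CleanColouring V ι t κ) (k : EdgeColour) {i j : ι} (h : i ≠ j) :
    ((S.Cl k).card : ℝ) = (S.U k i).card + (S.U k j).card + (S.Cl k \ (S.U k i ∪ S.U k j)).card := by
  have h1 := Finset.card_union_of_disjoint (disjoint_U (S := S) (k := k) h)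
  have h2 := Finset.card_sdiff_add_card_eq_card
    (Finset.union_subset (U_subset_Cl (S := S) k i) (U_subset_Cl k j))
  rw [← h2, h1]; push_cast; ring

/-- The vertices of the other colour that keep many neighbours in what is left of a component after
a maximal packing of triangles with exactly one vertex of the other colour. -/
theorem exists_residue (hκ : 10 ≤ κ) (k : EdgeColour) (c : ι) :
    ∃ Y ⊆ S.Cl k.other, ∃ U₀ ⊆ S.U k c, (Y.card : ℝ) ≤ 3 * t - (S.U k c).card + 5 * κ ∧
      3 * ((S.U k c).card : ℝ) - 6 * t - 10 * κ ≤ U₀.card ∧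
      ∀ y ∈ S.Cl k.other, y ∉ Y → ((S.miss k.other (S.hm y) y U₀).card : ℝ) ≤ 2 * κ := by
  -- Each triangle uses only two vertices of the home, so `m` is at most about `3 * t` minus the
  -- size of the home, and the home keeps all but `2 * m` of its vertices.
  obtain ⟨m, X, hX, Y, hY, Z, hZ, cX, cY, cZ, hP, hmax⟩ :=
    (Pk.nil (S := S) (k := k) (c := c)).greedy_max (S.U k c) (S.U k c) (S.Cl k.other)
  have hK := hP.three_mul_add_le hκ
  have hsub : S.U k c \ (X ∪ Y) ⊆ S.U k c \ (∅ ∪ X ∪ Y ∪ Z) := by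
    intro v hv
    simp only [Finset.mem_sdiff, Finset.mem_union, not_or] at hv ⊢
    exact ⟨hv.1, ⟨⟨by simp, hv.2.1⟩, hv.2.2⟩,
      fun h => Finset.disjoint_left.1 disjoint_Cl (U_subset_Cl _ _ hv.1) (hZ h)⟩
  have h1 := Finset.cast_card_mono hsub
  have h2 := Finset.cast_card_sdiff_ge (S.U k c) (X ∪ Y)
  have h3 := Finset.cast_card_union_le X Y
  push_cast at hK
  rw [cX, cY] at h3
  refine ⟨Z, hZ, S.U k c \ (X ∪ Y), Finset.sdiff_subset, by rw [cZ]; linarith, by linarith, ?_⟩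
  intro y hy hyZ
  by_contra hc
  push Not at hc
  -- If `y` had `κ` such neighbours, they would span an edge that forms a triangle with `y`, against
  -- maximality.
  set A := (S.U k c \ (X ∪ Y)).filter fun x => S.E k c y x with hA
  have hcov : S.miss k.other (S.hm y) y (S.U k c \ (X ∪ Y)) ⊆ S.bad y ∪ A := by
    intro x hx
    rw [mem_miss] at hx
    simp only [hA, Finset.mem_union, Finset.mem_filter, mem_bad]
    by_cases hg : S.Good y x
    · refine Or.inr ⟨hx.1, ?_⟩
      by_contra hE
      have hxU := (Finset.mem_sdiff.1 hx.1).1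
      simp only [mem_Cl] at hy
      exact hx.2 (S.symm (good_other (S.good_symm hg) hxU hy fun h => hE (S.symm h)))
    · exact Or.inl hg
  have h4 := Finset.cast_card_mono hcov
  have h5 := Finset.cast_card_union_le (S.bad y) A
  have h6 := S.card_bad y
  obtain ⟨u, hu, v, hv, -, -, huv, -⟩ := S.dense k c A (by
    intro v hv; simp [hA] at hv; exact hv.1.1) (by linarith)
  simp only [hA, Finset.mem_filter, Finset.mem_sdiff, Finset.mem_union, not_or] at hu hv
  have := hmax u hu.1.1 v hv.1.1 y hy ⟨huv, S.symm hu.2, S.symm hv.2⟩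
  have e1 : u ∉ Z := fun h => Finset.disjoint_left.1 disjoint_Cl (U_subset_Cl _ _ hu.1.1) (hZ h)
  have e2 : v ∉ Z := fun h => Finset.disjoint_left.1 disjoint_Cl (U_subset_Cl _ _ hv.1.1) (hZ h)
  have e3 : y ∉ X := fun h => Finset.disjoint_left.1 disjoint_Cl (U_subset_Cl _ _ (hX h)) hy
  have e4 : y ∉ Y := fun h => Finset.disjoint_left.1 disjoint_Cl (U_subset_Cl _ _ (hY h)) hy
  simp only [Finset.mem_union, Finset.notMem_empty, false_or] at this
  tauto

variable (S) in
/-- No two components of colour `k` contain all but `η` of the vertices of colour `k`. -/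
def Rich (k : EdgeColour) (η : ℝ) : Prop :=
  ∀ i j, η ≤ ((S.Cl k \ (S.U k i ∪ S.U k j)).card : ℝ)

variable (S) in
/-- All good pairs of vertices with different homes of colour `k` are edges of the component `Q`
of the other colour. -/
def IsHub (k : EdgeColour) (Q : ι) : Prop :=
  ∀ u v, S.col u = k → S.col v = k → S.hm u ≠ S.hm v → S.Good u v → S.E k.other Q u v

theorem IsHub.full {k : EdgeColour} {Q : ι} (h : S.IsHub k Q) (hκ : 0 ≤ κ) {X Y : Finset V}
    (hX : X ⊆ S.Cl k) (hY : Y ⊆ S.Cl k) (hXY : ∀ x ∈ X, ∀ y ∈ Y, S.hm x ≠ S.hm y) :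
    S.Full k.other Q X Y := by
  intro x hx
  have : S.miss k.other Q x Y ⊆ S.bad x := by
    intro y hy
    rw [mem_miss] at hy
    rw [mem_bad]
    exact fun hg => hy.2 (h x y (by simpa using hX hx) (by simpa using hY hy.1) (hXY x hx y hy.1) hg)
  have := Finset.cast_card_mono this
  linarith [S.card_bad x]

/-- Good pairs with different homes of colour `k` are edges of the other colour. Two of them, `uv`
and `uw`, lie in one component if some `z` with a home different from those of `u`, `v`, `w` is good
to all three, because the triangles `uvz` and `uwz` share the edge `uz`. Richness provides `z`, and
it also provides a vertex through which the stars of two given vertices are linked. -/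
theorem exists_hub [Nonempty ι] {k : EdgeColour} {η : ℝ} (hκ : 10 ≤ κ) (hr : S.Rich k η) (hη : 10 * κ ≤ η) :
    ∃ Q, S.IsHub k Q := by
  have key : ∀ u v w, S.col u = k → S.col v = k → S.col w = k → S.Good u v → S.Good u w →
      S.hm u ≠ S.hm v → S.hm u ≠ S.hm w → ∀ d e, S.E k.other d u v → S.E k.other e u w → d = e := by
    have aux : ∀ u v w z, S.col u = k → S.col v = k → S.col w = k → S.col z = k →
        S.Good u z → S.Good v z → S.Good w z → S.hm u ≠ S.hm z → S.hm v ≠ S.hm z →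
        S.hm w ≠ S.hm z → ∀ d e, S.E k.other d u v → S.E k.other e u w → d = e := by
      intro u v w z hu hv hw hz guz gvz gwz nu nv nw d e hd he
      obtain ⟨a, ha⟩ := S.good_same guz (hu.trans hz.symm) nu
      obtain ⟨b, hb⟩ := S.good_same gvz (hv.trans hz.symm) nv
      obtain ⟨c, hc⟩ := S.good_same gwz (hw.trans hz.symm) nw
      rw [hu] at ha; rw [hv] at hb; rw [hw] at hc
      exact (S.tri hd ha hb).1.trans (S.tri he ha hc).1.symm
    have same : ∀ u v w, S.col u = k → S.col v = k → S.col w = k → S.hm v = S.hm w →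
        ∀ d e, S.E k.other d u v → S.E k.other e u w → d = e := by
      intro u v w hu hv hw hvw d e hd he
      obtain ⟨z, hz, z1, z2, z3⟩ := Finset.exists_mem_notMem₃
        (A := S.Cl k \ (S.U k (S.hm u) ∪ S.U k (S.hm v))) (B := S.bad u) (C := S.bad v)
        (D := S.bad w) (by
          have := hr (S.hm u) (S.hm v)
          linarith [S.card_bad u, S.card_bad v, S.card_bad w])
      simp at hz z1 z2 z3
      exact aux u v w z hu hv hw hz.1 z1 z2 z3 (fun h => hz.2.1 hz.1 h.symm)
        (fun h => hz.2.2 hz.1 h.symm) (fun h => hz.2.2 hz.1 (h.symm.trans hvw.symm)) d e hd he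
    intro u v w hu hv hw guv guw nuv nuw d e hd he
    by_cases hvw : S.hm v = S.hm w
    · exact same u v w hu hv hw hvw d e hd he
    by_cases hz : ∃ z ∈ S.Cl k \ (S.U k (S.hm u) ∪ S.U k (S.hm v)), z ∉ S.bad u ∧ z ∉ S.bad v ∧
        z ∉ S.bad w ∪ S.U k (S.hm w)
    · obtain ⟨z, hz, z1, z2, z3⟩ := hz
      simp at hz z1 z2 z3
      exact aux u v w z hu hv hw hz.1 z1 z2 z3.1 (fun h => hz.2.1 hz.1 h.symm)
        (fun h => hz.2.2 hz.1 h.symm) (fun h => z3.2 hz.1 h.symm) d e hd he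
    -- Without such a `z`, the home of `w` contains most of what lies outside the homes of `u` and
    -- `v`. Then `z` is chosen in the home of `w`: the triangle `uvz` moves from `uv` to `uz`, and
    -- `same` moves from `uz` to `uw`.
    · obtain ⟨z, hz, z1, z2⟩ : ∃ z ∈ S.U k (S.hm w), z ∉ S.bad u ∧ z ∉ S.bad v := by
        apply Finset.exists_mem_notMem₂
        by_contra hc
        apply hz
        apply Finset.exists_mem_notMem₃
        have := hr (S.hm u) (S.hm v)
        linarith [S.card_bad u, S.card_bad v, S.card_bad w,
          Finset.cast_card_union_le (S.bad w) (S.U k (S.hm w))]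
      simp only [mem_U, mem_bad, not_not] at hz z1 z2
      obtain ⟨a, ha⟩ := S.good_same z1 (hu.trans hz.1.symm) (by rw [hz.2]; exact nuw)
      obtain ⟨b, hb⟩ := S.good_same z2 (hv.trans hz.1.symm) (by rw [hz.2]; exact hvw)
      rw [hu] at ha; rw [hv] at hb
      exact (S.tri hd ha hb).1.trans (same u z w hu hz.1 hw hz.2 a e ha he)
  have star : ∀ u, S.col u = k → ∃ q, ∀ v, S.col v = k → S.Good u v → S.hm u ≠ S.hm v →
      S.E k.other q u v := by
    intro u hu
    obtain ⟨z, hz, z1⟩ := Finset.exists_mem_notMem_of_card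
      (A := S.Cl k \ (S.U k (S.hm u) ∪ S.U k (S.hm u))) (B := S.bad u) (by
        have := hr (S.hm u) (S.hm u)
        linarith [S.card_bad u])
    simp at hz z1
    have nz : S.hm u ≠ S.hm z := fun h => hz.2 hz.1 h.symm
    obtain ⟨q, hq⟩ := S.good_same z1 (hu.trans hz.1.symm) nz
    rw [hu] at hq
    refine ⟨q, fun v hv hg hn => ?_⟩
    obtain ⟨d, hd⟩ := S.good_same hg (hu.trans hv.symm) hn
    rw [hu] at hd
    rw [key u z v hu hz.1 hv z1 hg nz hn q d hq hd]
    exact hd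
  rcases (S.Cl k).eq_empty_or_nonempty with he | ⟨u₀, hu₀⟩
  · have := hr (Classical.arbitrary ι) (Classical.arbitrary ι)
    simp [he] at this
    linarith
  rw [mem_Cl] at hu₀
  obtain ⟨Q, hQ⟩ := star u₀ hu₀
  refine ⟨Q, fun u v hu hv hn hg => ?_⟩
  obtain ⟨q, hq⟩ := star u hu
  obtain ⟨z, hz, z1, z2⟩ := Finset.exists_mem_notMem₂
    (A := S.Cl k \ (S.U k (S.hm u) ∪ S.U k (S.hm u₀))) (B := S.bad u) (C := S.bad u₀) (by
      have := hr (S.hm u) (S.hm u₀)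
      linarith [S.card_bad u, S.card_bad u₀])
  simp at hz z1 z2
  have h1 := hq z hz.1 z1 fun h => hz.2.1 hz.1 h.symm
  have h2 := hQ z hz.1 z2 fun h => hz.2.2 hz.1 h.symm
  obtain ⟨q', hq'⟩ := star z hz.1
  have h3 := hq' u hu (S.good_symm z1) fun h => hz.2.1 hz.1 h
  have h4 := hq' u₀ hu₀ (S.good_symm z2) fun h => hz.2.2 hz.1 h
  rw [(S.uniq (S.symm h2) h4).2, (S.uniq (S.symm h3) h1).2]
  exact hq v hv hg hn

end CleanColouring

/-! ### Inequalities between the sizes of components. -/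

namespace CleanColouring

variable {V ι : Type*} [Fintype V] {t κ δ : ℝ} {S : CleanColouring V ι t κ}

/-- At most one component of each colour is much larger than `2 * t`. -/
theorem not_both_large [Nonempty ι] (S : CleanColouring V ι t κ) (hκ : 10 ≤ κ) (hδ : 1000 * κ ≤ δ)
    (ht : 1000000 * δ ≤ t)
    {k : EdgeColour} {c₁ c₂ : ι} (hc : c₁ ≠ c₂) (h₁ : 2 * t + 10 * δ ≤ (S.U k c₁).card)
    (h₂ : 2 * t + 10 * δ ≤ (S.U k c₂).card) : False := by
  obtain ⟨Y₁, hY₁, U₁, hU₁, y₁, u₁, f₁⟩ := exists_residue (S := S) hκ k c₁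
  obtain ⟨Y₂, hY₂, U₂, hU₂, y₂, u₂, f₂⟩ := exists_residue (S := S) hκ k c₂
  have hV := card_Cl_add S k
  have hR := card_Cl_eq S k hc
  set s := ((S.Cl k \ (S.U k c₁ ∪ S.U k c₂)).card : ℝ) with hs
  set D := S.Cl k.other \ (Y₁ ∪ Y₂) with hD
  have hd := Finset.cast_card_sdiff_ge (S.Cl k.other) (Y₁ ∪ Y₂)
  have hd' := Finset.cast_card_union_le Y₁ Y₂
  have hDc : 3 * t - s - 11 * κ ≤ D.card := by linarith
  -- Both `y` and `y'` see almost all of the two residues in their own home components. An edge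
  -- `x₁x₂` across the residues forms a triangle with either vertex, so its component is the home of
  -- both.
  have key : ∀ y ∈ D, ∀ y' ∈ D, ∃ x₁ x₂, S.col x₁ = k ∧ S.col x₂ = k ∧ S.hm x₁ ≠ S.hm x₂ ∧
      S.Good x₁ x₂ ∧ S.E k.other (S.hm y) y x₁ ∧ S.E k.other (S.hm y) y x₂ ∧
      S.E k.other (S.hm y') y' x₁ ∧ S.E k.other (S.hm y') y' x₂ := by
    intro y hy y' hy'
    simp only [hD, Finset.mem_sdiff, Finset.mem_union, not_or] at hy hy'
    have e1 := f₁ y hy.1 hy.2.1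
    have e2 := f₂ y hy.1 hy.2.2
    have e3 := f₁ y' hy'.1 hy'.2.1
    have e4 := f₂ y' hy'.1 hy'.2.2
    obtain ⟨x₁, hx₁, a₁, b₁⟩ := Finset.exists_mem_notMem₂ (A := U₁)
      (B := S.miss k.other (S.hm y) y U₁) (C := S.miss k.other (S.hm y') y' U₁) (by linarith)
    obtain ⟨x₂, hx₂, a₂, b₂, g⟩ := Finset.exists_mem_notMem₃ (A := U₂)
      (B := S.miss k.other (S.hm y) y U₂) (C := S.miss k.other (S.hm y') y' U₂) (D := S.bad x₁)
      (by linarith [S.card_bad x₁])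
    have i₁ := hU₁ hx₁
    have i₂ := hU₂ hx₂
    simp only [mem_miss, mem_bad, mem_U, not_and, not_not] at a₁ b₁ a₂ b₂ g i₁ i₂
    exact ⟨x₁, x₂, i₁.1, i₂.1, by rw [i₁.2, i₂.2]; exact hc, g, a₁ hx₁, a₂ hx₂, b₁ hx₁, b₂ hx₂⟩
  rcases lt_or_ge s δ with hsδ | hsδ
  · obtain ⟨y, hy, -⟩ := Finset.exists_mem_notMem_of_card (A := D) (B := ∅)
      (by rw [Finset.card_empty]; push_cast; linarith)
    have hDU : D ⊆ S.U k.other (S.hm y) := by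
      intro y' hy'
      obtain ⟨x₁, x₂, k₁, k₂, hn, hg, e1, e2, e3, e4⟩ := key y hy y' hy'
      obtain ⟨d, hd⟩ := S.good_same hg (k₁.trans k₂.symm) hn
      rw [k₁] at hd
      rw [mem_U]
      refine ⟨by simpa using (Finset.mem_sdiff.1 hy').1, ?_⟩
      rw [(S.tri (S.symm e1) hd e2).1, (S.tri (S.symm e3) hd e4).1]
    obtain ⟨n, n1, n2⟩ := exists_nat_near (x := 3 * δ) (by linarith)
    have hDK : Disjoint U₁ D := Finset.disjoint_of_subset_left (hU₁.trans (U_subset_Cl _ _))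
      (Finset.disjoint_of_subset_right Finset.sdiff_subset disjoint_Cl)
    obtain ⟨D₁, hD₁, D₂, hD₂, X', hX', c1, c2, c3, hP⟩ :=
      Pk.pair_of_partial Pk.nil hDU hDK (by simp) (by simp) (ρ := U₁.card - 2 * κ) (n := n)
      (by
        intro d hd
        have h1 := f₁ d (Finset.mem_sdiff.1 hd).1 (fun h => (Finset.mem_sdiff.1 hd).2 (by simp [h]))
        have h2 : U₁ \ S.miss k.other (S.hm d) d U₁ ⊆
            U₁.filter fun x => S.E k.other (S.hm y) d x := by
          intro x hx
          have : S.hm d = S.hm y := (mem_U.1 (hDU hd)).2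
          simp [this] at hx
          simp [hx.1, hx.2 hx.1]
        have h3 := Finset.cast_card_mono h2
        have h4 := Finset.cast_card_sdiff_ge U₁ (S.miss k.other (S.hm d) d U₁)
        linarith) (by linarith) (by linarith) (by
        have e1 : (U₁.card : ℝ) / 2 ≤ U₁.card - 2 * κ - n := by linarith
        have e2 : 2 * t ≤ D.card - 2 * n := by linarith
        have e3 : (U₁.card : ℝ) / 2 * (2 * t) ≤ (U₁.card - 2 * κ - n) * (D.card - 2 * n) :=
          mul_le_mul e1 e2 (by linarith) (by linarith)
        have e4 : κ * U₁.card < t * U₁.card := by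
          apply mul_lt_mul_of_pos_right <;> linarith
        linarith)
    have h3 := hP.three_mul_add_le hκ
    have h4 : D \ (D₁ ∪ D₂) ⊆ S.U k.other (S.hm y) \ (∅ ∪ D₁ ∪ D₂ ∪ X') := by
      intro v hv
      simp only [Finset.mem_sdiff, Finset.mem_union, not_or] at hv ⊢
      exact ⟨hDU hv.1, ⟨⟨by simp, hv.2.1⟩, hv.2.2⟩,
        fun h => Finset.disjoint_left.1 hDK (hX' h) hv.1⟩
    have h5 := Finset.cast_card_mono h4
    have h6 := Finset.cast_card_sdiff_ge D (D₁ ∪ D₂)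
    have h7 := Finset.cast_card_union_le D₁ D₂
    rw [c1, c2] at h7
    push_cast at h3
    linarith
  · have hrich : S.Rich k δ := by
      have hsub : ∀ c i j : ι, c ≠ i → c ≠ j → S.U k c ⊆ S.Cl k \ (S.U k i ∪ S.U k j) := by
        intro c i j hi hj v hv
        simp only [Finset.mem_sdiff, Finset.mem_union, mem_U, mem_Cl] at hv ⊢
        refine ⟨hv.1, ?_⟩
        rintro (h | h)
        · exact hi (hv.2.symm.trans h.2)
        · exact hj (hv.2.symm.trans h.2)
      intro i j
      by_cases h1 : c₁ = i
      · by_cases h2 : c₂ = j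
        · rw [← h1, ← h2]; exact hsδ
        · have := Finset.cast_card_mono (hsub c₂ i j (fun h => hc (h1.trans h.symm)) h2)
          linarith
      · by_cases h1' : c₁ = j
        · by_cases h2 : c₂ = i
          · rw [← h1', ← h2, Finset.union_comm]; exact hsδ
          · have := Finset.cast_card_mono (hsub c₂ i j h2 (fun h => hc (h1'.trans h.symm)))
            linarith
        · have := Finset.cast_card_mono (hsub c₁ i j h1 h1')
          linarith
    obtain ⟨Q, hQ⟩ := exists_hub hκ hrich (by linarith)
    have hDU : D ⊆ S.U k.other Q := by
      intro y hy
      obtain ⟨x₁, x₂, k₁, k₂, hn, hg, e1, e2, -⟩ := key y hy y hy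
      rw [mem_U]
      refine ⟨by simpa using (Finset.mem_sdiff.1 hy).1, ?_⟩
      exact (S.tri (S.symm e1) (hQ x₁ x₂ k₁ k₂ hn hg) e2).1
    -- The cap `3 / 2 * t` lies below the sizes of the two large homes and is already too large for
    -- a packing.
    obtain ⟨n, n1, n2⟩ := exists_nat_near (x := min s (3 / 2 * t)) (by
      apply le_min <;> linarith)
    have m1 := min_le_left s (3 / 2 * t)
    have m2 := min_le_right s (3 / 2 * t)
    have hf : ∀ i j : ι, i ≠ j → S.Full k.other Q (S.U k i) (S.U k j) := by
      intro i j hij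
      refine hQ.full (by linarith) (U_subset_Cl _ _) (U_subset_Cl _ _) fun x hx y hy h => ?_
      rw [mem_U] at hx hy
      exact hij (hx.2.symm.trans (h.trans hy.2))
    have hf' : ∀ c, c = c₁ ∨ c = c₂ →
        S.Full k.other Q (S.Cl k \ (S.U k c₁ ∪ S.U k c₂)) (S.U k c) := by
      intro c hc'
      refine hQ.full (by linarith) Finset.sdiff_subset (U_subset_Cl _ _) fun x hx y hy h => ?_
      simp only [Finset.mem_sdiff, Finset.mem_union, mem_U, mem_Cl] at hx hy
      rcases hc' with rfl | rfl
      · exact hx.2 (Or.inl ⟨hx.1, h.trans hy.2⟩)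
      · exact hx.2 (Or.inr ⟨hx.1, h.trans hy.2⟩)
    obtain ⟨X, hX, Y, hY, Z, hZ, c1, c2, c3, hP⟩ := Pk.tripartite (S := S) (Pk.nil (c := Q))
      (A := S.Cl k \ (S.U k c₁ ∪ S.U k c₂)) (B := S.U k c₁) (C := S.U k c₂)
      (Finset.disjoint_of_subset_right Finset.subset_union_left Finset.sdiff_disjoint)
      (Finset.disjoint_of_subset_right Finset.subset_union_right Finset.sdiff_disjoint)
      (disjoint_U hc) (by simp) (by simp) (by simp) (hf' c₁ (Or.inl rfl))
      (hf' c₂ (Or.inr rfl)).fullCol (hf c₁ c₂ hc).fullCol (n := n)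
      (by have := n1.trans m1; rw [hs] at this; exact_mod_cast this) (by linarith) (by linarith)
    have h3 := hP.three_mul_add_le hκ
    have h4 : D ⊆ S.U k.other Q \ (∅ ∪ X ∪ Y ∪ Z) := by
      have hdis : ∀ v ∈ D, v ∉ S.Cl k := fun v hv h =>
        Finset.disjoint_left.1 disjoint_Cl h (Finset.mem_sdiff.1 hv).1
      intro v hv
      simp only [Finset.mem_sdiff, Finset.mem_union, not_or]
      exact ⟨hDU hv, ⟨⟨by simp, fun h => hdis v hv (Finset.mem_sdiff.1 (hX h)).1⟩,
        fun h => hdis v hv (U_subset_Cl _ _ (hY h))⟩, fun h => hdis v hv (U_subset_Cl _ _ (hZ h))⟩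
    have h5 := Finset.cast_card_mono h4
    have h6 := hP.le
    push_cast at h3 h6
    rcases min_choice s (3 / 2 * t) with h | h <;> rw [h] at n2 <;> linarith

/-- Two large components of different colours. -/
theorem large_opposite (S : CleanColouring V ι t κ) (hκ : 10 ≤ κ) {k : EdgeColour} {c d : ι} :
    3 * ((S.U k.other d).card : ℝ) + (S.U k c).card ≤ 9 * t + 25 * κ ∨
    3 * ((S.U k c).card : ℝ) + (S.U k.other d).card ≤ 9 * t + 25 * κ := by
  obtain ⟨Y, hY, U₀, hU₀, y₁, u₁, f₁⟩ := exists_residue (S := S) hκ k c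
  obtain ⟨Y', hY', B₀, hB₀, y₂, u₂, f₂⟩ := exists_residue (S := S) hκ k.other d
  rw [EdgeColour.other_other] at hY' f₂
  have h1 := Finset.cast_card_sdiff_ge U₀ Y'
  have h2 := Finset.cast_card_sdiff_ge B₀ Y
  rcases lt_or_ge ((U₀ \ Y').card : ℝ) (10 * κ) with h | hX
  · right; linarith
  rcases lt_or_ge ((B₀ \ Y).card : ℝ) (10 * κ) with h | hZ
  · left; linarith
  exfalso
  -- Almost all pairs between the two residues have colour `k` when seen from `U₀`, and the other
  -- colour when seen from `B₀`; double counting finds a vertex at which these views conflict.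
  obtain ⟨z, hz, hz'⟩ := exists_many_neighbours (S := S) (k := k) (c := c) (D := U₀ \ Y')
    (X := B₀ \ Y) (ρ := (B₀ \ Y).card - 2 * κ) (m := (U₀ \ Y').card / 2) (by
      intro x hx
      simp only [Finset.mem_sdiff] at hx
      have hxU := mem_U.1 (hU₀ hx.1)
      have e1 := f₂ x (by simp [hxU.1]) hx.2
      rw [hxU.2] at e1
      have e2 := Finset.cast_card_sdiff_ge (B₀ \ Y) (S.miss k c x B₀)
      have e3 : (B₀ \ Y) \ S.miss k c x B₀ ⊆ (B₀ \ Y).filter fun y => S.E k c x y := by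
        intro y hy; simp at hy ⊢; exact ⟨hy.1, hy.2 hy.1.1⟩
      have e4 := Finset.cast_card_mono e3
      linarith) (by
      have : (0 : ℝ) < (U₀ \ Y').card * ((B₀ \ Y).card / 2 - 2 * κ) := by
        apply mul_pos <;> linarith
      nlinarith)
  simp only [Finset.mem_sdiff] at hz
  have hzU := mem_U.1 (hB₀ hz.1)
  have e1 := f₁ z (by simp [hzU.1]) hz.2
  have e2 : ((U₀ \ Y').filter fun x => S.E k c x z) ⊆ S.miss k.other (S.hm z) z U₀ := by
    intro x hx
    simp at hx ⊢
    exact ⟨hx.1.1, fun h => k.other_ne (S.uniq (S.symm h) hx.2).1⟩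
  have e3 := Finset.cast_card_mono e2
  linarith

/-- With `n` triangles across `A`, `N`, `D`, followed by triangles with two of the remaining
vertices of `D` and one of `N`, the total is about `n + (|D| - n) / 2`. This exceeds `t` once `n`
exceeds `2 * t - |D|`. -/
theorem card_le_of_many_neighbours (hκ : 10 ≤ κ) (hδ : 1000 * κ ≤ δ)
    {k : EdgeColour} {c : ι} {N A : Finset V} (hN : N ⊆ S.Cl k.other) (hA : A ⊆ S.Cl k.other)
    (hAN : Disjoint A N) (fN : S.Full k c N (S.U k c)) (fA : S.FullCol k A N)
    (hNA : t + 40 * δ ≤ N.card) (hc : ((S.U k c).card : ℝ) ≤ 2 * t + 10 * δ)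
    (h : ∀ y ∈ A, 2 * t - (S.U k c).card + 30 * δ ≤
      (((S.U k c).filter fun x => S.E k c y x).card : ℝ)) :
    (A.card : ℝ) ≤ 2 * t - (S.U k c).card + 30 * δ := by
  by_contra hlt
  push Not at hlt
  set D := S.U k c with hD
  obtain ⟨y₀, hy₀, -⟩ := Finset.exists_mem_notMem_of_card (A := A) (B := (∅ : Finset V))
    (by rw [Finset.card_empty]; push_cast; linarith)
  have hDt := h y₀ hy₀
  have hDt' := Finset.cast_card_mono (Finset.filter_subset (fun x => S.E k c y₀ x) D)
  have dN : Disjoint N D := (Finset.disjoint_of_subset_left (hD ▸ U_subset_Cl _ _)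
    (Finset.disjoint_of_subset_right hN disjoint_Cl)).symm
  have dA : Disjoint A D := (Finset.disjoint_of_subset_left (hD ▸ U_subset_Cl _ _)
    (Finset.disjoint_of_subset_right hA disjoint_Cl)).symm
  obtain ⟨n, n1, n2⟩ := exists_nat_near (x := 2 * t - D.card + 30 * δ - 10 * κ) (by linarith)
  obtain ⟨X, hX, Y, hY, Z, hZ, cX, cY, cZ, hP⟩ :=
    (Pk.nil (S := S) (k := k) (c := c)).greedy A N D n (by
      intro X hX Y hY Z hZ cX cY cZ
      have c2' : (Y.card : ℝ) + 1 ≤ n := by exact_mod_cast cY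
      have c3' : (Z.card : ℝ) + 1 ≤ n := by exact_mod_cast cZ
      have c1' : (X.card : ℝ) + 1 ≤ n := by exact_mod_cast cX
      obtain ⟨y, hy, hyX⟩ := Finset.exists_mem_notMem_of_card (A := A) (B := X) (by linarith)
      obtain ⟨d, hd, dY, hdy⟩ := Finset.exists_mem_notMem₂ (A := N) (B := Y)
        (C := N.filter fun z => ¬ ∃ e, S.E k e y z) (by linarith [fA y hy])
      obtain ⟨x, hx, xZ, hxd⟩ := Finset.exists_mem_notMem₂ (A := D.filter fun x => S.E k c y x)
        (B := Z) (C := S.miss k c d D) (by linarith [fN d hd, h y hy])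
      simp only [Finset.mem_filter, not_and, not_not, mem_miss] at hdy hx hxd
      obtain ⟨e, he⟩ := hdy hd
      refine ⟨y, hy, d, hd, x, hx.1, (T.of_E hx.2 he (S.symm (hxd hx.1))).comm₂, ?_, ?_, ?_⟩ <;>
        simp only [Finset.mem_union, not_or]
      · exact ⟨⟨⟨by simp, hyX⟩, fun h => Finset.disjoint_left.1 hAN hy (hY h)⟩,
          fun h => Finset.disjoint_left.1 dA hy (hZ h)⟩
      · exact ⟨⟨⟨by simp, fun h => Finset.disjoint_left.1 hAN (hX h) hd⟩, dY⟩,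
          fun h => Finset.disjoint_left.1 dN hd (hZ h)⟩
      · exact ⟨⟨⟨by simp, fun h => Finset.disjoint_left.1 dA (hX h) hx.1⟩,
          fun h => Finset.disjoint_left.1 dN (hY h) hx.1⟩, xZ⟩)
  have e1 := Finset.cast_card_sdiff_ge D Z
  have e2 := Finset.cast_card_sdiff_ge N Y
  rw [cZ] at e1
  rw [cY] at e2
  obtain ⟨m, m1, m2⟩ := exists_nat_near (x := (D.card - n - 6 * κ) / 2) (by linarith)
  obtain ⟨D₁, -, D₂, -, X', -, -, -, -, hP'⟩ := hP.pair_of_full (D := D \ Z) (X := N \ Y)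
    (Finset.sdiff_subset.trans (by rw [hD]))
    (Finset.disjoint_of_subset_left Finset.sdiff_subset
      (Finset.disjoint_of_subset_right Finset.sdiff_subset dN)) (by
      rw [Finset.disjoint_left]; intro v hv
      simp only [Finset.mem_sdiff, Finset.mem_union, not_or] at hv ⊢
      exact ⟨⟨⟨by simp, fun h => Finset.disjoint_left.1 hAN (hX h) hv.1⟩, hv.2⟩,
        fun h => Finset.disjoint_left.1 dN hv.1 (hZ h)⟩) (by
      rw [Finset.disjoint_left]; intro v hv
      simp only [Finset.mem_sdiff, Finset.mem_union, not_or] at hv ⊢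
      exact ⟨⟨⟨by simp, fun h => Finset.disjoint_left.1 dA (hX h) hv.1⟩,
        fun h => Finset.disjoint_left.1 dN (hY h) hv.1⟩, hv.2⟩)
    (fN.mono Finset.sdiff_subset Finset.sdiff_subset) (n := m)
    (by
      have : (m : ℝ) ≤ (N \ Y).card := by linarith
      exact_mod_cast this) (by linarith)
  have := hP'.le
  push_cast at this
  linarith

/-- Packing in the hub component: first `m` triangles with two vertices in the hub and one in `X`,
then `s` triangles across `B`, `X` and `A`, and then triangles inside the hub. -/
theorem hub_pack_partial (hκ : 10 ≤ κ) (hδ : 1000 * κ ≤ δ) (ht : 1000000 * δ ≤ t)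
    (hδ' : 100 * κ * t ≤ δ ^ 2) {k : EdgeColour} {c : ι} {Z X A B : Finset V} (hZ : Z ⊆ S.U k c)
    (hX : X ⊆ S.Cl k.other) (hA : A ⊆ S.Cl k.other) (hB : B ⊆ S.Cl k.other)
    (dBX : Disjoint B X) (dBA : Disjoint B A) (dXA : Disjoint X A)
    (fBX : S.Full k c B X) (fBA : S.Full k c B A) (fXA : S.Full k c X A) {ρ m s : ℝ}
    (hρ : ∀ z ∈ Z, ρ ≤ ((X.filter fun x => S.E k c z x).card : ℝ)) (hm : 0 ≤ m)
    (hmZ : 2 * m + δ ≤ Z.card) (hmρ : m + δ ≤ ρ) (hXt : (X.card : ℝ) ≤ 4 * t) (hs : 0 ≤ s)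
    (hsB : s ≤ B.card) (hsA : s + 10 * κ ≤ A.card) (hsX : s + m + 10 * κ ≤ X.card) :
    3 * s + m + (S.U k c).card ≤ 3 * t + 20 * κ := by
  have dU : ∀ {F : Finset V}, F ⊆ S.Cl k.other → ∀ v ∈ S.U k c, v ∉ F := fun hF v hv h =>
    Finset.disjoint_left.1 disjoint_Cl (U_subset_Cl _ _ hv) (hF h)
  have dX : Disjoint X Z := (Finset.disjoint_of_subset_left (hZ.trans (U_subset_Cl _ _))
    (Finset.disjoint_of_subset_right hX disjoint_Cl)).symm
  obtain ⟨n, n1, n2⟩ := exists_nat_near hm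
  obtain ⟨l, l1, l2⟩ := exists_nat_near hs
  obtain ⟨D₁, hD₁, D₂, hD₂, X', hX', c1, c2, c3, hP⟩ :=
    Pk.pair_of_partial Pk.nil hZ dX (by simp) (by simp) hρ (by linarith) (n := n) (by linarith) (by
      -- The double counting of `pair_of_partial` needs `κ * |X| < δ ^ 2`, hence the hypothesis
      -- relating `κ * t` to `δ ^ 2`.
      have e1 : δ * δ ≤ (ρ - n) * (Z.card - 2 * n) := by
        apply mul_le_mul <;> linarith
      have e2 : κ * X.card ≤ κ * (4 * t) := by gcongr
      have e3 : 0 < κ * t := by apply mul_pos <;> linarith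
      nlinarith)
  have e1 := Finset.cast_card_sdiff_ge X X'
  rw [c3] at e1
  obtain ⟨B', hB', Y, hY, A', hA', c4, c5, c6, hP'⟩ := hP.tripartite (A := B) (B := X \ X') (C := A)
    (Finset.disjoint_of_subset_right Finset.sdiff_subset dBX) dBA
    (Finset.disjoint_of_subset_left Finset.sdiff_subset dXA) (by
      rw [Finset.disjoint_right]; intro v hv hvB
      simp only [Finset.mem_union] at hv
      rcases hv with ((hv | hv) | hv) | hv
      · simp at hv
      · exact dU hB v (hZ (hD₁ hv)) hvB
      · exact dU hB v (hZ (hD₂ hv)) hvB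
      · exact Finset.disjoint_left.1 dBX hvB (hX' hv)) (by
      rw [Finset.disjoint_right]; intro v hv hvB
      simp only [Finset.mem_union, Finset.mem_sdiff] at hv hvB
      rcases hv with ((hv | hv) | hv) | hv
      · simp at hv
      · exact dU hX v (hZ (hD₁ hv)) hvB.1
      · exact dU hX v (hZ (hD₂ hv)) hvB.1
      · exact hvB.2 hv) (by
      rw [Finset.disjoint_right]; intro v hv hvB
      simp only [Finset.mem_union] at hv
      rcases hv with ((hv | hv) | hv) | hv
      · simp at hv
      · exact dU hA v (hZ (hD₁ hv)) hvB
      · exact dU hA v (hZ (hD₂ hv)) hvB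
      · exact Finset.disjoint_left.1 dXA (hX' hv) hvB)
    (fBX.mono subset_rfl Finset.sdiff_subset) fBA.fullCol
    (fXA.mono Finset.sdiff_subset subset_rfl).fullCol (n := l)
    (by exact_mod_cast l1.trans hsB) (by linarith) (by linarith)
  have h3 := hP'.three_mul_add_le hκ
  have h4 : S.U k c \ (D₁ ∪ D₂) ⊆ S.U k c \ (∅ ∪ D₁ ∪ D₂ ∪ X' ∪ B' ∪ Y ∪ A') := by
    intro v hv
    simp only [Finset.mem_sdiff, Finset.mem_union, not_or] at hv ⊢
    exact ⟨hv.1, ⟨⟨⟨⟨⟨by simp, hv.2.1⟩, hv.2.2⟩, dU (hX'.trans hX) v hv.1⟩,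
      dU (hB'.trans hB) v hv.1⟩, dU (hY.trans (Finset.sdiff_subset.trans hX)) v hv.1⟩,
      dU (hA'.trans hA) v hv.1⟩
  have h5 := Finset.cast_card_mono h4
  have h6 := Finset.cast_card_sdiff_ge (S.U k c) (D₁ ∪ D₂)
  have h7 := Finset.cast_card_union_le D₁ D₂
  rw [c1, c2] at h7
  push_cast at h3
  linarith

/-- These triangles avoid the home of the component, so all of it remains for `Pk.three_mul_add_le`.
-/
theorem hub_pack (hκ : 10 ≤ κ) {k : EdgeColour} {c : ι} {X A B : Finset V}
    (hX : X ⊆ S.Cl k.other) (hA : A ⊆ S.Cl k.other) (hB : B ⊆ S.Cl k.other)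
    (dBX : Disjoint B X) (dBA : Disjoint B A) (dXA : Disjoint X A)
    (fBX : S.Full k c B X) (fBA : S.Full k c B A) (fXA : S.Full k c X A) {s : ℝ}
    (hs : 0 ≤ s) (hsB : s ≤ B.card) (hsA : s + 10 * κ ≤ A.card) (hsX : s + 10 * κ ≤ X.card) :
    3 * s + (S.U k c).card ≤ 3 * t + 20 * κ := by
  obtain ⟨l, l1, l2⟩ := exists_nat_near hs
  obtain ⟨B', hB', Y, hY, A', hA', c4, c5, c6, hP'⟩ := (Pk.nil (S := S) (k := k) (c := c)).tripartite
    (A := B) (B := X) (C := A) dBX dBA dXA (by simp) (by simp) (by simp) fBX fBA.fullCol fXA.fullCol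
    (n := l) (by exact_mod_cast l1.trans hsB) (by linarith) (by linarith)
  have h3 := hP'.three_mul_add_le hκ
  have h4 : S.U k c ⊆ S.U k c \ (∅ ∪ B' ∪ Y ∪ A') := by
    have dU : ∀ {F : Finset V}, F ⊆ S.Cl k.other → ∀ v ∈ S.U k c, v ∉ F := fun hF v hv h =>
      Finset.disjoint_left.1 disjoint_Cl (U_subset_Cl _ _ hv) (hF h)
    intro v hv
    simp only [Finset.mem_sdiff, Finset.mem_union, not_or]
    exact ⟨hv, ⟨⟨by simp, dU (hB'.trans hB) v hv⟩, dU (hY.trans hX) v hv⟩, dU (hA'.trans hA) v hv⟩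
  have h5 := Finset.cast_card_mono h4
  push_cast at h3
  linarith

/-! ### The hub and one further home do not exhaust the other colour. -/

variable (S) in
/-- No vertex of `X` has the same home component as a vertex of `Y`. -/
def Apart (X Y : Finset V) : Prop := ∀ x ∈ X, ∀ y ∈ Y, S.hm x ≠ S.hm y

theorem Apart.symm {X Y : Finset V} (h : S.Apart X Y) : S.Apart Y X :=
  fun y hy x hx => (h x hx y hy).symm

theorem Apart.disjoint {X Y : Finset V} (h : S.Apart X Y) : Disjoint X Y :=
  Finset.disjoint_left.2 fun v hv hv' => h v hv v hv' rfl

theorem apart_U {k : EdgeColour} {i j : ι} (h : i ≠ j) : S.Apart (S.U k i) (S.U k j) := by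
  intro x hx y hy
  rw [mem_U] at hx hy
  rw [hx.2, hy.2]; exact h

theorem apart_rest {k : EdgeColour} {i : ι} {X : Finset V} (hX : X ⊆ S.Cl k)
    (h : Disjoint X (S.U k i)) : S.Apart X (S.U k i) := by
  intro x hx y hy
  have := Finset.disjoint_left.1 h hx
  have h1 := hX hx
  simp at h1 hy this
  rw [hy.2]; exact this h1

theorem disjoint_rest_left {k : EdgeColour} {i j : ι} :
    Disjoint (S.Cl k \ (S.U k i ∪ S.U k j)) (S.U k i) :=
  Finset.disjoint_of_subset_right Finset.subset_union_left Finset.sdiff_disjoint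

theorem disjoint_rest_right {k : EdgeColour} {i j : ι} :
    Disjoint (S.Cl k \ (S.U k i ∪ S.U k j)) (S.U k j) :=
  Finset.disjoint_of_subset_right Finset.subset_union_right Finset.sdiff_disjoint

theorem IsHub.pack {k : EdgeColour} {Q : ι} (hQ : S.IsHub k Q) (hκ : 10 ≤ κ) {X A B : Finset V}
    (hX : X ⊆ S.Cl k) (hA : A ⊆ S.Cl k) (hB : B ⊆ S.Cl k) (aBX : S.Apart B X) (aBA : S.Apart B A)
    (aXA : S.Apart X A) {s : ℝ} (hsB : s ≤ B.card) (hsA : s ≤ A.card) (hsX : s ≤ X.card)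
    (hs : 10 * κ ≤ s) : 3 * s + (S.U k.other Q).card ≤ 3 * t + 50 * κ := by
  have := hub_pack (S := S) hκ (k := k.other) (c := Q) (X := X) (A := A) (B := B)
    (by rwa [EdgeColour.other_other]) (by rwa [EdgeColour.other_other])
    (by rwa [EdgeColour.other_other]) aBX.disjoint aBA.disjoint aXA.disjoint
    (hQ.full (by linarith) hB hX aBX) (hQ.full (by linarith) hB hA aBA)
    (hQ.full (by linarith) hX hA aXA) (s := s - 10 * κ) (by linarith) (by linarith) (by linarith)
    (by linarith)
  linarith

/-- A union of fibres of the home map whose size is close to a given number. -/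
theorem exists_union_of_homes (S : CleanColouring V ι t κ) (A : Finset V) {x M : ℝ} (hx : x ≤ A.card)
    (hM : ∀ i, ((A.filter fun v => S.hm v = i).card : ℝ) ≤ M) :
    ∃ P ⊆ A, S.Apart P (A \ P) ∧ x ≤ P.card ∧ (P.card : ℝ) ≤ max 0 (x + M) := by
  have hne : (A.powerset.filter fun P => S.Apart P (A \ P) ∧ x ≤ (P.card : ℝ)).Nonempty :=
    ⟨A, by simpa using ⟨by intro a _ b hb; simp at hb, hx⟩⟩
  -- For a smallest admissible union of fibres, dropping one fibre brings the size below `x`; this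
  -- bounds the size by `x + M`.
  obtain ⟨P, hP, hmin⟩ := Finset.exists_min_image _ Finset.card hne
  simp only [Finset.mem_filter, Finset.mem_powerset] at hP hmin
  refine ⟨P, hP.1, hP.2.1, hP.2.2, ?_⟩
  by_contra hc
  push Not at hc
  have h0 := (le_max_left _ _).trans_lt hc
  have h1 := (le_max_right _ _).trans_lt hc
  obtain ⟨v, hv⟩ : P.Nonempty := by
    rw [← Finset.card_pos]; exact_mod_cast h0
  have h2 : P.filter (fun w => S.hm w ≠ S.hm v) ⊂ P :=
    Finset.filter_ssubset.2 ⟨v, hv, by simp⟩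
  have h3 := Finset.card_filter_add_card_filter_not (s := P) (fun w => S.hm w = S.hm v)
  have h4 := Finset.cast_card_mono (Finset.filter_subset_filter (fun w => S.hm w = S.hm v) hP.1)
  have h5 := hM (S.hm v)
  have h6 : ((P.filter fun w => S.hm w = S.hm v).card : ℝ) +
      (P.filter fun w => ¬ S.hm w = S.hm v).card = P.card := by exact_mod_cast h3
  have := hmin (P.filter fun w => S.hm w ≠ S.hm v) ⟨h2.subset.trans hP.1, ?_, by
    simp only [ne_eq]; linarith⟩
  · have := Finset.card_lt_card h2
    omega
  · intro a ha b hb h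
    simp only [Finset.mem_filter, Finset.mem_sdiff, not_and, not_not] at ha hb
    by_cases hbP : b ∈ P
    · exact ha.2 (h.trans (hb.2 hbP))
    · exact hP.2.1 a ha.1 b (by simp [hb.1, hbP]) h

/-- By `card_le_of_many_neighbours`, few vertices with home `Q` have many neighbours in `U k i`
inside the component `i`. All others have at least `ρ` neighbours there inside the hub component. So
the triangles across the three parts of colour `k` can be preceded by `m` triangles with two
vertices at home in the hub and one in `U k i`. -/
theorem hub_bound (hκ : 10 ≤ κ) (hδ : 1000 * κ ≤ δ) (ht : 1000000 * δ ≤ t)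
    (hδ' : 100 * κ * t ≤ δ ^ 2) {k : EdgeColour} {Q o i j : ι} (hij : i ≠ j) (hQ : S.IsHub k Q)
    (hoQ : o ≠ Q) {N : Finset V} (hN : N ⊆ S.U k.other o) (fN : S.Full k i N (S.U k i))
    (hNt : t + 40 * δ ≤ N.card) (hi : ((S.U k i).card : ℝ) ≤ 2 * t + 10 * δ)
    (hs : 10 * κ ≤ (S.Cl k \ (S.U k i ∪ S.U k j)).card)
    (hsj : ((S.Cl k \ (S.U k i ∪ S.U k j)).card : ℝ) ≤ (S.U k j).card)
    (hq : 3 * ((S.Cl k \ (S.U k i ∪ S.U k j)).card : ℝ) + (S.U k.other Q).card ≤ 3 * t + 50 * κ) :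
    ((S.U k.other Q).card : ℝ) + 2 * (S.Cl k \ (S.U k i ∪ S.U k j)).card + (S.U k i).card ≤
      4 * t + 100 * δ ∨
    ((S.U k.other Q).card : ℝ) + 3 * (S.Cl k \ (S.U k i ∪ S.U k j)).card + 2 * (S.U k i).card ≤
      5 * t + 100 * δ := by
  set B := S.Cl k \ (S.U k i ∪ S.U k j) with hB
  set Tt := (S.U k.other Q).filter fun y => 2 * t - (S.U k i).card + 30 * δ ≤
      (((S.U k i).filter fun x => S.E k i y x).card : ℝ) with hT
  have bT := card_le_of_many_neighbours hκ hδ (k := k) (c := i) (N := N) (A := Tt)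
    (hN.trans (U_subset_Cl _ _)) ((Finset.filter_subset _ _).trans (U_subset_Cl _ _))
    (Finset.disjoint_of_subset_left (Finset.filter_subset _ _)
      (Finset.disjoint_of_subset_right hN (disjoint_U hoQ.symm))) fN (by
      intro y hy
      have : (N.filter fun z => ¬ ∃ d, S.E k d y z) ⊆ S.bad y := by
        intro z hz
        rw [Finset.mem_filter] at hz
        rw [mem_bad]
        intro hg
        have hzU := hN hz.1
        have hyU := (Finset.mem_filter.1 hy).1
        rw [mem_U] at hzU hyU
        have := S.good_same hg (hyU.1.trans hzU.1.symm) (by rw [hyU.2, hzU.2]; exact hoQ.symm)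
        rw [hyU.1, EdgeColour.other_other] at this
        exact hz.2 this
      have := Finset.cast_card_mono this
      linarith [S.card_bad y]) hNt hi (fun y hy => (Finset.mem_filter.1 hy).2)
  set Z := S.U k.other Q \ Tt with hZ
  have cZ := Finset.cast_card_sdiff_ge (S.U k.other Q) Tt
  set ρ : ℝ := 2 * (S.U k i).card - 2 * t - 30 * δ - κ with hρ
  have fρ : ∀ z ∈ Z, ρ ≤ (((S.U k i).filter fun x => S.E k.other Q z x).card : ℝ) := by
    intro z hz
    simp only [hZ, hT, Finset.mem_sdiff, Finset.mem_filter, not_and, not_le] at hz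
    have h1 := hz.2 hz.1
    have h2 : S.U k i ⊆ ((S.U k i).filter fun x => S.E k.other Q z x) ∪
        (((S.U k i).filter fun x => S.E k i z x) ∪ S.bad z) := by
      intro x hx
      simp only [Finset.mem_union, Finset.mem_filter, mem_bad]
      by_cases hg : S.Good z x
      · by_cases hE : S.E k i z x
        · exact Or.inr (Or.inl ⟨hx, hE⟩)
        · have hzU := mem_U.1 hz.1
          have := good_other (S.good_symm hg) hx hzU.1 (fun h => hE (S.symm h))
          rw [hzU.2] at this
          exact Or.inl ⟨hx, S.symm this⟩
      · exact Or.inr (Or.inr hg)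
    have h3 := Finset.cast_card_mono h2
    have h4 := Finset.cast_card_union_le ((S.U k i).filter fun x => S.E k.other Q z x)
      (((S.U k i).filter fun x => S.E k i z x) ∪ S.bad z)
    have h5 := Finset.cast_card_union_le ((S.U k i).filter fun x => S.E k i z x) (S.bad z)
    linarith [S.card_bad z]
  by_contra hc
  push Not at hc
  have hm1 : 0 ≤ (Z.card : ℝ) / 2 - δ := by linarith
  have hm2 : 0 ≤ ρ - δ := by linarith
  have hm3 : 0 ≤ t - B.card + 50 * κ := by linarith
  -- The last term keeps `|B| + m` near `t`, so that `U k i` has enough vertices for both kinds of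
  -- triangles.
  set m := min (min ((Z.card : ℝ) / 2 - δ) (ρ - δ)) (t - B.card + 50 * κ) with hm
  have m1 : m ≤ (Z.card : ℝ) / 2 - δ := (min_le_left _ _).trans (min_le_left _ _)
  have m2 : m ≤ ρ - δ := (min_le_left _ _).trans (min_le_right _ _)
  have m3 : m ≤ t - B.card + 50 * κ := min_le_right _ _
  have aBi : S.Apart B (S.U k i) := apart_rest Finset.sdiff_subset disjoint_rest_left
  have aBj : S.Apart B (S.U k j) := apart_rest Finset.sdiff_subset disjoint_rest_right
  have aij : S.Apart (S.U k i) (S.U k j) := apart_U hij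
  have hBs : B ⊆ S.Cl k := Finset.sdiff_subset
  have := hub_pack_partial hκ hδ ht hδ' (S := S) (k := k.other) (c := Q) (Z := Z) (X := S.U k i)
    (A := S.U k j) (B := B) Finset.sdiff_subset (by rw [EdgeColour.other_other]; exact U_subset_Cl _ _)
    (by rw [EdgeColour.other_other]; exact U_subset_Cl _ _)
    (by rwa [EdgeColour.other_other])
    aBi.disjoint aBj.disjoint aij.disjoint
    (hQ.full (by linarith) hBs (U_subset_Cl _ _) aBi)
    (hQ.full (by linarith) hBs (U_subset_Cl _ _) aBj)
    (hQ.full (by linarith) (U_subset_Cl _ _) (U_subset_Cl _ _) aij) (ρ := ρ) (m := m)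
    (s := B.card - 10 * κ) fρ (le_min (le_min hm1 hm2) hm3) (by linarith) (by linarith)
    (by linarith) (by linarith) (by linarith) (by linarith) (by linarith)
  have hmc : m = (Z.card : ℝ) / 2 - δ ∨ m = ρ - δ ∨ m = t - B.card + 50 * κ := by
    rcases min_choice (min ((Z.card : ℝ) / 2 - δ) (ρ - δ)) (t - B.card + 50 * κ) with h | h
    · rcases min_choice ((Z.card : ℝ) / 2 - δ) (ρ - δ) with h' | h'
      · exact Or.inl (hm.trans (h.trans h'))
      · exact Or.inr (Or.inl (hm.trans (h.trans h')))
    · exact Or.inr (Or.inr (hm.trans h))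
  rcases hmc with h | h | h <;> rw [h] at this <;> linarith

/-- The two components of the other colour that cover almost all of its vertices cannot include the
hub. -/
theorem hub_case [Nonempty ι] (S : CleanColouring V ι t κ) (hκ : 10 ≤ κ) (hδ : 1000 * κ ≤ δ)
    (ht : 1000000 * δ ≤ t) (hδ' : 100 * κ * t ≤ δ ^ 2) {k : EdgeColour} {Q o c₁ c₂ : ι}
    (hc : c₁ ≠ c₂) (h₁ : ∀ i, (S.U k i).card ≤ (S.U k c₁).card)
    (h₂ : ∀ i, i ≠ c₁ → (S.U k i).card ≤ (S.U k c₂).card) (hr : S.Rich k (10000 * δ))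
    (hQ : S.IsHub k Q) (hoQ : o ≠ Q)
    (hcov : ((S.Cl k.other \ (S.U k.other Q ∪ S.U k.other o)).card : ℝ) ≤ 20 * κ) : False := by
  have hV := card_Cl_add S k
  have hR := card_Cl_eq S k hc
  have hB := card_Cl_eq S k.other hoQ.symm
  have hs := hr c₁ c₂
  have h21 : ((S.U k c₂).card : ℝ) ≤ (S.U k c₁).card := by exact_mod_cast h₁ c₂
  have u1 := card_U_le (S := S) hκ k c₁
  have uo := card_U_le (S := S) hκ k.other o
  set B := S.Cl k \ (S.U k c₁ ∪ S.U k c₂) with hBd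
  have aB1 : S.Apart B (S.U k c₁) := apart_rest Finset.sdiff_subset disjoint_rest_left
  have aB2 : S.Apart B (S.U k c₂) := apart_rest Finset.sdiff_subset disjoint_rest_right
  have a12 : S.Apart (S.U k c₁) (S.U k c₂) := apart_U hc
  have hBs : B ⊆ S.Cl k := Finset.sdiff_subset
  have opp := large_opposite S hκ (k := k) (c := c₁) (d := o)
  have fib : ∀ A ⊆ S.Cl k, ∀ i, (A.filter fun v => S.hm v = i).card ≤ (S.U k i).card := by
    intro A hA i
    apply Finset.card_le_card
    intro v hv
    rw [Finset.mem_filter] at hv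
    have := hA hv.1
    simp at this ⊢
    exact ⟨this, hv.2⟩
  -- If `B` is larger than the second home, colour `k` can be split along homes into three groups,
  -- large enough for a hub packing that contradicts the total count. The groups depend on how `x`
  -- compares with the two largest homes.
  rcases lt_or_ge ((S.U k c₂).card : ℝ) B.card with hlt | hge
  · set x : ℝ := (B.card + (S.U k c₂).card) / 3 with hx
    have fin : 3 * (x - δ) + (S.U k.other Q).card ≤ 3 * t + 50 * κ → False := by
      intro h
      rcases opp with h | h <;> linarith
    rcases le_or_gt (x - δ) ((S.U k c₂).card : ℝ) with h | h
    · exact fin (hQ.pack hκ (U_subset_Cl k c₂) (U_subset_Cl k c₁) hBs aB2 aB1 a12.symm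
        (by linarith) (by linarith) h (by linarith))
    rcases le_or_gt (x - δ) ((S.U k c₁).card : ℝ) with h' | h'
    · obtain ⟨P, hP, aP, p1, p2⟩ := exists_union_of_homes S (S.Cl k \ S.U k c₁) (x := x - δ)
        (M := (S.U k c₂).card) (by
          have := Finset.cast_card_sdiff_ge (S.Cl k) (S.U k c₁)
          linarith) (by
          intro i
          by_cases hi : i = c₁
          · have : ((S.Cl k \ S.U k c₁).filter fun v => S.hm v = i) = ∅ := by
              ext v; simp [hi]; tauto
            rw [this]; simp
          · exact_mod_cast (fib _ Finset.sdiff_subset i).trans (h₂ i hi))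
      rw [max_eq_right (by linarith [(Nat.cast_nonneg (S.U k c₂).card : (0 : ℝ) ≤ _)])] at p2
      have e1 := Finset.cast_card_sdiff_ge (S.Cl k) (S.U k c₁)
      have e2 := Finset.cast_card_sdiff_ge (S.Cl k \ S.U k c₁) P
      have sP : P ⊆ S.Cl k := hP.trans Finset.sdiff_subset
      have sP' : (S.Cl k \ S.U k c₁) \ P ⊆ S.Cl k := Finset.sdiff_subset.trans Finset.sdiff_subset
      exact fin (hQ.pack hκ sP' (U_subset_Cl k c₁) sP aP
        (apart_rest sP (Finset.disjoint_of_subset_left hP Finset.sdiff_disjoint))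
        (apart_rest sP' (Finset.disjoint_of_subset_left Finset.sdiff_subset Finset.sdiff_disjoint))
        p1 h' (by linarith) (by linarith))
    · have hM : ∀ A ⊆ S.Cl k, ∀ i, ((A.filter fun v => S.hm v = i).card : ℝ) ≤ (S.U k c₁).card :=
        fun A hA i => by exact_mod_cast (fib A hA i).trans (h₁ i)
      have n1 : (0 : ℝ) ≤ (S.U k c₁).card := Nat.cast_nonneg _
      obtain ⟨P, hP, aP, p1, p2⟩ := exists_union_of_homes S (S.Cl k)
        (x := x - (S.U k c₁).card / 3) (M := (S.U k c₁).card) (by linarith) (hM _ subset_rfl)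
      rw [max_eq_right (by linarith)] at p2
      have e1 := Finset.cast_card_sdiff_ge (S.Cl k) P
      obtain ⟨P', hP', aP', p1', p2'⟩ := exists_union_of_homes S (S.Cl k \ P)
        (x := x - (S.U k c₁).card / 3) (M := (S.U k c₁).card) (by linarith)
        (hM _ Finset.sdiff_subset)
      rw [max_eq_right (by linarith)] at p2'
      have e2 := Finset.cast_card_sdiff_ge (S.Cl k \ P) P'
      have := hQ.pack hκ (hP'.trans Finset.sdiff_subset)
        (Finset.sdiff_subset.trans Finset.sdiff_subset : (S.Cl k \ P) \ P' ⊆ S.Cl k) hP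
        (fun a ha b hb => aP a ha b (hP' hb))
        (fun a ha b hb => aP a ha b (Finset.sdiff_subset hb)) aP'
        p1 (by linarith) p1' (by linarith)
      linarith [(Nat.cast_nonneg (S.U k.other Q).card : (0 : ℝ) ≤ _)]
  · have hq := hQ.pack hκ (U_subset_Cl k c₂) (U_subset_Cl k c₁) hBs aB2 aB1 a12.symm
      le_rfl (by linarith) hge (by linarith)
    set N : ι → Finset V := fun i => (S.U k.other o).filter fun y =>
      ((S.miss k i y (S.U k i)).card : ℝ) ≤ 5 * κ with hN
    have sN : ∀ i, N i ⊆ S.U k.other o := fun i => Finset.filter_subset _ _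
    have fN : ∀ i, S.Full k i (N i) (S.U k i) := fun i y hy => (Finset.mem_filter.1 hy).2
    -- A vertex with home `o` in neither set would be joined, in the component `o`, to both ends of
    -- a hub edge; the triangle gives `o = Q`.
    have cN : ((S.U k.other o).card : ℝ) ≤ (N c₁).card + (N c₂).card := by
      refine (Finset.cast_card_mono ?_).trans (Finset.cast_card_union_le _ _)
      intro y hy
      by_contra hn
      simp only [hN, Finset.mem_union, Finset.mem_filter, not_or, not_and, not_le] at hn
      have hyU := mem_U.1 hy
      obtain ⟨x, hx, x1⟩ := Finset.exists_mem_notMem_of_card (A := S.miss k c₁ y (S.U k c₁))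
        (B := S.bad y) (by linarith [S.card_bad y, hn.1 hy])
      obtain ⟨x', hx', x1', x2'⟩ := Finset.exists_mem_notMem₂ (A := S.miss k c₂ y (S.U k c₂))
        (B := S.bad y) (C := S.bad x) (by linarith [S.card_bad y, S.card_bad x, hn.2 hy])
      simp only [mem_miss, mem_bad, not_not] at hx x1 hx' x1' x2'
      have e1 := good_other (S.good_symm x1) hx.1 hyU.1 (fun h => hx.2 (S.symm h))
      have e2 := good_other (S.good_symm x1') hx'.1 hyU.1 (fun h => hx'.2 (S.symm h))
      have e3 := hQ x x' (mem_U.1 hx.1).1 (mem_U.1 hx'.1).1 (a12 x hx.1 x' hx'.1) x2'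
      have := (S.tri e1 e3 (S.symm e2)).1
      rw [hyU.2] at this
      exact hoQ this
    have bN : ∀ i, 2 * t + 10 * δ < (S.U k i).card →
        (N i).card + ((S.U k i).card : ℝ) ≤ 3 * t + 20 * κ := by
      intro i hi
      rcases card_le_of_full (S := S) hκ subset_rfl (Finset.disjoint_of_subset_left
        ((sN i).trans (U_subset_Cl _ _)) (Finset.disjoint_of_subset_right (U_subset_Cl k i)
          disjoint_Cl.symm)) (fN i) with h | h <;> linarith
    have r2 : ((S.U k c₂).card : ℝ) ≤ 2 * t + 10 * δ := by
      by_contra h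
      push Not at h
      exact not_both_large S hκ hδ ht hc (by linarith) h.le
    rcases le_or_gt (t + 40 * δ) ((N c₁).card : ℝ) with hN1 | hN1
    · have r1 : ((S.U k c₁).card : ℝ) ≤ 2 * t + 10 * δ := by
        by_contra h
        push Not at h
        linarith [bN c₁ h]
      rcases hub_bound hκ hδ ht hδ' hc hQ hoQ (sN c₁) (fN c₁) hN1 r1 (by linarith) hge
        (by linarith) with h | h <;> rw [← hBd] at h <;> linarith
    rcases le_or_gt (t + 40 * δ) ((N c₂).card : ℝ) with hN2 | hN2
    · have hcomm : S.Cl k \ (S.U k c₂ ∪ S.U k c₁) = B := by rw [Finset.union_comm]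
      rcases hub_bound hκ hδ ht hδ' hc.symm hQ hoQ (sN c₂) (fN c₂) hN2 r2
        (by rw [hcomm]; linarith) (by rw [hcomm]; linarith) (by rw [hcomm]; linarith) with h | h <;>
        rw [hcomm] at h <;> rcases opp with h' | h' <;> linarith
    · have := bN c₁ (by linarith)
      linarith

/-! ### Types of the vertices outside the hub. -/

theorem card_le_of_forall_bad {A : Finset V} (w₁ w₂ w₃ w₄ : V) (h : ∀ v ∈ A, S.Good w₁ v →
    S.Good w₂ v → S.Good w₃ v → S.Good w₄ v → False) : (A.card : ℝ) ≤ 4 * κ := by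
  have h1 : A ⊆ (S.bad w₁ ∪ S.bad w₂) ∪ (S.bad w₃ ∪ S.bad w₄) := by
    intro v hv
    have := h v hv
    simp only [Finset.mem_union, mem_bad]
    tauto
  have h2 := Finset.cast_card_mono h1
  have h3 := Finset.cast_card_union_le (S.bad w₁ ∪ S.bad w₂) (S.bad w₃ ∪ S.bad w₄)
  have h4 := Finset.cast_card_union_le (S.bad w₁) (S.bad w₂)
  have h5 := Finset.cast_card_union_le (S.bad w₃) (S.bad w₄)
  linarith [S.card_bad w₁, S.card_bad w₂, S.card_bad w₃, S.card_bad w₄]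

theorem exists_max_card_U (S : CleanColouring V ι t κ) (k : EdgeColour) (P : ι → Prop)
    (h : ∃ i, P i) : ∃ i, P i ∧ ∀ j, P j → (S.U k j).card ≤ (S.U k i).card := by
  obtain ⟨i, hi, hmin⟩ := (measure fun i => Fintype.card V - (S.U k i).card).wf.has_min {i | P i} h
  refine ⟨i, hi, fun j hj => ?_⟩
  have h1 := hmin j hj
  have h2 := Finset.card_le_univ (S.U k i)
  have h3 := Finset.card_le_univ (S.U k j)
  simp only [WellFoundedRelation.rel, InvImage] at h1
  omega

theorem edge_or {k : EdgeColour} {x y : V} (hx : S.col x = k) (hy : S.col y = k.other)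
    (hg : S.Good x y) : S.E k (S.hm x) x y ∨ S.E k.other (S.hm y) x y := by
  have := S.good_diff hg (by rw [hx, hy]; exact k.other_ne.symm)
  rwa [hx, hy] at this

/-- The triangle on `x`, `x'`, `y` contains a hub edge, which would make the hub the home of `y`. So
`y` reaches essentially one home of colour `k` inside its own component. -/
theorem IsHub.not_both {k : EdgeColour} {Q : ι} (hQ : S.IsHub k Q) {x x' y : V} (hx : S.col x = k)
    (hx' : S.col x' = k) (hn : S.hm x ≠ S.hm x') (hg : S.Good x x') (hy : S.hm y ≠ Q)
    (h : S.E k.other (S.hm y) x y) (h' : S.E k.other (S.hm y) x' y) : False :=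
  hy (S.tri (S.symm h) (S.symm h') (hQ x x' hx hx' hn hg)).2

variable (S) in
/-- The vertex `y` is joined in its own component to almost all vertices with home `e`, and to
almost all vertices with another home of colour `k` in the component of those vertices. -/
def Ty (k : EdgeColour) (y : V) (e : ι) : Prop :=
  ((S.miss k.other (S.hm y) y (S.U k e)).card : ℝ) ≤ 4 * κ ∧
    ∀ c, c ≠ e → ((S.miss k c y (S.U k c)).card : ℝ) ≤ 4 * κ

/-- The edge `yz` lies in a component `c` of colour `k`. A vertex of colour `k` with another home
cannot be joined to both `y` and `z` in its own home, so it is joined to `y` in the home of `y` or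
to `z` in the home of `z`. By `IsHub.not_both`, each of `y` and `z` reaches only one home in this
way; these are `a` and `b`. -/
theorem exists_types {k : EdgeColour} {Q : ι} {η : ℝ} (hκ : 10 ≤ κ) (hr : S.Rich k η)
    (hη : 100 * κ ≤ η) (hQ : S.IsHub k Q) {y z : V} (hy : S.col y = k.other)
    (hz : S.col z = k.other) (hyQ : S.hm y ≠ Q) (hzQ : S.hm z ≠ Q) (hyz : S.hm y ≠ S.hm z)
    (hg : S.Good y z) : ∃ a b c, a ≠ b ∧ a ≠ c ∧ b ≠ c ∧ S.E k c y z ∧ S.Ty k y a ∧ S.Ty k z b ∧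
      ((S.Cl k \ (S.U k a ∪ (S.U k b ∪ S.U k c))).card : ℝ) ≤ 4 * κ := by
  obtain ⟨c, hc⟩ := S.good_same hg (hy.trans hz.symm) hyz
  rw [hy, EdgeColour.other_other] at hc
  have one : ∀ {y z}, S.col y = k.other → S.col z = k.other → S.E k c y z → ∀ x, S.col x = k →
      S.hm x ≠ c → S.Good y x → S.Good z x → S.E k.other (S.hm y) x y ∨ S.E k.other (S.hm z) x z := by
    intro y z hy hz hc x hx hxc gy gz
    rcases edge_or hx hy (S.good_symm gy) with h | h
    · rcases edge_or hx hz (S.good_symm gz) with h' | h'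
      · exact absurd (S.tri h h' hc).2 hxc
      · exact Or.inr h'
    · exact Or.inl h
  -- If `y` reached nothing outside `c`, then `z` would reach two different homes, against
  -- `IsHub.not_both`.
  have ex : ∀ {y z}, S.col y = k.other → S.col z = k.other → S.hm y ≠ Q → S.hm z ≠ Q →
      S.E k c y z → ∃ x, S.col x = k ∧ S.hm x ≠ c ∧ S.E k.other (S.hm y) x y := by
    intro y z hy hz hyQ hzQ hc
    by_contra hno
    push Not at hno
    have all : ∀ x, S.col x = k → S.hm x ≠ c → S.Good y x → S.Good z x →
        S.E k.other (S.hm z) x z := fun x hx hxc gy gz =>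
      (one hy hz hc x hx hxc gy gz).resolve_left (hno x hx hxc)
    obtain ⟨x, hx, x1, x2⟩ := Finset.exists_mem_notMem₂ (A := S.Cl k \ (S.U k c ∪ S.U k c))
      (B := S.bad y) (C := S.bad z) (by linarith [S.card_bad y, S.card_bad z, hr c c])
    obtain ⟨x', hx', x1', x2', x3'⟩ := Finset.exists_mem_notMem₃
      (A := S.Cl k \ (S.U k c ∪ S.U k (S.hm x))) (B := S.bad y) (C := S.bad z) (D := S.bad x)
      (by linarith [S.card_bad y, S.card_bad z, S.card_bad x, hr c (S.hm x)])
    simp at hx x1 x2 hx' x1' x2' x3'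
    exact hQ.not_both hx.1 hx'.1 (fun h => hx'.2.2 hx'.1 h.symm) x3' hzQ
      (all x hx.1 (hx.2 hx.1) x1 x2) (all x' hx'.1 (hx'.2.1 hx'.1) x1' x2')
  obtain ⟨x, hx, hxc, hxy⟩ := ex hy hz hyQ hzQ hc
  obtain ⟨x', hx', hxc', hxz⟩ := ex hz hy hzQ hyQ (S.symm hc)
  have rest : ((S.Cl k \ (S.U k (S.hm x) ∪ (S.U k (S.hm x') ∪ S.U k c))).card : ℝ) ≤ 4 * κ := by
    apply card_le_of_forall_bad y z x x'
    intro v hv g1 g2 g3 g4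
    simp at hv
    rcases one hy hz hc v hv.1 (hv.2.2.2 hv.1) g1 g2 with h | h
    · exact hQ.not_both hx hv.1 (fun h => hv.2.1 hv.1 h.symm) g3 hyQ hxy h
    · exact hQ.not_both hx' hv.1 (fun h => hv.2.2.1 hv.1 h.symm) g4 hzQ hxz h
  have hne : S.hm x ≠ S.hm x' := by
    intro h
    have := hr (S.hm x') c
    rw [h, ← Finset.union_assoc, Finset.union_self] at rest
    linarith
  refine ⟨S.hm x, S.hm x', c, hne, hxc, hxc', hc, ⟨?_, fun d hd => ?_⟩, ⟨?_, fun d hd => ?_⟩, rest⟩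
  · apply card_le_of_forall_bad y z x' x'
    intro v hv g1 g2 g3 _
    simp at hv
    rcases one hy hz hc v hv.1.1 (by rw [hv.1.2]; exact hxc) g1 g2 with h | h
    · exact hv.2 (S.symm h)
    · exact hQ.not_both hx' hv.1.1 (by rw [hv.1.2]; exact hne.symm) g3 hzQ hxz h
  · apply card_le_of_forall_bad y z x x
    intro v hv g1 g2 g3 _
    simp at hv
    rcases edge_or hv.1.1 hy (S.good_symm g1) with h | h
    · rw [hv.1.2] at h; exact hv.2 (S.symm h)
    · exact hQ.not_both hx hv.1.1 (by rw [hv.1.2]; exact hd.symm) g3 hyQ hxy h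
  · apply card_le_of_forall_bad y z x x
    intro v hv g1 g2 g3 _
    simp at hv
    rcases one hy hz hc v hv.1.1 (by rw [hv.1.2]; exact hxc') g1 g2 with h | h
    · exact hQ.not_both hx hv.1.1 (by rw [hv.1.2]; exact hne) g3 hyQ hxy h
    · exact hv.2 (S.symm h)
  · apply card_le_of_forall_bad y z x' x'
    intro v hv g1 g2 g3 _
    simp at hv
    rcases edge_or hv.1.1 hz (S.good_symm g2) with h | h
    · rw [hv.1.2] at h; exact hv.2 (S.symm h)
    · exact hQ.not_both hx' hv.1.1 (by rw [hv.1.2]; exact hd.symm) g3 hzQ hxz h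

theorem Ty.eq {k : EdgeColour} {y : V} {e e' : ι} (h : S.Ty k y e) (h' : S.Ty k y e')
    (he : 10 * κ ≤ (S.U k e).card) (hκ : 10 ≤ κ) : e = e' := by
  by_contra hne
  have h1 := h.1
  have h2 := h'.2 e hne
  obtain ⟨x, hx, x1, x2⟩ := Finset.exists_mem_notMem₂ (A := S.U k e)
    (B := S.miss k.other (S.hm y) y (S.U k e)) (C := S.miss k e y (S.U k e)) (by linarith)
  rw [mem_miss, not_and, not_not] at x1 x2
  exact k.other_ne (S.uniq (x1 hx) (x2 hx)).1

variable (S) in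
/-- Three distinct components of colour `k` that contain almost all vertices of this colour. -/
structure Triple (k : EdgeColour) (a b c : ι) : Prop where
  ab : a ≠ b
  ac : a ≠ c
  bc : b ≠ c
  rest : ((S.Cl k \ (S.U k a ∪ (S.U k b ∪ S.U k c))).card : ℝ) ≤ 4 * κ

theorem Triple.rotate {k : EdgeColour} {a b c : ι} (h : S.Triple k a b c) : S.Triple k b c a :=
  ⟨h.bc, h.ab.symm, h.ac.symm, by
    have := h.rest
    rwa [Finset.union_comm, Finset.union_assoc] at this⟩

theorem Triple.swap {k : EdgeColour} {a b c : ι} (h : S.Triple k a b c) : S.Triple k a c b :=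
  ⟨h.ac, h.ab, h.bc.symm, by
    have := h.rest
    rwa [Finset.union_comm (S.U k b)] at this⟩

theorem Triple.card_le {k : EdgeColour} {a b c : ι} {η : ℝ} (h : S.Triple k a b c)
    (hr : S.Rich k η) : η - 4 * κ ≤ (S.U k a).card := by
  have h1 := hr b c
  have h2 : S.Cl k \ (S.U k b ∪ S.U k c) ⊆
      S.U k a ∪ (S.Cl k \ (S.U k a ∪ (S.U k b ∪ S.U k c))) := by
    intro v; simp; tauto
  have h3 := Finset.cast_card_mono h2
  have h4 := Finset.cast_card_union_le (S.U k a) (S.Cl k \ (S.U k a ∪ (S.U k b ∪ S.U k c)))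
  linarith [h.rest]

theorem Triple.mem {k : EdgeColour} {a b c d : ι} (h : S.Triple k a b c)
    (hd : 4 * κ < (S.U k d).card) : d = a ∨ d = b ∨ d = c := by
  by_contra hc
  push Not at hc
  have : S.U k d ⊆ S.Cl k \ (S.U k a ∪ (S.U k b ∪ S.U k c)) := by
    intro v hv
    simp at hv ⊢
    refine ⟨hv.1, fun _ h => hc.1 ?_, fun _ h => hc.2.1 ?_, fun _ h => hc.2.2 ?_⟩ <;>
      exact hv.2.symm.trans h
  have := Finset.cast_card_mono this
  linarith [h.rest]

variable (S) in
/-- All good pairs between `X` and `Y` are edges of the component `c` of colour `k`. -/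
def Joined (k : EdgeColour) (c : ι) (X Y : Finset V) : Prop :=
  ∀ x ∈ X, ∀ y ∈ Y, S.Good x y → S.E k c x y

theorem Joined.symm {k : EdgeColour} {c : ι} {X Y : Finset V} (h : S.Joined k c X Y) :
    S.Joined k c Y X := fun y hy x hx hg => S.symm (h x hx y hy (S.good_symm hg))

theorem Joined.mono {k : EdgeColour} {c : ι} {X Y X' Y' : Finset V} (h : S.Joined k c X Y)
    (hX : X' ⊆ X) (hY : Y' ⊆ Y) : S.Joined k c X' Y' := fun x hx y hy => h x (hX hx) y (hY hy)

theorem Joined.card_miss {k : EdgeColour} {c : ι} {X Y : Finset V} (h : S.Joined k c X Y)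
    {x : V} (hx : x ∈ X) : ((S.miss k c x Y).card : ℝ) ≤ κ := by
  refine (Finset.cast_card_mono fun y hy => ?_).trans (S.card_bad x)
  rw [mem_miss] at hy
  rw [mem_bad]
  exact fun hg => hy.2 (h x hx y hy.1 hg)

theorem Joined.full {k : EdgeColour} {c : ι} {X Y : Finset V} (h : S.Joined k c X Y) (hκ : 10 ≤ κ) :
    S.Full k c X Y := fun x hx => by linarith [h.card_miss hx]

theorem Joined.union_left {k : EdgeColour} {c : ι} {X X' Y : Finset V} (h : S.Joined k c X Y)
    (h' : S.Joined k c X' Y) : S.Joined k c (X ∪ X') Y := by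
  intro x hx
  rcases Finset.mem_union.1 hx with hx | hx
  · exact h x hx
  · exact h' x hx

variable (S) in
/-- The vertices of the other colour with home `h` and type `e`. -/
noncomputable def Tp (k : EdgeColour) (h e : ι) : Finset V :=
  (S.U k.other h).filter fun y => S.Ty k y e

theorem IsHub.joined {k : EdgeColour} {Q i j : ι} (hQ : S.IsHub k Q) (h : i ≠ j) :
    S.Joined k.other Q (S.U k i) (S.U k j) := fun x hx y hy hg =>
  hQ x y (mem_U.1 hx).1 (mem_U.1 hy).1 (apart_U h x hx y hy) hg

/-- A vertex of type `e` already reaches the home `e` in its own component, so it cannot reach a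
second home `e'` in this component. -/
theorem joined_Tp_cross (hκ : 10 ≤ κ) {k : EdgeColour} {Q h e e' : ι} (hQ : S.IsHub k Q)
    (hh : h ≠ Q) (hne : e' ≠ e) (he : 10 * κ ≤ (S.U k e).card) :
    S.Joined k e' (S.U k e') (S.Tp k h e) := by
  intro x hx y hy hg
  rw [Tp, Finset.mem_filter] at hy
  have hxU := mem_U.1 hx
  have hyU := mem_U.1 hy.1
  by_contra hE
  have h1 := good_other hg hx hyU.1 hE
  obtain ⟨x', hx', x1, x2⟩ := Finset.exists_mem_notMem₂ (A := S.U k e)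
    (B := S.miss k.other (S.hm y) y (S.U k e)) (C := S.bad x) (by
      linarith [S.card_bad x, hy.2.1])
  rw [mem_miss, not_and, not_not] at x1
  rw [mem_bad, not_not] at x2
  have hxU' := mem_U.1 hx'
  exact hQ.not_both hxU.1 hxU'.1 (by rw [hxU.2, hxU'.2]; exact hne) x2 (by rwa [hyU.2]) h1
    (S.symm (x1 hx'))

/-- The three homes given by `exists_types` are too large to lie outside the triple, so they are `a,
b, c` in some order, and the type of `y` fixes the first. -/
theorem types_of_pair {k : EdgeColour} {Q : ι} {η : ℝ} (hκ : 10 ≤ κ) (hr : S.Rich k η)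
    (hη : 100 * κ ≤ η) (hQ : S.IsHub k Q) {a b c : ι} (hT : S.Triple k a b c) {y z : V}
    (hy : S.col y = k.other) (hz : S.col z = k.other) (hyQ : S.hm y ≠ Q) (hzQ : S.hm z ≠ Q)
    (hyz : S.hm y ≠ S.hm z) (hg : S.Good y z) (hya : S.Ty k y a) :
    (S.Ty k z b ∧ S.E k c y z) ∨ (S.Ty k z c ∧ S.E k b y z) := by
  obtain ⟨a', b', c', h1, h2, h3, hE, hy', hz', hrest⟩ := exists_types hκ hr hη hQ hy hz hyQ hzQ hyz hg
  have hT' : S.Triple k a' b' c' := ⟨h1, h2, h3, hrest⟩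
  have := hya.eq hy' (by linarith [hT.card_le hr]) hκ
  subst this
  have hb := hT.mem (d := b') (by linarith [hT'.rotate.card_le hr])
  have hc := hT.mem (d := c') (by linarith [hT'.rotate.rotate.card_le hr])
  rcases hb with rfl | rfl | rfl
  · exact absurd rfl h1
  · rcases hc with rfl | rfl | rfl
    · exact absurd rfl h2
    · exact absurd rfl h3
    · exact Or.inl ⟨hz', hE⟩
  · rcases hc with rfl | rfl | rfl
    · exact absurd rfl h2
    · exact Or.inr ⟨hz', hE⟩
    · exact absurd rfl h3

theorem joined_Tp_pair {k : EdgeColour} {Q : ι} {η : ℝ} (hκ : 10 ≤ κ) (hr : S.Rich k η)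
    (hη : 100 * κ ≤ η) (hQ : S.IsHub k Q) {a b c h₁ h₂ : ι} (hT : S.Triple k a b c)
    (n₁ : h₁ ≠ Q) (n₂ : h₂ ≠ Q) (n : h₁ ≠ h₂) : S.Joined k c (S.Tp k h₁ a) (S.Tp k h₂ b) := by
  intro y hy z hz hg
  simp only [Tp, Finset.mem_filter, mem_U] at hy hz
  rcases types_of_pair hκ hr hη hQ hT hy.1.1 hz.1.1 (by rwa [hy.1.2]) (by rwa [hz.1.2])
    (by rwa [hy.1.2, hz.1.2]) hg hy.2 with h | h
  · exact h.2
  · exact absurd (hz.2.eq h.1 (by linarith [hT.rotate.card_le hr]) hκ) hT.bc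

theorem not_good_same_type {k : EdgeColour} {Q : ι} {η : ℝ} (hκ : 10 ≤ κ) (hr : S.Rich k η)
    (hη : 100 * κ ≤ η) (hQ : S.IsHub k Q) {a b c h₁ h₂ : ι} (hT : S.Triple k a b c)
    (n₁ : h₁ ≠ Q) (n₂ : h₂ ≠ Q) (n : h₁ ≠ h₂) {y z : V} (hy : y ∈ S.Tp k h₁ a)
    (hz : z ∈ S.Tp k h₂ a) : ¬ S.Good y z := by
  intro hg
  simp only [Tp, Finset.mem_filter, mem_U] at hy hz
  rcases types_of_pair hκ hr hη hQ hT hy.1.1 hz.1.1 (by rwa [hy.1.2]) (by rwa [hz.1.2])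
    (by rwa [hy.1.2, hz.1.2]) hg hy.2 with h | h
  · exact hT.ab (hz.2.eq h.1 (by linarith [hT.card_le hr]) hκ)
  · exact hT.ac (hz.2.eq h.1 (by linarith [hT.card_le hr]) hκ)

variable (S) in
/-- The extremal structure: the sets `A₁, A₂, A₀` have homes `a, b, c` of colour `k`, and the sets
`B₁, B₂, B₀` have homes `h₁, h₂, Q` of the other colour. -/
structure Pure (k : EdgeColour) (a b c h₁ h₂ Q : ι) (A₁ A₂ A₀ B₁ B₂ B₀ : Finset V) : Prop where
  ab : a ≠ b
  ac : a ≠ c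
  bc : b ≠ c
  h12 : h₁ ≠ h₂
  h1Q : h₁ ≠ Q
  h2Q : h₂ ≠ Q
  sA₁ : A₁ ⊆ S.U k a
  sA₂ : A₂ ⊆ S.U k b
  sA₀ : A₀ ⊆ S.U k c
  sB₁ : B₁ ⊆ S.U k.other h₁
  sB₂ : B₂ ⊆ S.U k.other h₂
  sB₀ : B₀ ⊆ S.U k.other Q
  A₁B₁ : S.Joined k.other h₁ A₁ B₁
  A₂B₂ : S.Joined k.other h₂ A₂ B₂
  A₁B₂ : S.Joined k a A₁ B₂
  A₂B₁ : S.Joined k b A₂ B₁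
  A₁A₂ : S.Joined k.other Q A₁ A₂
  A₀A₁ : S.Joined k.other Q A₀ A₁
  A₀A₂ : S.Joined k.other Q A₀ A₂
  B₀A₁ : S.Joined k.other Q B₀ A₁
  B₀A₂ : S.Joined k.other Q B₀ A₂
  B₁B₂ : S.Joined k c B₁ B₂
  B₀B₁ : S.Joined k c B₀ B₁
  B₀B₂ : S.Joined k c B₀ B₂
  A₀B₁ : S.Joined k c A₀ B₁
  A₀B₂ : S.Joined k c A₀ B₂

/-- If `xy` lay in the home of `x`, a vertex `z` of type `b` would complete a triangle with `xz` in
`a` and `yz` in `c`. -/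
theorem joined_Tp_own (hκ : 10 ≤ κ) {k : EdgeColour} {Q : ι} {η : ℝ} (hr : S.Rich k η)
    (hη : 100 * κ ≤ η) (hQ : S.IsHub k Q) {a b c h₁ h₂ : ι} (hT : S.Triple k a b c)
    (n₁ : h₁ ≠ Q) (n₂ : h₂ ≠ Q) (n : h₁ ≠ h₂) (c₂ : 2 * κ < (S.Tp k h₂ b).card) :
    S.Joined k.other h₁ (S.U k a) (S.Tp k h₁ a) := by
  intro x hx y hy hg
  by_contra hE
  have hyU := mem_U.1 (Finset.mem_filter.1 hy).1
  rcases edge_or (mem_U.1 hx).1 hyU.1 hg with h | h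
  · obtain ⟨z, hz, z1, z2⟩ := Finset.exists_mem_notMem₂ (A := S.Tp k h₂ b) (B := S.bad x)
      (C := S.bad y) (by linarith [S.card_bad x, S.card_bad y])
    rw [mem_bad, not_not] at z1 z2
    have e1 := joined_Tp_cross hκ hQ n₂ hT.ab (by linarith [hT.rotate.card_le hr]) x hx z hz z1
    have e2 := joined_Tp_pair hκ hr hη hQ hT n₁ n₂ n y hy z hz z2
    exact hT.ac ((S.tri e1 h (S.symm e2)).2)
  · rw [hyU.2] at h
    exact hE h

/-- The edges at the hub's home are located through an auxiliary vertex `w` of the opposite type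
class. In `hub`, the triangle through `w` lies in `c`; in `hubU`, an edge in the wrong component
would give `a = c`. -/
theorem pure_of_types (hκ : 10 ≤ κ) {k : EdgeColour} {Q : ι} {η : ℝ} (hr : S.Rich k η)
    (hη : 100 * κ ≤ η) (hQ : S.IsHub k Q) {a b c h₁ h₂ : ι} (hT : S.Triple k a b c)
    (n₁ : h₁ ≠ Q) (n₂ : h₂ ≠ Q) (n : h₁ ≠ h₂) (c₁ : 2 * κ < (S.Tp k h₁ a).card)
    (c₂ : 2 * κ < (S.Tp k h₂ b).card) :
    S.Pure k a b c h₁ h₂ Q (S.U k a) (S.U k b) (S.U k c) (S.Tp k h₁ a) (S.Tp k h₂ b)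
      (S.U k.other Q) := by
  have ua : 10 * κ ≤ (S.U k a).card := by linarith [hT.card_le hr]
  have ub : 10 * κ ≤ (S.U k b).card := by linarith [hT.rotate.card_le hr]
  have hT' : S.Triple k b a c := hT.swap.rotate.rotate
  have hub : ∀ {a b h₁ h₂}, S.Triple k a b c → h₁ ≠ Q → h₂ ≠ Q → h₁ ≠ h₂ →
      2 * κ < (S.Tp k h₂ b).card → S.Joined k c (S.U k.other Q) (S.Tp k h₁ a) := by
    intro a b h₁ h₂ hT n₁ n₂ n c₂ y hy z hz hg
    obtain ⟨w, hw, w1, w2⟩ := Finset.exists_mem_notMem₂ (A := S.Tp k h₂ b) (B := S.bad y)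
      (C := S.bad z) (by linarith [S.card_bad y, S.card_bad z])
    rw [mem_bad, not_not] at w1 w2
    have e1 := joined_Tp_pair hκ hr hη hQ hT n₁ n₂ n z hz w hw w2
    rw [mem_U] at hy
    simp only [Tp, Finset.mem_filter, mem_U] at hz hw
    obtain ⟨d, hd⟩ := S.good_same hg (hy.1.trans hz.1.1.symm) (by rw [hy.2, hz.1.2]; exact n₁.symm)
    obtain ⟨e, he⟩ := S.good_same w1 (hy.1.trans hw.1.1.symm) (by rw [hy.2, hw.1.2]; exact n₂.symm)
    rw [hy.1, EdgeColour.other_other] at hd he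
    rw [← (S.tri hd he e1).2]
    exact hd
  have hubU : ∀ {a b h₂}, S.Triple k a b c → h₂ ≠ Q → 10 * κ ≤ (S.U k b).card →
      2 * κ < (S.Tp k h₂ b).card → S.Joined k c (S.U k.other Q) (S.Tp k h₂ b) →
      S.Joined k.other Q (S.U k.other Q) (S.U k a) := by
    intro a b h₂ hT n₂ ub c₂ hJ y hy x hx hg
    by_contra hE
    have hyU := mem_U.1 hy
    rcases edge_or (mem_U.1 hx).1 hyU.1 (S.good_symm hg) with h | h
    · obtain ⟨w, hw, w1, w2⟩ := Finset.exists_mem_notMem₂ (A := S.Tp k h₂ b) (B := S.bad y)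
        (C := S.bad x) (by linarith [S.card_bad y, S.card_bad x])
      rw [mem_bad, not_not] at w1 w2
      have e1 := joined_Tp_cross hκ hQ n₂ hT.ab ub x hx w hw w2
      rw [(mem_U.1 hx).2] at h
      exact hT.ac (S.tri e1 h (S.symm (hJ y hy w hw w1))).2
    · rw [hyU.2] at h
      exact hE (S.symm h)
  have j1 := hub hT n₁ n₂ n c₂
  have j2 := hub hT' n₂ n₁ n.symm c₁
  exact
  { ab := hT.ab
    ac := hT.ac
    bc := hT.bc
    h12 := n
    h1Q := n₁
    h2Q := n₂
    sA₁ := subset_rfl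
    sA₂ := subset_rfl
    sA₀ := subset_rfl
    sB₁ := Finset.filter_subset _ _
    sB₂ := Finset.filter_subset _ _
    sB₀ := subset_rfl
    A₁B₁ := joined_Tp_own hκ hr hη hQ hT n₁ n₂ n c₂
    A₂B₂ := joined_Tp_own hκ hr hη hQ hT' n₂ n₁ n.symm c₁
    A₁B₂ := joined_Tp_cross hκ hQ n₂ hT.ab ub
    A₂B₁ := joined_Tp_cross hκ hQ n₁ hT.ab.symm ua
    A₁A₂ := hQ.joined hT.ab
    A₀A₁ := hQ.joined hT.ac.symm
    A₀A₂ := hQ.joined hT.bc.symm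
    B₀A₁ := hubU hT n₂ ub c₂ j2
    B₀A₂ := hubU hT' n₁ ua c₁ j1
    B₁B₂ := joined_Tp_pair hκ hr hη hQ hT n₁ n₂ n
    B₀B₁ := j1
    B₀B₂ := j2
    A₀B₁ := joined_Tp_cross hκ hQ n₁ hT.ac.symm ua
    A₀B₂ := joined_Tp_cross hκ hQ n₂ hT.bc.symm ub }

end CleanColouring

theorem Finset.cast_card_union_of_disjoint {V : Type*} {A B : Finset V} (h : Disjoint A B) :
    ((A ∪ B).card : ℝ) = A.card + B.card := by
  exact_mod_cast Finset.card_union_of_disjoint h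

/-! ### Excluding mixed types. -/

namespace CleanColouring

variable {V ι : Type*} [Fintype V] {t κ δ : ℝ} {S : CleanColouring V ι t κ}

/-- This is the packing of `card_le_of_full` when only the part `D` of the home is joined to `X`;
the rest of the home still counts in `Pk.three_mul_add_le`. -/
theorem card_U_add_le_of_full (hκ : 10 ≤ κ) {k : EdgeColour} {c : ι} {D X : Finset V}
    (hD : D ⊆ S.U k c) (hX : X ⊆ S.Cl k.other) (hf : S.Full k c X D) :
    (X.card : ℝ) + (S.U k c).card ≤ 3 * t + 20 * κ ∨
      (D.card : ℝ) + 2 * (S.U k c).card ≤ 6 * t + 40 * κ := by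
  by_contra hc
  push Not at hc
  have hXU : Disjoint X (S.U k c) := Finset.disjoint_of_subset_left hX
    (Finset.disjoint_of_subset_right (U_subset_Cl k c) disjoint_Cl.symm)
  have h00 := card_U_le (S := S) hκ k c
  obtain ⟨n, h1, h2⟩ := exists_nat_near (x := min (X.card : ℝ) ((D.card - 6 * κ) / 2)) (by
    apply le_min
    · positivity
    · linarith)
  have hx := h1.trans (min_le_left _ _)
  have hd := h1.trans (min_le_right _ _)
  obtain ⟨D₁, hD₁, D₂, hD₂, X', hX', c1, c2, c3, hP⟩ :=
    Pk.pair_of_full Pk.nil hD (Finset.disjoint_of_subset_right hD hXU) (by simp) (by simp) hf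
      (n := n) (by exact_mod_cast hx) (by linarith)
  have h3 := hP.three_mul_add_le hκ
  have h4 : S.U k c \ (D₁ ∪ D₂) ⊆ S.U k c \ (∅ ∪ D₁ ∪ D₂ ∪ X') := by
    intro v hv
    simp only [Finset.mem_sdiff, Finset.mem_union, not_or] at hv ⊢
    exact ⟨hv.1, ⟨⟨by simp, hv.2.1⟩, hv.2.2⟩, fun h => Finset.disjoint_left.1 hXU (hX' h) hv.1⟩
  have h5 := Finset.cast_card_mono h4
  have h6 := Finset.cast_card_sdiff_ge (S.U k c) (D₁ ∪ D₂)
  have h7 := Finset.cast_card_union_le D₁ D₂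
  rw [c1, c2] at h7
  push_cast at h3
  rcases min_choice (X.card : ℝ) ((D.card - 6 * κ) / 2) with h | h <;> rw [h] at h2 <;> linarith

theorem disjoint_Cl_of {k : EdgeColour} {X Y : Finset V} (hX : X ⊆ S.Cl k)
    (hY : Y ⊆ S.Cl k.other) : Disjoint X Y :=
  Finset.disjoint_of_subset_left hX (Finset.disjoint_of_subset_right hY disjoint_Cl)

theorem Full.union_left {k : EdgeColour} {c : ι} {X X' Y : Finset V} (h : S.Full k c X Y)
    (h' : S.Full k c X' Y) : S.Full k c (X ∪ X') Y := by
  intro x hx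
  rcases Finset.mem_union.1 hx with hx | hx
  · exact h x hx
  · exact h' x hx

theorem Tp_subset (k : EdgeColour) (h e : ι) : S.Tp k h e ⊆ S.U k.other h :=
  Finset.filter_subset _ _

theorem Joined.many {k : EdgeColour} {c : ι} {X Y : Finset V} (h : S.Joined k c X Y) {x : V}
    (hx : x ∈ X) : (Y.card : ℝ) - κ ≤ ((Y.filter fun y => S.E k c x y).card : ℝ) := by
  have h1 := h.card_miss hx
  have h2 := Finset.card_filter_add_card_filter_not (s := Y) (fun y => S.E k c x y)
  have h3 : ((Y.filter fun y => S.E k c x y).card : ℝ) + (S.miss k c x Y).card = Y.card := by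
    exact_mod_cast h2
  linarith

/-- Two pure structures hold at once, with `a` and `c` interchanged. This doubles the supply of full
pairs, and the packing inequalities from all of them are incompatible with a total of nearly `9 *
t`. -/
theorem no_mixture [Nonempty ι] (hκ : 10 ≤ κ) (hδ : 1000 * κ ≤ δ) (ht : 1000000 * δ ≤ t)
    {k : EdgeColour} (hr : S.Rich k (10000 * δ)) {Q a b c h₁ h₂ : ι} (hQ : S.IsHub k Q)
    (hT : S.Triple k a b c) (n₁ : h₁ ≠ Q) (n₂ : h₂ ≠ Q) (n : h₁ ≠ h₂)
    (cP : 1000 * δ ≤ (S.Tp k h₁ a).card) (cW : 1000 * δ ≤ (S.Tp k h₁ c).card)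
    (c₂ : 2 * κ < (S.Tp k h₂ b).card)
    (tot : 9 * t - δ ≤ ((S.U k a).card : ℝ) + (S.U k b).card + (S.U k c).card +
      (S.Tp k h₁ a).card + (S.Tp k h₁ c).card + (S.Tp k h₂ b).card) : False := by
  have P1 := pure_of_types hκ hr (by linarith) hQ hT n₁ n₂ n (by linarith) c₂
  have P2 := pure_of_types hκ hr (by linarith) hQ hT.rotate.rotate.swap n₁ n₂ n (by linarith) c₂
  set P := S.Tp k h₁ a
  set W := S.Tp k h₁ c
  set H := S.Tp k h₂ b
  have sP : P ⊆ S.Cl k.other := (Tp_subset _ _ _).trans (U_subset_Cl _ _)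
  have sW : W ⊆ S.Cl k.other := (Tp_subset _ _ _).trans (U_subset_Cl _ _)
  have sH : H ⊆ S.Cl k.other := (Tp_subset _ _ _).trans (U_subset_Cl _ _)
  have dWH : Disjoint W H := Finset.disjoint_of_subset_left (Tp_subset _ _ _)
    (Finset.disjoint_of_subset_right (Tp_subset _ _ _) (disjoint_U n))
  have dPH : Disjoint P H := Finset.disjoint_of_subset_left (Tp_subset _ _ _)
    (Finset.disjoint_of_subset_right (Tp_subset _ _ _) (disjoint_U n))
  have dPW : Disjoint P W := by
    rw [Finset.disjoint_left]
    intro y hy hy'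
    simp only [P, W, Tp, Finset.mem_filter] at hy hy'
    exact hT.ac (hy.2.eq hy'.2 (by linarith [hT.card_le hr]) hκ)
  have F1 := card_le_of_full hκ (subset_refl (S.U k b)) (disjoint_Cl_of (U_subset_Cl k b)
    (Finset.union_subset sP sW)).symm ((P1.A₂B₁.symm.full hκ).union_left (P2.A₂B₁.symm.full hκ))
  have F2 := card_le_of_full hκ P1.sB₂ (disjoint_Cl_of (U_subset_Cl k b) sH) (P1.A₂B₂.full hκ)
  have F3 := card_le_of_full hκ (subset_refl (S.U k a)) (disjoint_Cl_of (U_subset_Cl k a)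
    (Finset.union_subset sW sH)).symm ((P2.A₀B₁.symm.full hκ).union_left (P1.A₁B₂.symm.full hκ))
  have F4 := card_le_of_full hκ (subset_refl (S.U k c)) (disjoint_Cl_of (U_subset_Cl k c)
    (Finset.union_subset sP sH)).symm ((P1.A₀B₁.symm.full hκ).union_left (P2.A₁B₂.symm.full hκ))
  have F5 := card_U_add_le_of_full hκ P1.sB₁ (X := S.U k a)
    (by rw [EdgeColour.other_other]; exact U_subset_Cl _ _) (P1.A₁B₁.full hκ)
  have F6 := card_U_add_le_of_full hκ P2.sB₁ (X := S.U k c)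
    (by rw [EdgeColour.other_other]; exact U_subset_Cl _ _) (P2.A₁B₁.full hκ)
  have F8 := card_U_le (S := S) hκ k.other h₁
  have F8' := Finset.cast_card_mono (Finset.union_subset P1.sB₁ P2.sB₁)
  rw [Finset.cast_card_union_of_disjoint dPW] at F1 F8'
  rw [Finset.cast_card_union_of_disjoint dWH] at F3
  rw [Finset.cast_card_union_of_disjoint dPH] at F4
  -- Three homes well above `t` would give too many hub triangles across them.
  have F7 : ((S.U k a).card : ℝ) ≤ t + 20 * κ ∨ ((S.U k b).card : ℝ) ≤ t + 20 * κ ∨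
      ((S.U k c).card : ℝ) ≤ t + 20 * κ := by
    by_contra hc
    push Not at hc
    have := hQ.pack hκ (U_subset_Cl k a) (U_subset_Cl k b) (U_subset_Cl k c)
      (apart_U hT.ac.symm) (apart_U hT.bc.symm) (apart_U hT.ab) hc.2.2.le hc.2.1.le hc.1.le
      (by linarith)
    linarith [(Nat.cast_nonneg (S.U k.other Q).card : (0 : ℝ) ≤ _)]
  have G1 : t + 40 * δ ≤ H.card → ((S.U k a).card : ℝ) ≤ 2 * t + 10 * δ →
      t + 20 * δ ≤ (S.U k a).card → (W.card : ℝ) ≤ 2 * t - (S.U k a).card + 30 * δ :=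
    fun h h' h'' => card_le_of_many_neighbours hκ hδ sH sW dWH (P1.A₁B₂.symm.full hκ)
      (P2.B₁B₂.full hκ).fullCol h h' fun y hy => by linarith [P2.A₀B₁.symm.many hy]
  have G2 : t + 40 * δ ≤ H.card → ((S.U k c).card : ℝ) ≤ 2 * t + 10 * δ →
      t + 20 * δ ≤ (S.U k c).card → (P.card : ℝ) ≤ 2 * t - (S.U k c).card + 30 * δ :=
    fun h h' h'' => card_le_of_many_neighbours hκ hδ sH sP dPH (P2.A₁B₂.symm.full hκ)
      (P1.B₁B₂.full hκ).fullCol h h' fun y hy => by linarith [P1.A₀B₁.symm.many hy]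
  have two : ∀ {i j : ι}, i ≠ j → 2 * t + 10 * δ < (S.U k i).card →
      ((S.U k j).card : ℝ) ≤ 2 * t + 10 * δ := by
    intro i j hij hi
    by_contra hj
    push Not at hj
    exact not_both_large S hκ hδ ht hij hi.le hj.le
  rcases le_or_gt (t + 40 * δ) (H.card : ℝ) with hH | hH
  · have ra : ((S.U k a).card : ℝ) ≤ 2 * t + 10 * δ := by
      rcases F3 with h | h <;> linarith
    have rc : ((S.U k c).card : ℝ) ≤ 2 * t + 10 * δ := by
      rcases F4 with h | h <;> linarith
    have G1 := G1 hH ra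
    have G2 := G2 hH rc
    rcases le_or_gt (t + 20 * δ) ((S.U k a).card : ℝ) with ha | ha <;>
      rcases le_or_gt (t + 20 * δ) ((S.U k c).card : ℝ) with hc | hc
    · have G1 := G1 ha
      have G2 := G2 hc
      rcases F1 with F1 | F1 <;> rcases F2 with F2 | F2 <;> linarith
    · have G1 := G1 ha
      rcases F1 with F1 | F1 <;> rcases F2 with F2 | F2 <;> rcases F5 with F5 | F5 <;>
        rcases F6 with F6 | F6 <;> linarith
    · have G2 := G2 hc
      rcases F1 with F1 | F1 <;> rcases F2 with F2 | F2 <;> rcases F5 with F5 | F5 <;>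
        rcases F6 with F6 | F6 <;> linarith
    · rcases F1 with F1 | F1 <;> rcases F2 with F2 | F2 <;> rcases F5 with F5 | F5 <;>
        rcases F6 with F6 | F6 <;> linarith
  · have rb : ((S.U k b).card : ℝ) ≤ 2 * t + 10 * δ := by
      by_contra h
      push Not at h
      have := two hT.ab.symm h
      have := two hT.bc h
      rcases F1 with F1 | F1 <;> linarith
    have ra : ((S.U k a).card : ℝ) ≤ 2 * t + 10 * δ := by
      by_contra h
      push Not at h
      have := two hT.ac h
      rcases F3 with F3 | F3 <;> rcases F7 with F7 | F7 | F7 <;> linarith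
    have rc : ((S.U k c).card : ℝ) ≤ 2 * t + 10 * δ := by
      by_contra h
      push Not at h
      rcases F4 with F4 | F4 <;> rcases F7 with F7 | F7 | F7 <;> linarith
    rcases F7 with F7 | F7 | F7 <;> rcases F5 with F5 | F5 <;> rcases F6 with F6 | F6 <;> linarith

/-- Almost every vertex of the other colour outside the hub falls into one of four type classes, the
last of which is negligible. If one of the two classes in the home of `y` is small, it is discarded;
if both are large, `no_mixture` applies. -/
theorem exists_pure_of_types [Nonempty ι] (hκ : 10 ≤ κ) (hδ : 1000 * κ ≤ δ) (ht : 1000000 * δ ≤ t)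
    {k : EdgeColour} (hr : S.Rich k (10000 * δ)) {Q a b c : ι} (hQ : S.IsHub k Q)
    (hT : S.Triple k a b c) {y z : V} (hy : S.col y = k.other) (hz : S.col z = k.other)
    (n₁ : S.hm y ≠ Q) (n₂ : S.hm z ≠ Q) (n : S.hm y ≠ S.hm z)
    (hE : S.E k c y z) (hya : S.Ty k y a) (hzb : S.Ty k z b)
    (l₁ : 20 * κ < (S.Cl k.other \ (S.U k.other Q ∪ S.U k.other (S.hm z))).card)
    (l₂ : 20 * κ < (S.Cl k.other \ (S.U k.other Q ∪ S.U k.other (S.hm y))).card)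
    (hW : ((S.Tp k (S.hm z) c).card : ℝ) ≤ κ) :
    ∃ a b c h₁ h₂ Q A₁ A₂ A₀ B₁ B₂ B₀, S.Pure k a b c h₁ h₂ Q A₁ A₂ A₀ B₁ B₂ B₀ ∧
      5000 * δ ≤ A₁.card ∧ 5000 * δ ≤ A₂.card ∧ 9 * t - 1100 * δ ≤
        (A₁.card : ℝ) + A₂.card + A₀.card + B₁.card + B₂.card + B₀.card := by
  have hη : 100 * κ ≤ 10000 * δ := by linarith
  have cover : ∀ w, S.col w = k.other → S.Good y w → S.Good z w → S.hm w ≠ Q →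
      w ∈ S.Tp k (S.hm y) a ∨ w ∈ S.Tp k (S.hm y) c ∨ w ∈ S.Tp k (S.hm z) b ∨
        w ∈ S.Tp k (S.hm z) c := by
    intro w hw gy gz hwQ
    have t1 := fun h : S.hm y ≠ S.hm w => types_of_pair hκ hr hη hQ hT hy hw n₁ hwQ h gy hya
    have t2 := fun h : S.hm z ≠ S.hm w => types_of_pair hκ hr hη hQ hT.swap.rotate.rotate hz hw n₂ hwQ h
      gz hzb
    simp only [Tp, Finset.mem_filter, mem_U]
    by_cases e1 : S.hm y = S.hm w
    · rcases t2 (fun h => n (e1.trans h.symm)) with h | h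
      · exact Or.inl ⟨⟨hw, e1.symm⟩, h.1⟩
      · exact Or.inr (Or.inl ⟨⟨hw, e1.symm⟩, h.1⟩)
    · by_cases e2 : S.hm z = S.hm w
      · rcases t1 e1 with h | h
        · exact Or.inr (Or.inr (Or.inl ⟨⟨hw, e2.symm⟩, h.1⟩))
        · exact Or.inr (Or.inr (Or.inr ⟨⟨hw, e2.symm⟩, h.1⟩))
      -- A third home leaves only the type `c` for `w`; then the triangle `yzw` has edges in the
      -- different components `c`, `b`, `a`.
      · exfalso
        rcases t1 e1 with h | h <;> rcases t2 e2 with h' | h'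
        · exact hT.ab (h'.1.eq h.1 (by linarith [hT.card_le hr]) hκ)
        · exact hT.bc (h.1.eq h'.1 (by linarith [hT.rotate.card_le hr]) hκ)
        · exact hT.ac (h'.1.eq h.1 (by linarith [hT.card_le hr]) hκ)
        · exact hT.bc (S.tri hE h.2 h'.2).1.symm
  set P := S.Tp k (S.hm y) a
  set W := S.Tp k (S.hm y) c
  set H := S.Tp k (S.hm z) b
  set W' := S.Tp k (S.hm z) c
  have b1 := card_le_of_forall_bad (S := S)
    (A := S.Cl k.other \ (S.U k.other Q ∪ ((P ∪ W) ∪ (H ∪ W')))) y z y z (by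
      intro w hw g1 g2 _ _
      simp only [Finset.mem_sdiff, Finset.mem_union, mem_Cl, mem_U, not_or, not_and] at hw
      have := cover w hw.1 g1 g2 (hw.2.1 hw.1)
      tauto)
  have b2 := Finset.cast_card_sdiff_ge (S.Cl k.other) (S.U k.other Q ∪ ((P ∪ W) ∪ (H ∪ W')))
  have b3 := Finset.cast_card_union_le (S.U k.other Q) ((P ∪ W) ∪ (H ∪ W'))
  have b4 := Finset.cast_card_union_le (P ∪ W) (H ∪ W')
  have b5 := Finset.cast_card_union_le P W
  have b6 := Finset.cast_card_union_le H W'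
  have sub : ∀ {h e}, S.Tp k h e ⊆ S.U k.other h := fun {h e} => Tp_subset k h e
  have b7 : 15 * κ ≤ (P ∪ W).card := by
    have h1 := Finset.cast_card_mono (show S.Cl k.other \ (S.U k.other Q ∪ S.U k.other (S.hm z)) ⊆
        (S.Cl k.other \ (S.U k.other Q ∪ ((P ∪ W) ∪ (H ∪ W')))) ∪ (P ∪ W) by
      intro w hw
      have : w ∈ H ∪ W' → w ∈ S.U k.other (S.hm z) := fun h => by
        rcases Finset.mem_union.1 h with h | h <;> exact sub h
      simp only [Finset.mem_sdiff, Finset.mem_union] at hw this ⊢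
      tauto)
    linarith [Finset.cast_card_union_le (S.Cl k.other \ (S.U k.other Q ∪ ((P ∪ W) ∪ (H ∪ W')))) (P ∪ W)]
  have b8 : 15 * κ ≤ (H ∪ W').card := by
    have h1 := Finset.cast_card_mono (show S.Cl k.other \ (S.U k.other Q ∪ S.U k.other (S.hm y)) ⊆
        (S.Cl k.other \ (S.U k.other Q ∪ ((P ∪ W) ∪ (H ∪ W')))) ∪ (H ∪ W') by
      intro w hw
      have : w ∈ P ∪ W → w ∈ S.U k.other (S.hm y) := fun h => by
        rcases Finset.mem_union.1 h with h | h <;> exact sub h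
      simp only [Finset.mem_sdiff, Finset.mem_union] at hw this ⊢
      tauto)
    linarith [Finset.cast_card_union_le (S.Cl k.other \ (S.U k.other Q ∪ ((P ∪ W) ∪ (H ∪ W')))) (H ∪ W')]
  have d2 := Finset.cast_card_sdiff_ge (S.Cl k) (S.U k a ∪ (S.U k b ∪ S.U k c))
  have d3 := Finset.cast_card_union_le (S.U k a) (S.U k b ∪ S.U k c)
  have d4 := Finset.cast_card_union_le (S.U k b) (S.U k c)
  have hV := card_Cl_add S k
  have hrest := hT.rest
  have cH : 2 * κ < H.card := by linarith
  have ua := hT.card_le hr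
  have ub := hT.rotate.card_le hr
  have uc := hT.rotate.rotate.card_le hr
  by_cases hWs : (W.card : ℝ) ≤ 1000 * δ ∧ 2 * κ < P.card
  · exact ⟨a, b, c, _, _, Q, _, _, _, _, _, _,
      pure_of_types hκ hr hη hQ hT n₁ n₂ n hWs.2 cH, by linarith, by linarith, by linarith [hWs.1]⟩
  by_cases hPs : (P.card : ℝ) ≤ 1000 * δ
  · have cW : 2 * κ < W.card := by
      by_contra h
      push Not at h hWs
      linarith [hWs (by linarith)]
    exact ⟨c, b, a, _, _, Q, _, _, _, _, _, _,
      pure_of_types hκ hr hη hQ hT.rotate.rotate.swap n₁ n₂ n cW cH, by linarith, by linarith,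
      by linarith⟩
  · exfalso
    push Not at hPs hWs
    have cW : 1000 * δ < W.card := by
      by_contra h
      push Not at h
      linarith [hWs h]
    have P1 := pure_of_types hκ hr hη hQ hT n₁ n₂ n (by linarith) cH
    have P2 := pure_of_types hκ hr hη hQ hT.rotate.rotate.swap n₁ n₂ n (by linarith) cH
    -- An edge from the hub's home to `H` would lie in `c` by one structure and in `a` by the other.
    have hub : ((S.U k.other Q).card : ℝ) ≤ 4 * κ := by
      obtain ⟨w, hw, -⟩ := Finset.exists_mem_notMem_of_card (A := H) (B := (∅ : Finset V))
        (by rw [Finset.card_empty]; push_cast; linarith)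
      apply card_le_of_forall_bad w w w w
      intro v hv g _ _ _
      exact hT.ac (S.uniq (P2.B₀B₂ v hv w hw (S.good_symm g))
        (P1.B₀B₂ v hv w hw (S.good_symm g))).2
    exact no_mixture hκ hδ ht hr hQ hT n₁ n₂ n hPs.le cW.le cH (by linarith)

/-- By `hub_case` there are `y` and `z` outside the hub with different homes. Vertices of equal type
with different homes never form a good pair, so of the two classes of type `c` in these homes one is
negligible; this decides the order of `y` and `z`. -/
theorem exists_pure [Nonempty ι] (S : CleanColouring V ι t κ) (hκ : 10 ≤ κ) (hδ : 1000 * κ ≤ δ)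
    (ht : 1000000 * δ ≤ t) (hδ' : 100 * κ * t ≤ δ ^ 2) {k : EdgeColour}
    (hr : S.Rich k (10000 * δ)) :
    ∃ a b c h₁ h₂ Q A₁ A₂ A₀ B₁ B₂ B₀, S.Pure k a b c h₁ h₂ Q A₁ A₂ A₀ B₁ B₂ B₀ ∧
      5000 * δ ≤ A₁.card ∧ 5000 * δ ≤ A₂.card ∧ 9 * t - 1100 * δ ≤
        (A₁.card : ℝ) + A₂.card + A₀.card + B₁.card + B₂.card + B₀.card := by
  have hη : 100 * κ ≤ 10000 * δ := by linarith
  obtain ⟨Q, hQ⟩ := exists_hub hκ hr (by linarith)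
  have out : ∀ i : ι, ∃ j, j ≠ i := by
    intro i
    obtain ⟨x, hx, -⟩ := Finset.exists_mem_notMem_of_card (A := S.Cl k \ (S.U k i ∪ S.U k i))
      (B := (∅ : Finset V)) (by
        rw [Finset.card_empty]; push_cast
        linarith [hr i i])
    simp at hx
    exact ⟨S.hm x, hx.2 hx.1⟩
  obtain ⟨c₁, -, hc₁⟩ := exists_max_card_U S k (fun _ => True) ⟨Classical.arbitrary ι, trivial⟩
  obtain ⟨c₂, hc₂, hc₂'⟩ := exists_max_card_U S k (fun i => i ≠ c₁) (out c₁)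
  have L : ∀ o, o ≠ Q → 20 * κ < (S.Cl k.other \ (S.U k.other Q ∪ S.U k.other o)).card := by
    intro o ho
    by_contra h
    push Not at h
    exact hub_case S hκ hδ ht hδ' hc₂.symm (fun i => hc₁ i trivial) hc₂' hr hQ ho h
  obtain ⟨o, ho⟩ := out Q
  obtain ⟨y, hy, -⟩ := Finset.exists_mem_notMem_of_card (A := S.Cl k.other \ (S.U k.other Q ∪ S.U k.other o))
    (B := (∅ : Finset V)) (by
      rw [Finset.card_empty]; push_cast
      linarith [L o ho])
  simp only [Finset.mem_sdiff, Finset.mem_union, mem_U, mem_Cl, not_or, not_and] at hy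
  have hyQ := hy.2.1 hy.1
  obtain ⟨z, hz, gz⟩ := Finset.exists_mem_notMem_of_card
    (A := S.Cl k.other \ (S.U k.other Q ∪ S.U k.other (S.hm y))) (B := S.bad y)
    (by linarith [L _ hyQ, S.card_bad y])
  simp only [Finset.mem_sdiff, Finset.mem_union, mem_U, mem_Cl, not_or, not_and, mem_bad,
    not_not] at hz gz
  have hzQ := hz.2.1 hz.1
  have hyz : S.hm y ≠ S.hm z := fun h => hz.2.2 hz.1 h.symm
  obtain ⟨a, b, c, ab, ac, bc, hE, ya, zb, rest⟩ :=
    exists_types hκ hr hη hQ hy.1 hz.1 hyQ hzQ hyz gz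
  have hT : S.Triple k a b c := ⟨ab, ac, bc, rest⟩
  by_cases hW : ((S.Tp k (S.hm z) c).card : ℝ) ≤ κ
  · exact exists_pure_of_types hκ hδ ht hr hQ hT hy.1 hz.1 hyQ hzQ hyz hE ya zb (L _ hzQ) (L _ hyQ) hW
  · refine exists_pure_of_types hκ hδ ht hr hQ hT.swap.rotate.rotate hz.1 hy.1 hzQ hyQ hyz.symm
      (S.symm hE) zb ya (L _ hyQ) (L _ hzQ) ?_
    by_contra h
    push Not at h hW
    obtain ⟨v, hv, -⟩ := Finset.exists_mem_notMem_of_card (A := S.Tp k (S.hm y) c)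
      (B := (∅ : Finset V)) (by rw [Finset.card_empty]; push_cast; linarith)
    obtain ⟨w, hw, g⟩ := Finset.exists_mem_notMem_of_card (A := S.Tp k (S.hm z) c)
      (B := S.bad v) (by linarith [S.card_bad v])
    rw [mem_bad, not_not] at g
    exact not_good_same_type hκ hr hη hQ hT.rotate.rotate hyQ hzQ hyz hv hw g

/-! ### One of the colours is rich. -/

/-- An edge of component `d` from `U k c₂` to `D` closes a triangle with some vertex of `U₀`. More
than `2 * m` disjoint triangles of this kind could be extended beyond the packing bound by triangles
with two vertices in `D` and one in `U₀`. Hence a maximal packing is small, and removing it destroys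
all such edges between good pairs. -/
theorem exists_joined (hκ : 10 ≤ κ) {k : EdgeColour} {c₁ c₂ d : ι} (hc : c₁ ≠ c₂)
    {U₀ D : Finset V} (hU₀ : U₀ ⊆ S.U k c₁) (hD : D ⊆ S.U k.other d)
    (hf : ∀ y ∈ D, ((S.miss k.other d y U₀).card : ℝ) ≤ 2 * κ) {m : ℝ} (hm : 10 * κ ≤ m)
    (hmt : 10 * m ≤ t) (cD : 2 * t - m ≤ D.card) (cU : 2 * t + 2 * m ≤ U₀.card) :
    ∃ X ⊆ S.U k c₂, ∃ Y ⊆ D, (X.card : ℝ) ≤ 2 * m ∧ (Y.card : ℝ) ≤ 2 * m ∧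
      S.Joined k c₂ (S.U k c₂ \ X) (D \ Y) := by
  obtain ⟨n, X, hX, Y, hY, Z, hZ, cX, cY, cZ, hP, hmax⟩ :=
    (Pk.nil (S := S) (k := k.other) (c := d)).greedy_max (S.U k c₂) D U₀
  have sU : U₀ ⊆ S.Cl k := hU₀.trans (U_subset_Cl _ _)
  have sD : D ⊆ S.Cl k.other := hD.trans (U_subset_Cl _ _)
  have dUD : Disjoint U₀ D := disjoint_Cl_of sU sD
  have dXD : Disjoint (S.U k c₂) D := disjoint_Cl_of (U_subset_Cl _ _) sD
  have dXU : Disjoint (S.U k c₂) U₀ := Finset.disjoint_of_subset_right hU₀ (disjoint_U hc.symm)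
  have e1 := Finset.cast_card_sdiff_ge D Y
  have e2 := Finset.cast_card_sdiff_ge U₀ Z
  rw [cY] at e1
  rw [cZ] at e2
  have hnt := hP.le
  push_cast at hnt
  have hn : (n : ℝ) ≤ 2 * m := by
    by_contra hlt
    push Not at hlt
    obtain ⟨l, l1, l2⟩ := exists_nat_near (x := t - n + 2 * κ) (by linarith)
    obtain ⟨D₁, -, D₂, -, X', -, -, -, -, hP'⟩ := hP.pair_of_partial (D := D \ Y) (X := U₀ \ Z)
      (Finset.sdiff_subset.trans hD)
      (Finset.disjoint_of_subset_left Finset.sdiff_subset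
        (Finset.disjoint_of_subset_right Finset.sdiff_subset dUD)) (by
        rw [Finset.disjoint_left]; intro v hv
        simp only [Finset.mem_sdiff, Finset.mem_union, not_or] at hv ⊢
        exact ⟨⟨⟨by simp, fun h => Finset.disjoint_left.1 dXU (hX h) hv.1⟩,
          fun h => Finset.disjoint_left.1 dUD hv.1 (hY h)⟩, hv.2⟩) (by
        rw [Finset.disjoint_left]; intro v hv
        simp only [Finset.mem_sdiff, Finset.mem_union, not_or] at hv ⊢
        exact ⟨⟨⟨by simp, fun h => Finset.disjoint_left.1 dXD (hX h) hv.1⟩, hv.2⟩,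
          fun h => Finset.disjoint_left.1 dUD (hZ h) hv.1⟩)
      (ρ := (U₀ \ Z).card - 2 * κ) (by
        intro y hy
        have h1 := hf y (Finset.mem_sdiff.1 hy).1
        have h2 := Finset.cast_card_sdiff_ge (U₀ \ Z) (S.miss k.other d y U₀)
        have h3 : (U₀ \ Z) \ S.miss k.other d y U₀ ⊆
            (U₀ \ Z).filter fun x => S.E k.other d y x := by
          intro x hx
          simp at hx ⊢
          exact ⟨hx.1, hx.2 hx.1.1⟩
        linarith [Finset.cast_card_mono h3]) (by linarith) (n := l) (by linarith) (by
        have i1 : ((U₀ \ Z).card : ℝ) / 2 ≤ (U₀ \ Z).card - 2 * κ - l := by linarith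
        have i2 : 4 * κ ≤ (D \ Y).card - 2 * l := by linarith
        have i3 : ((U₀ \ Z).card : ℝ) / 2 * (4 * κ) ≤
            ((U₀ \ Z).card - 2 * κ - l) * ((D \ Y).card - 2 * l) :=
          mul_le_mul i1 i2 (by linarith) (by linarith)
        have i4 : 0 < κ * (U₀ \ Z).card := by apply mul_pos <;> linarith
        linarith)
    have := hP'.le
    push_cast at this
    linarith
  refine ⟨X, hX, Y, hY, by rwa [cX], by rwa [cY], ?_⟩
  intro x hx y hy hg
  rw [Finset.mem_sdiff] at hx hy
  by_contra hE
  have hyU := mem_U.1 (hD hy.1)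
  have h1 := good_other hg hx.1 hyU.1 hE
  rw [hyU.2] at h1
  obtain ⟨u, hu, u1, u2⟩ := Finset.exists_mem_notMem₂ (A := U₀ \ Z) (B := S.bad x)
    (C := S.miss k.other d y U₀) (by linarith [S.card_bad x, hf y hy.1])
  rw [Finset.mem_sdiff] at hu
  rw [mem_bad, not_not] at u1
  rw [mem_miss, not_and, not_not] at u2
  have hxU := mem_U.1 hx.1
  have huU := mem_U.1 (hU₀ hu.1)
  obtain ⟨e, he⟩ := S.good_same u1 (hxU.1.trans huU.1.symm) (by rw [hxU.2, huU.2]; exact hc.symm)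
  rw [hxU.1] at he
  have := hmax x hx.1 y hy.1 u hu.1 (T.of_E h1 he (u2 hu.1))
  have f1 : x ∉ Y := fun h => Finset.disjoint_left.1 dXD hx.1 (hY h)
  have f2 : x ∉ Z := fun h => Finset.disjoint_left.1 dXU hx.1 (hZ h)
  have f3 : y ∉ X := fun h => Finset.disjoint_left.1 dXD (hX h) hy.1
  have f4 : y ∉ Z := fun h => Finset.disjoint_left.1 dUD (hZ h) hy.1
  have f5 : u ∉ X := fun h => Finset.disjoint_left.1 dXU (hX h) hu.1
  have f6 : u ∉ Y := fun h => Finset.disjoint_left.1 dUD hu.1 (hY h)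
  simp only [Finset.mem_union, Finset.notMem_empty, false_or] at this
  tauto

theorem exists_two_components [Nonempty ι] (S : CleanColouring V ι t κ) (hκ : 10 ≤ κ)
    (ht : 100 * κ ≤ t) {k : EdgeColour} {η : ℝ} (h : ¬ S.Rich k η) :
    ∃ c d, c ≠ d ∧ (S.U k d).card ≤ (S.U k c).card ∧
      ((S.Cl k \ (S.U k c ∪ S.U k d)).card : ℝ) < η := by
  rcases subsingleton_or_nontrivial ι with hs | hn
  · exfalso
    have hC : ∀ k, S.Cl k ⊆ S.U k (Classical.arbitrary ι) := by
      intro k v hv; simp at hv ⊢; exact ⟨hv, Subsingleton.elim _ _⟩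
    have h1 := Finset.cast_card_mono (hC k)
    have h2 := Finset.cast_card_mono (hC k.other)
    linarith [card_Cl_add S k, card_U_le (S := S) hκ k (Classical.arbitrary ι),
      card_U_le (S := S) hκ k.other (Classical.arbitrary ι)]
  · have : ∃ c d, c ≠ d ∧ ((S.Cl k \ (S.U k c ∪ S.U k d)).card : ℝ) < η := by
      unfold Rich at h
      push Not at h
      obtain ⟨i, j, hij⟩ := h
      by_cases e : i = j
      · subst e
        obtain ⟨j, hj⟩ := exists_ne i
        refine ⟨i, j, hj.symm, lt_of_le_of_lt (Finset.cast_card_mono ?_) hij⟩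
        exact Finset.sdiff_subset_sdiff subset_rfl
          (by rw [Finset.union_self]; exact Finset.subset_union_left)
      · exact ⟨i, j, e, hij⟩
    obtain ⟨c, d, hcd, hlt⟩ := this
    rcases le_total (S.U k d).card (S.U k c).card with h | h
    · exact ⟨c, d, hcd, h, hlt⟩
    · exact ⟨d, c, hcd.symm, h, by rwa [Finset.union_comm]⟩

/-- If neither colour is rich, two homes of each colour contain nearly all vertices, and the earlier
bounds force sizes near `3 * t` and `2 * t` in one colour and `2 * t` twice in the other. By
`exists_joined` most of the home `c₂` is joined in `c₂` to most of both homes of the other colour,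
which allows more than `t + κ` triangles across the three. -/
theorem rich_or_rich [Nonempty ι] (S : CleanColouring V ι t κ) (hκ : 10 ≤ κ) (hδ : 1000 * κ ≤ δ)
    (ht : 2000000 * δ ≤ t) (k : EdgeColour) : S.Rich k (10000 * δ) ∨ S.Rich k.other (10000 * δ) := by
  by_contra hnr
  push Not at hnr
  have main : ∀ k : EdgeColour, ∀ c₁ c₂ d₁ d₂ : ι, c₁ ≠ c₂ → d₁ ≠ d₂ →
      3 * t - 60000 * δ ≤ (S.U k c₁).card → 2 * t - 60000 * δ ≤ (S.U k c₂).card →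
      2 * t - 60000 * δ ≤ (S.U k.other d₁).card → 2 * t - 60000 * δ ≤ (S.U k.other d₂).card →
      False := by
    intro k c₁ c₂ d₁ d₂ hc hd u1 u2 v1 v2
    obtain ⟨Y, hY, U₀, hU₀, y1, y2, hf⟩ := exists_residue (S := S) hκ k c₁
    have J : ∀ d, 2 * t - 60000 * δ ≤ (S.U k.other d).card →
        ∃ X ⊆ S.U k c₂, ∃ D ⊆ S.U k.other d, (X.card : ℝ) ≤ 300000 * δ ∧
          2 * t - 450000 * δ ≤ D.card ∧ S.Joined k c₂ (S.U k c₂ \ X) D := by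
      intro d hd
      have e1 := Finset.cast_card_sdiff_ge (S.U k.other d) Y
      obtain ⟨X, hX, Z, hZ, cX, cZ, hJ⟩ := exists_joined hκ (d := d) hc hU₀
        (D := S.U k.other d \ Y) Finset.sdiff_subset (by
          intro y hy
          rw [Finset.mem_sdiff] at hy
          have := hf y (U_subset_Cl _ _ hy.1) hy.2
          rwa [(mem_U.1 hy.1).2] at this) (m := 130000 * δ) (by linarith) (by linarith)
        (by linarith) (by linarith)
      have e2 := Finset.cast_card_sdiff_ge (S.U k.other d \ Y) Z
      exact ⟨X, hX, _, Finset.sdiff_subset.trans Finset.sdiff_subset, by linarith, by linarith, hJ⟩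
    obtain ⟨X₁, hX₁, D₁, hD₁, x1, w1, j1⟩ := J d₁ v1
    obtain ⟨X₂, hX₂, D₂, hD₂, x2, w2, j2⟩ := J d₂ v2
    have e1 := Finset.cast_card_sdiff_ge (S.U k c₂) (X₁ ∪ X₂)
    have e2 := Finset.cast_card_union_le X₁ X₂
    have sW : S.U k c₂ \ (X₁ ∪ X₂) ⊆ S.Cl k := Finset.sdiff_subset.trans (U_subset_Cl _ _)
    have s1 : D₁ ⊆ S.Cl k.other := hD₁.trans (U_subset_Cl _ _)
    have s2 : D₂ ⊆ S.Cl k.other := hD₂.trans (U_subset_Cl _ _)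
    obtain ⟨n, n1, n2⟩ := exists_nat_near (x := t + 10 * κ) (by linarith)
    obtain ⟨X, -, Y', -, Z, -, -, -, -, hP⟩ := (Pk.nil (S := S) (k := k) (c := c₂)).tripartite
      (A := S.U k c₂ \ (X₁ ∪ X₂)) (B := D₁) (C := D₂) (disjoint_Cl_of sW s1)
      (disjoint_Cl_of sW s2) (Finset.disjoint_of_subset_left hD₁
        (Finset.disjoint_of_subset_right hD₂ (disjoint_U hd))) (by simp) (by simp) (by simp)
      ((j1.mono (Finset.sdiff_subset_sdiff subset_rfl Finset.subset_union_left)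
        subset_rfl).full hκ)
      ((j2.mono (Finset.sdiff_subset_sdiff subset_rfl Finset.subset_union_right)
        subset_rfl).full hκ).fullCol (by
        intro y hy
        have : (D₂.filter fun z => ¬ ∃ d, S.E k d y z) ⊆ S.bad y := by
          intro z hz
          rw [Finset.mem_filter] at hz
          rw [mem_bad]
          intro hg
          have hzU := mem_U.1 (hD₂ hz.1)
          have hyU := mem_U.1 (hD₁ hy)
          have := S.good_same hg (hyU.1.trans hzU.1.symm) (by rw [hyU.2, hzU.2]; exact hd)
          rw [hyU.1, EdgeColour.other_other] at this
          exact hz.2 this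
        linarith [Finset.cast_card_mono this, S.card_bad y]) (n := n)
      (by
        have : (n : ℝ) ≤ (S.U k c₂ \ (X₁ ∪ X₂)).card := by linarith
        exact_mod_cast this) (by linarith) (by linarith)
    have := hP.le
    push_cast at this
    linarith
  obtain ⟨c₁, c₂, hc, h12, hs⟩ := exists_two_components S hκ (by linarith) hnr.1
  obtain ⟨d₁, d₂, hd, h12', hs'⟩ := exists_two_components S hκ (by linarith) hnr.2
  have r12 : ((S.U k c₂).card : ℝ) ≤ (S.U k c₁).card := by exact_mod_cast h12
  have b12 : ((S.U k.other d₂).card : ℝ) ≤ (S.U k.other d₁).card := by exact_mod_cast h12'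
  have hR := card_Cl_eq S k hc
  have hB := card_Cl_eq S k.other hd
  have hV := card_Cl_add S k
  have r2 : ((S.U k c₂).card : ℝ) ≤ 2 * t + 10 * δ := by
    by_contra h
    push Not at h
    exact not_both_large S hκ hδ (by linarith) hc (by linarith) h.le
  have b2 : ((S.U k.other d₂).card : ℝ) ≤ 2 * t + 10 * δ := by
    by_contra h
    push Not at h
    exact not_both_large S hκ hδ (by linarith) hd (by linarith) h.le
  have r1 := card_U_le (S := S) hκ k c₁
  have b1 := card_U_le (S := S) hκ k.other d₁
  rcases large_opposite S hκ (k := k) (c := c₁) (d := d₁) with h | h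
  · exact main k c₁ c₂ d₁ d₂ hc hd (by linarith) (by linarith) (by linarith) (by linarith)
  · refine main k.other d₁ d₂ c₁ c₂ hd hc (by linarith) (by linarith) ?_ ?_ <;>
      rw [EdgeColour.other_other] <;> linarith

/-! ### Sizes in the pure structure. -/

/-- No part has to be large: for `x < 10 * κ` the empty extension is within the allowed error. -/
theorem Pk.exists_tripartite (hκ : 10 ≤ κ) {k : EdgeColour} {c : ι} {n₀ : ℕ} {W₀ : Finset V}
    (h0 : S.Pk k c n₀ W₀) {A B C : Finset V} (hAB : Disjoint A B) (hAC : Disjoint A C)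
    (hBC : Disjoint B C) (hA : Disjoint A W₀) (hB : Disjoint B W₀) (hC : Disjoint C W₀)
    (fAB : S.Full k c A B) (fAC : S.FullCol k A C) (fBC : S.FullCol k B C) {x : ℝ} (hx : 0 ≤ x)
    (nA : x ≤ A.card) (nB : x ≤ B.card) (nC : x ≤ C.card) :
    ∃ n : ℕ, x - 11 * κ ≤ n ∧ (n : ℝ) ≤ x ∧ ∃ X ⊆ A, ∃ Y ⊆ B, ∃ Z ⊆ C, X.card = n ∧ Y.card = n ∧
      Z.card = n ∧ S.Pk k c (n₀ + n) (W₀ ∪ X ∪ Y ∪ Z) := by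
  rcases lt_or_ge x (10 * κ) with h | h
  · exact ⟨0, by push_cast; linarith, by simpa, ∅, by simp, ∅, by simp, ∅, by simp, rfl, rfl, rfl,
      by simpa using h0⟩
  · obtain ⟨n, n1, n2⟩ := exists_nat_near (x := x - 10 * κ) (by linarith)
    refine ⟨n, by linarith, by linarith, h0.tripartite hAB hAC hBC hA hB hC fAB fAC fBC ?_
      (by linarith) (by linarith)⟩
    have : (n : ℝ) ≤ A.card := by linarith
    exact_mod_cast this

theorem Pk.exists_pair (hκ : 10 ≤ κ) {k : EdgeColour} {c : ι} {n₀ : ℕ} {W₀ : Finset V}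
    (h0 : S.Pk k c n₀ W₀) {D X : Finset V} (hD : D ⊆ S.U k c) (hXD : Disjoint X D)
    (hXW : Disjoint X W₀) (hDW : Disjoint D W₀) (hf : S.Full k c X D) {x : ℝ} (hx : 0 ≤ x)
    (nX : x ≤ X.card) (nD : 2 * x ≤ D.card) :
    ∃ n : ℕ, x - 11 * κ ≤ n ∧ (n : ℝ) ≤ x ∧ ∃ D₁ ⊆ D, ∃ D₂ ⊆ D, ∃ X' ⊆ X, D₁.card = n ∧
      D₂.card = n ∧ X'.card = n ∧ S.Pk k c (n₀ + n) (W₀ ∪ D₁ ∪ D₂ ∪ X') := by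
  rcases lt_or_ge x (10 * κ) with h | h
  · exact ⟨0, by push_cast; linarith, by simpa, ∅, by simp, ∅, by simp, ∅, by simp, rfl, rfl, rfl,
      by simpa using h0⟩
  · obtain ⟨n, n1, n2⟩ := exists_nat_near (x := x - 10 * κ) (by linarith)
    refine ⟨n, by linarith, by linarith, h0.pair_of_full hD hXD hXW hDW hf ?_ (by linarith)⟩
    have : (n : ℝ) ≤ X.card := by linarith
    exact_mod_cast this

/-- Packing in a component: triangles across `A₁, A₂, A₀`, triangles across `A₁, A₂, B`, triangles
with two vertices in `B` and one in `A₂`, and triangles inside `B`. -/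
theorem exists_hub_packing (hκ : 10 ≤ κ) {k : EdgeColour} {c : ι} {A₁ A₂ A₀ B : Finset V}
    (hB : B ⊆ S.U k c) (h₁ : A₁ ⊆ S.Cl k.other) (h₂ : A₂ ⊆ S.Cl k.other) (h₀ : A₀ ⊆ S.Cl k.other)
    (d₁₂ : Disjoint A₁ A₂) (d₁₀ : Disjoint A₁ A₀) (d₂₀ : Disjoint A₂ A₀)
    (f₁₂ : S.Full k c A₁ A₂) (f₁₀ : S.Full k c A₁ A₀) (f₂₀ : S.Full k c A₂ A₀)
    (f₁ : S.Full k c A₁ B) (f₂ : S.Full k c A₂ B) (hle : A₁.card ≤ A₂.card) :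
    ∃ n₁ n₂ m : ℝ, min (A₀.card : ℝ) A₁.card - 11 * κ ≤ n₁ ∧ n₁ ≤ min (A₀.card : ℝ) A₁.card ∧
      min (B.card : ℝ) (A₁.card - n₁) - 11 * κ ≤ n₂ ∧ 0 ≤ n₂ ∧ n₂ ≤ A₁.card - n₁ ∧
      min ((B.card - n₂) / 2) (A₂.card - n₁ - n₂) - 11 * κ ≤ m ∧ 0 ≤ m ∧
      3 * n₁ + 2 * n₂ + m + B.card ≤ 3 * t + 5 * κ := by
  have hle' : (A₁.card : ℝ) ≤ A₂.card := by exact_mod_cast hle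
  have dB : ∀ v ∈ S.Cl k.other, v ∉ B := fun v hv h =>
    Finset.disjoint_left.1 disjoint_Cl (U_subset_Cl _ _ (hB h)) hv
  have b1 : ∀ v ∈ A₁, v ∉ B := fun v hv => dB v (h₁ hv)
  have b2 : ∀ v ∈ A₂, v ∉ B := fun v hv => dB v (h₂ hv)
  have b0 : ∀ v ∈ A₀, v ∉ B := fun v hv => dB v (h₀ hv)
  rw [Finset.disjoint_left] at d₁₂ d₁₀ d₂₀
  obtain ⟨n₁, p1, q1, X, hX, Y, hY, Z, hZ, cX, cY, cZ, hP⟩ :=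
    (Pk.nil (S := S) (k := k) (c := c)).exists_tripartite hκ (A := A₁) (B := A₂) (C := A₀)
      (Finset.disjoint_left.2 d₁₂) (Finset.disjoint_left.2 d₁₀) (Finset.disjoint_left.2 d₂₀)
      (by simp) (by simp) (by simp) f₁₂ f₁₀.fullCol f₂₀.fullCol (x := min (A₀.card : ℝ) A₁.card)
      (by positivity) (min_le_right _ _) ((min_le_right _ _).trans hle') (min_le_left _ _)
  have q1' := q1.trans (min_le_right _ _)
  have e1 := Finset.cast_card_sdiff_ge A₁ X
  have e2 := Finset.cast_card_sdiff_ge A₂ Y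
  rw [cX] at e1
  rw [cY] at e2
  obtain ⟨n₂, p2, q2, X', hX', Y', hY', Z', hZ', cX', cY', cZ', hP'⟩ :=
    hP.exists_tripartite hκ (A := A₁ \ X) (B := A₂ \ Y) (C := B)
      (Finset.disjoint_left.2 fun v h h' => d₁₂ (Finset.sdiff_subset h) (Finset.sdiff_subset h'))
      (Finset.disjoint_left.2 fun v h h' => b1 v (Finset.sdiff_subset h) h')
      (Finset.disjoint_left.2 fun v h h' => b2 v (Finset.sdiff_subset h) h')
      (Finset.disjoint_left.2 fun v h h' => by
        simp only [Finset.mem_sdiff, Finset.mem_union, Finset.notMem_empty, false_or] at h h'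
        rcases h' with (h' | h') | h'
        · exact h.2 h'
        · exact d₁₂ h.1 (hY h')
        · exact d₁₀ h.1 (hZ h'))
      (Finset.disjoint_left.2 fun v h h' => by
        simp only [Finset.mem_sdiff, Finset.mem_union, Finset.notMem_empty, false_or] at h h'
        rcases h' with (h' | h') | h'
        · exact d₁₂ (hX h') h.1
        · exact h.2 h'
        · exact d₂₀ h.1 (hZ h'))
      (Finset.disjoint_left.2 fun v h h' => by
        simp only [Finset.mem_union, Finset.notMem_empty, false_or] at h'
        rcases h' with (h' | h') | h'
        · exact b1 v (hX h') h
        · exact b2 v (hY h') h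
        · exact b0 v (hZ h') h)
      (f₁₂.mono Finset.sdiff_subset Finset.sdiff_subset)
      (f₁.mono Finset.sdiff_subset subset_rfl).fullCol
      (f₂.mono Finset.sdiff_subset subset_rfl).fullCol
      (x := min (B.card : ℝ) (A₁.card - n₁)) (le_min (by positivity) (by linarith))
      ((min_le_right _ _).trans e1) ((min_le_right _ _).trans (by linarith)) (min_le_left _ _)
  have q2a := q2.trans (min_le_left _ _)
  have q2' := q2.trans (min_le_right _ _)
  have e3 := Finset.cast_card_sdiff_ge B Z'
  have e4 := Finset.cast_card_sdiff_ge A₂ (Y ∪ Y')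
  have e5 := Finset.cast_card_union_le Y Y'
  rw [cZ'] at e3
  rw [cY, cY'] at e5
  obtain ⟨m, p3, q3, D₁, hD₁, D₂, hD₂, X'', hX'', cD₁, cD₂, -, hP''⟩ :=
    hP'.exists_pair hκ (D := B \ Z') (X := A₂ \ (Y ∪ Y')) (Finset.sdiff_subset.trans hB)
      (Finset.disjoint_left.2 fun v h h' => b2 v (Finset.sdiff_subset h) (Finset.sdiff_subset h'))
      (Finset.disjoint_left.2 fun v h h' => by
        simp only [Finset.mem_sdiff, Finset.mem_union, Finset.notMem_empty, false_or, not_or] at h h'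
        rcases h' with ((((h' | h') | h') | h') | h') | h'
        · exact d₁₂ (hX h') h.1
        · exact h.2.1 h'
        · exact d₂₀ h.1 (hZ h')
        · exact d₁₂ (Finset.sdiff_subset (hX' h')) h.1
        · exact h.2.2 h'
        · exact b2 v h.1 (hZ' h'))
      (Finset.disjoint_left.2 fun v h h' => by
        simp only [Finset.mem_sdiff, Finset.mem_union, Finset.notMem_empty, false_or] at h h'
        rcases h' with ((((h' | h') | h') | h') | h') | h'
        · exact b1 v (hX h') h.1
        · exact b2 v (hY h') h.1
        · exact b0 v (hZ h') h.1
        · exact b1 v (Finset.sdiff_subset (hX' h')) h.1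
        · exact b2 v (Finset.sdiff_subset (hY' h')) h.1
        · exact h.2 h')
      (f₂.mono Finset.sdiff_subset Finset.sdiff_subset)
      (x := min (((B.card : ℝ) - n₂) / 2) (A₂.card - n₁ - n₂))
      (le_min (by linarith) (by linarith)) ((min_le_right _ _).trans (by linarith))
      (by have := min_le_left (((B.card : ℝ) - n₂) / 2) (A₂.card - n₁ - n₂); linarith)
  refine ⟨n₁, n₂, m, p1, q1, p2, Nat.cast_nonneg _, q2', p3, Nat.cast_nonneg _, ?_⟩
  -- The packing uses `n₂ + 2 * m` vertices of `B`, whence the coefficients `3, 2, 1` of `n₁, n₂,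
  -- m`.
  have h3 := hP''.three_mul_add_le hκ
  have h4 : (B \ Z') \ (D₁ ∪ D₂) ⊆ S.U k c \ (∅ ∪ X ∪ Y ∪ Z ∪ X' ∪ Y' ∪ Z' ∪ D₁ ∪ D₂ ∪ X'') := by
    intro v hv
    simp only [Finset.mem_sdiff, Finset.mem_union, Finset.notMem_empty, false_or, not_or] at hv ⊢
    have := hv.1.1
    exact ⟨hB this, ⟨⟨⟨⟨⟨⟨⟨⟨fun h => b1 v (hX h) this, fun h => b2 v (hY h) this⟩,
      fun h => b0 v (hZ h) this⟩, fun h => b1 v (Finset.sdiff_subset (hX' h)) this⟩,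
      fun h => b2 v (Finset.sdiff_subset (hY' h)) this⟩, hv.1.2⟩, hv.2.1⟩, hv.2.2⟩,
      fun h => b2 v (Finset.sdiff_subset (hX'' h)) this⟩⟩
  have h5 := Finset.cast_card_mono h4
  have h6 := Finset.cast_card_sdiff_ge (B \ Z') (D₁ ∪ D₂)
  have h7 := Finset.cast_card_union_le D₁ D₂
  rw [cD₁, cD₂] at h7
  push_cast at h3
  linarith

variable {k : EdgeColour} {a b c h₁ h₂ Q : ι} {A₁ A₂ A₀ B₁ B₂ B₀ : Finset V}

theorem Pure.swap (P : S.Pure k a b c h₁ h₂ Q A₁ A₂ A₀ B₁ B₂ B₀) :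
    S.Pure k b a c h₂ h₁ Q A₂ A₁ A₀ B₂ B₁ B₀ where
  ab := P.ab.symm
  ac := P.bc
  bc := P.ac
  h12 := P.h12.symm
  h1Q := P.h2Q
  h2Q := P.h1Q
  sA₁ := P.sA₂
  sA₂ := P.sA₁
  sA₀ := P.sA₀
  sB₁ := P.sB₂
  sB₂ := P.sB₁
  sB₀ := P.sB₀
  A₁B₁ := P.A₂B₂
  A₂B₂ := P.A₁B₁
  A₁B₂ := P.A₂B₁
  A₂B₁ := P.A₁B₂
  A₁A₂ := P.A₁A₂.symm
  A₀A₁ := P.A₀A₂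
  A₀A₂ := P.A₀A₁
  B₀A₁ := P.B₀A₂
  B₀A₂ := P.B₀A₁
  B₁B₂ := P.B₁B₂.symm
  B₀B₁ := P.B₀B₂
  B₀B₂ := P.B₀B₁
  A₀B₁ := P.A₀B₂
  A₀B₂ := P.A₀B₁

/-- The structure is self-dual under exchange of colours: `c` and `Q` change places, and the pair
`A₁, A₂` returns in reversed order. Every estimate in `Q` thus has a counterpart in `c`. -/
theorem Pure.flip (P : S.Pure k a b c h₁ h₂ Q A₁ A₂ A₀ B₁ B₂ B₀) :
    S.Pure k.other h₁ h₂ Q b a c B₁ B₂ B₀ A₂ A₁ A₀ where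
  ab := P.h12
  ac := P.h1Q
  bc := P.h2Q
  h12 := P.ab.symm
  h1Q := P.bc
  h2Q := P.ac
  sA₁ := P.sB₁
  sA₂ := P.sB₂
  sA₀ := P.sB₀
  sB₁ := by rw [EdgeColour.other_other]; exact P.sA₂
  sB₂ := by rw [EdgeColour.other_other]; exact P.sA₁
  sB₀ := by rw [EdgeColour.other_other]; exact P.sA₀
  A₁B₁ := by rw [EdgeColour.other_other]; exact P.A₂B₁.symm
  A₂B₂ := by rw [EdgeColour.other_other]; exact P.A₁B₂.symm
  A₁B₂ := P.A₁B₁.symm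
  A₂B₁ := P.A₂B₂.symm
  A₁A₂ := by rw [EdgeColour.other_other]; exact P.B₁B₂
  A₀A₁ := by rw [EdgeColour.other_other]; exact P.B₀B₁
  A₀A₂ := by rw [EdgeColour.other_other]; exact P.B₀B₂
  B₀A₁ := by rw [EdgeColour.other_other]; exact P.A₀B₁
  B₀A₂ := by rw [EdgeColour.other_other]; exact P.A₀B₂
  B₁B₂ := P.A₁A₂.symm
  B₀B₁ := P.A₀A₂
  B₀B₂ := P.A₀A₁
  A₀B₁ := P.B₀A₂
  A₀B₂ := P.B₀A₁

/-- The alternatives correspond to which set is exhausted in each stage of `exists_hub_packing`. -/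
theorem Pure.hub_ineq (P : S.Pure k a b c h₁ h₂ Q A₁ A₂ A₀ B₁ B₂ B₀) (hκ : 10 ≤ κ)
    (hδ : 1000 * κ ≤ δ) (hle : A₁.card ≤ A₂.card) :
    ((A₁.card : ℝ) ≤ A₀.card ∧ ((B₀.card : ℝ) + 2 * A₁.card ≤ 2 * t + δ ∨
      (B₀.card : ℝ) + 2 * A₁.card + A₂.card ≤ 3 * t + δ)) ∨
    (A₀.card : ℝ) + B₀.card ≤ t + δ ∨ (A₀.card : ℝ) + B₀.card + A₁.card ≤ 2 * t + δ ∨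
      (A₀.card : ℝ) + B₀.card + A₁.card + A₂.card ≤ 3 * t + δ := by
  have oo := EdgeColour.other_other k
  have s1 : A₁ ⊆ S.Cl k.other.other := by rw [oo]; exact P.sA₁.trans (U_subset_Cl _ _)
  have s2 : A₂ ⊆ S.Cl k.other.other := by rw [oo]; exact P.sA₂.trans (U_subset_Cl _ _)
  have s0 : A₀ ⊆ S.Cl k.other.other := by rw [oo]; exact P.sA₀.trans (U_subset_Cl _ _)
  have dis : ∀ {X Y : Finset V} {i j : ι}, X ⊆ S.U k i → Y ⊆ S.U k j → i ≠ j → Disjoint X Y :=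
    fun hX hY h => Finset.disjoint_of_subset_left hX (Finset.disjoint_of_subset_right hY (disjoint_U h))
  obtain ⟨n₁, n₂, m, p1, q1, p2, p2', q2, p3, p3', h⟩ := exists_hub_packing hκ P.sB₀ s1 s2 s0
    (dis P.sA₁ P.sA₂ P.ab) (dis P.sA₁ P.sA₀ P.ac) (dis P.sA₂ P.sA₀ P.bc) (P.A₁A₂.full hκ)
    (P.A₀A₁.symm.full hκ) (P.A₀A₂.symm.full hκ) (P.B₀A₁.symm.full hκ) (P.B₀A₂.symm.full hκ) hle
  rcases le_total (A₁.card : ℝ) A₀.card with h1 | h1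
  · rw [min_eq_right h1] at p1 q1
    rcases min_choice (((B₀.card : ℝ) - n₂) / 2) (A₂.card - n₁ - n₂) with e | e <;> rw [e] at p3
    · exact Or.inl ⟨h1, Or.inl (by linarith)⟩
    · exact Or.inl ⟨h1, Or.inr (by linarith)⟩
  · rw [min_eq_left h1] at p1 q1
    rcases min_choice (B₀.card : ℝ) (A₁.card - n₁) with f | f <;> rw [f] at p2
    · exact Or.inr (Or.inl (by linarith))
    · rcases min_choice (((B₀.card : ℝ) - n₂) / 2) (A₂.card - n₁ - n₂) with e | e <;> rw [e] at p3
      · exact Or.inr (Or.inr (Or.inl (by linarith)))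
      · exact Or.inr (Or.inr (Or.inr (by linarith)))

theorem Pure.card_or (P : S.Pure k a b c h₁ h₂ Q A₁ A₂ A₀ B₁ B₂ B₀) (hκ : 10 ≤ κ) :
    (A₁.card : ℝ) ≤ 2 * t + 20 * κ ∨ (A₁.card : ℝ) + B₂.card ≤ 3 * t + 20 * κ :=
  card_le_of_full hκ P.sA₁ (disjoint_Cl_of (P.sA₁.trans (U_subset_Cl _ _))
    (P.sB₂.trans (U_subset_Cl _ _))).symm (P.A₁B₂.symm.full hκ)

/-- If `A₁` were larger, `not_both_large` would bound `A₂`, and `Pure.card_or` would bound `|A₁| +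
|B₂|` and `B₁`. The hub inequalities in `Q` and `c` then leave too few vertices in total. -/
theorem Pure.card_A₁_le [Nonempty ι] (P : S.Pure k a b c h₁ h₂ Q A₁ A₂ A₀ B₁ B₂ B₀) (hκ : 10 ≤ κ)
    (hδ : 1000 * κ ≤ δ) (ht : 1000000 * δ ≤ t) (tot : 9 * t - 1100 * δ ≤
      (A₁.card : ℝ) + A₂.card + A₀.card + B₁.card + B₂.card + B₀.card)
    (low : 5000 * δ ≤ (A₂.card : ℝ) + 2 * B₂.card) : (A₁.card : ℝ) ≤ 2 * t + 10 * δ := by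
  by_contra hc
  push Not at hc
  have a2 : (A₂.card : ℝ) ≤ 2 * t + 10 * δ := by
    by_contra h
    push Not at h
    exact not_both_large S hκ hδ ht P.ab (hc.le.trans (Finset.cast_card_mono P.sA₁))
      (h.le.trans (Finset.cast_card_mono P.sA₂))
  have F1 : (A₁.card : ℝ) + B₂.card ≤ 3 * t + 20 * κ := by
    rcases P.card_or hκ with h | h <;> linarith
  have F2 : (B₁.card : ℝ) ≤ 2 * t + 20 * κ := by
    rcases P.flip.card_or hκ with h | h <;> linarith
  have hle : A₂.card ≤ A₁.card := by
    have : (A₂.card : ℝ) ≤ A₁.card := by linarith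
    exact_mod_cast this
  have n1 : (0 : ℝ) ≤ A₂.card := by positivity
  have n2 : (0 : ℝ) ≤ B₂.card := by positivity
  have n3 : (0 : ℝ) ≤ B₀.card := by positivity
  have n4 : (0 : ℝ) ≤ B₁.card := by positivity
  rcases P.swap.hub_ineq hκ hδ hle with ⟨h, h' | h'⟩ | h | h | h
  · rcases le_total B₁.card B₂.card with g | g
    · have g' : (B₁.card : ℝ) ≤ B₂.card := by exact_mod_cast g
      rcases P.flip.hub_ineq hκ hδ g with ⟨i, i' | i'⟩ | i | i | i <;> linarith
    · rcases P.flip.swap.hub_ineq hκ hδ g with ⟨i, i' | i'⟩ | i | i | i <;> linarith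
  · rcases le_total B₁.card B₂.card with g | g
    · have g' : (B₁.card : ℝ) ≤ B₂.card := by exact_mod_cast g
      rcases P.flip.hub_ineq hκ hδ g with ⟨i, i' | i'⟩ | i | i | i <;> linarith
    · rcases P.flip.swap.hub_ineq hκ hδ g with ⟨i, i' | i'⟩ | i | i | i <;> linarith
  all_goals linarith

theorem Pure.sizes [Nonempty ι] (P : S.Pure k a b c h₁ h₂ Q A₁ A₂ A₀ B₁ B₂ B₀) (hκ : 10 ≤ κ)
    (hδ : 1000 * κ ≤ δ) (ht : 1000000 * δ ≤ t) (tot : 9 * t - 1100 * δ ≤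
      (A₁.card : ℝ) + A₂.card + A₀.card + B₁.card + B₂.card + B₀.card)
    (l₁ : 5000 * δ ≤ A₁.card) (l₂ : 5000 * δ ≤ A₂.card) :
    (A₁.card : ℝ) ≤ 2 * t + 10 * δ ∧ (A₂.card : ℝ) ≤ 2 * t + 10 * δ ∧
    (B₁.card : ℝ) ≤ 2 * t + 10 * δ ∧ (B₂.card : ℝ) ≤ 2 * t + 10 * δ ∧
    (A₀.card : ℝ) + B₀.card ≤ t + δ := by
  have n1 : (0 : ℝ) ≤ B₁.card := by positivity
  have n2 : (0 : ℝ) ≤ B₂.card := by positivity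
  have e1 := P.card_A₁_le hκ hδ ht tot (by linarith)
  have e2 := P.swap.card_A₁_le hκ hδ ht (by linarith) (by linarith)
  have e3 := P.flip.card_A₁_le hκ hδ ht (by linarith) (by linarith)
  have e4 := P.flip.swap.card_A₁_le hκ hδ ht (by linarith) (by linarith)
  refine ⟨e1, e2, e3, e4, ?_⟩
  -- Otherwise the hub inequalities bound `|B₀| + |A₁| + |A₂|` and its dual by about `4 * t` each,
  -- which is about `t` short of the total.
  by_contra hz
  push Not at hz
  have FA : (B₀.card : ℝ) + A₁.card + A₂.card ≤ 4 * t + 20 * δ := by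
    rcases le_total A₁.card A₂.card with h | h
    · rcases P.hub_ineq hκ hδ h with ⟨i, i' | i'⟩ | i | i | i <;> linarith
    · rcases P.swap.hub_ineq hκ hδ h with ⟨i, i' | i'⟩ | i | i | i <;> linarith
  have FB : (A₀.card : ℝ) + B₁.card + B₂.card ≤ 4 * t + 20 * δ := by
    rcases le_total B₁.card B₂.card with h | h
    · rcases P.flip.hub_ineq hκ hδ h with ⟨i, i' | i'⟩ | i | i | i <;> linarith
    · rcases P.flip.swap.hub_ineq hκ hδ h with ⟨i, i' | i'⟩ | i | i | i <;> linarith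
  linarith

/-! ### From the pure structure to exact colours. -/

variable (S) in
/-- All edges between `X` and `Y` have colour `k`. -/
def Only (k : EdgeColour) (X Y : Finset V) : Prop :=
  ∀ x ∈ X, ∀ y ∈ Y, ∀ j d, S.E j d x y → j = k

theorem Only.symm {X Y : Finset V} (h : S.Only k X Y) : S.Only k Y X :=
  fun y hy x hx j d hE => h x hx y hy j d (S.symm hE)

theorem Only.mono {X Y X' Y' : Finset V} (h : S.Only k X Y) (hX : X' ⊆ X) (hY : Y' ⊆ Y) :
    S.Only k X' Y' := fun x hx y hy => h x (hX hx) y (hY hy)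

theorem Only.union_right {X Y Y' : Finset V} (h : S.Only k X Y) (h' : S.Only k X Y') :
    S.Only k X (Y ∪ Y') := by
  intro x hx y hy
  rcases Finset.mem_union.1 hy with hy | hy
  · exact h x hx y hy
  · exact h' x hx y hy

/-- An edge of the other colour would form a triangle with a common neighbour in `W`, although the
two edges to `W` lie in different components. This covers all edges, not only good pairs. -/
theorem only_of_joined {d e : ι} {X Y W : Finset V} (hX : S.Joined k.other d X W)
    (hY : S.Joined k.other e Y W) (hde : d ≠ e) (hW : 2 * κ < W.card) : S.Only k X Y := by
  intro x hx y hy j i hE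
  by_contra hj
  rw [EdgeColour.eq_other_of_ne hj] at hE
  obtain ⟨w, hw, w1, w2⟩ := Finset.exists_mem_notMem₂ (A := W) (B := S.bad x) (C := S.bad y)
    (by linarith [S.card_bad x, S.card_bad y])
  rw [mem_bad, not_not] at w1 w2
  have := S.tri hE (hX x hx w hw w1) (hY y hy w hw w2)
  exact hde (this.1.symm.trans this.2)

theorem Pure.only_A₁B₁ (P : S.Pure k a b c h₁ h₂ Q A₁ A₂ A₀ B₁ B₂ B₀) (h : 2 * κ < B₂.card) :
    S.Only k.other A₁ B₁ :=
  only_of_joined (W := B₂) (by rw [EdgeColour.other_other]; exact P.A₁B₂)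
    (by rw [EdgeColour.other_other]; exact P.B₁B₂) P.ac h

theorem Pure.only_A₁B₂ (P : S.Pure k a b c h₁ h₂ Q A₁ A₂ A₀ B₁ B₂ B₀) (h : 2 * κ < A₂.card) :
    S.Only k A₁ B₂ :=
  only_of_joined P.A₁A₂ P.A₂B₂.symm P.h2Q.symm h

theorem Pure.only_A₁Z (P : S.Pure k a b c h₁ h₂ Q A₁ A₂ A₀ B₁ B₂ B₀) (h : 2 * κ < B₂.card) :
    S.Only k.other A₁ (A₀ ∪ B₀) :=
  (only_of_joined (W := B₂) (by rw [EdgeColour.other_other]; exact P.A₁B₂)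
    (by rw [EdgeColour.other_other]; exact P.A₀B₂) P.ac h).union_right
  (only_of_joined (W := B₂) (by rw [EdgeColour.other_other]; exact P.A₁B₂)
    (by rw [EdgeColour.other_other]; exact P.B₀B₂) P.ac h)

/-- Few vertices of `A₁` have to be removed to make all edges inside `A₁` have the colour `k`. -/
theorem Pure.exists_prune (P : S.Pure k a b c h₁ h₂ Q A₁ A₂ A₀ B₁ B₂ B₀) (hκ : 10 ≤ κ)
    (hδ : 1000 * κ ≤ δ) (ht : 1000000 * δ ≤ t) (l₁ : 2 * t - 1200 * δ ≤ A₁.card)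
    (l₂ : 2 * t - 1200 * δ ≤ A₂.card) (l₀ : t - 1200 * δ ≤ (A₀.card : ℝ) + B₀.card) :
    ∃ A ⊆ A₁, (A₁.card : ℝ) - 4000 * δ ≤ A.card ∧ S.Only k A A := by
  have oo := EdgeColour.other_other k
  have dis : ∀ {X Y : Finset V} {i j : ι}, X ⊆ S.U k i → Y ⊆ S.U k j → i ≠ j → Disjoint X Y :=
    fun hX hY h => Finset.disjoint_of_subset_left hX (Finset.disjoint_of_subset_right hY (disjoint_U h))
  have d12 := dis P.sA₁ P.sA₂ P.ab
  have d01 : Disjoint (A₀ ∪ B₀) A₁ := Finset.disjoint_union_left.2 ⟨dis P.sA₀ P.sA₁ P.ac.symm,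
    (disjoint_Cl_of (P.sA₁.trans (U_subset_Cl _ _)) (P.sB₀.trans (U_subset_Cl _ _))).symm⟩
  have d02 : Disjoint (A₀ ∪ B₀) A₂ := Finset.disjoint_union_left.2 ⟨dis P.sA₀ P.sA₂ P.bc.symm,
    (disjoint_Cl_of (P.sA₂.trans (U_subset_Cl _ _)) (P.sB₀.trans (U_subset_Cl _ _))).symm⟩
  have dZ : Disjoint A₀ B₀ :=
    disjoint_Cl_of (P.sA₀.trans (U_subset_Cl _ _)) (P.sB₀.trans (U_subset_Cl _ _))
  have cZ := Finset.cast_card_union_of_disjoint dZ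
  -- Edges of the wrong colour inside `A₁` form hub triangles with vertices of `A₂`. There is room
  -- for a further `t - 1200 * δ` or so triangles across `A₀ ∪ B₀`, `A₁` and `A₂`, so `1500 * δ` of
  -- the former would be too many.
  obtain ⟨N, N1, N2⟩ := exists_nat_near (x := 1500 * δ) (by linarith)
  rcases (Pk.nil (S := S) (k := k.other) (c := Q)).greedy_or A₁ A₁ A₂ N with
    ⟨X, hX, Y, hY, Z, hZ, cX, cY, cZ', hP⟩ | ⟨m, hm, X, hX, Y, hY, Z, hZ, cX, cY, cZ', hP, hmax⟩
  · exfalso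
    have e1 := Finset.cast_card_sdiff_ge A₁ (X ∪ Y)
    have e2 := Finset.cast_card_sdiff_ge A₂ Z
    have e3 := Finset.cast_card_union_le X Y
    rw [cX, cY] at e3
    rw [cZ'] at e2
    obtain ⟨n, n1, n2, X', hX', Y', hY', Z', hZ', -, -, -, hP'⟩ := hP.exists_tripartite hκ
      (A := A₀ ∪ B₀) (B := A₁ \ (X ∪ Y)) (C := A₂ \ Z)
      (Finset.disjoint_of_subset_right Finset.sdiff_subset d01)
      (Finset.disjoint_of_subset_right Finset.sdiff_subset d02)
      (Finset.disjoint_of_subset_left Finset.sdiff_subset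
        (Finset.disjoint_of_subset_right Finset.sdiff_subset d12))
      (Finset.disjoint_left.2 fun v h h' => by
        simp only [Finset.mem_union (s := ∅ ∪ X ∪ Y), Finset.mem_union (s := ∅ ∪ X),
          Finset.mem_union (s := (∅ : Finset V)), Finset.notMem_empty, false_or] at h'
        rcases h' with (h' | h') | h'
        · exact Finset.disjoint_left.1 d01 h (hX h')
        · exact Finset.disjoint_left.1 d01 h (hY h')
        · exact Finset.disjoint_left.1 d02 h (hZ h'))
      (Finset.disjoint_left.2 fun v h h' => by
        simp only [Finset.mem_sdiff, Finset.mem_union, Finset.notMem_empty, false_or] at h h'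
        rcases h' with h' | h'
        · exact h.2 h'
        · exact Finset.disjoint_left.1 d12 h.1 (hZ h'))
      (Finset.disjoint_left.2 fun v h h' => by
        simp only [Finset.mem_sdiff, Finset.mem_union, Finset.notMem_empty, false_or] at h h'
        rcases h' with (h' | h') | h'
        · exact Finset.disjoint_left.1 d12 (hX h') h.1
        · exact Finset.disjoint_left.1 d12 (hY h') h.1
        · exact h.2 h')
      (((P.A₀A₁.union_left P.B₀A₁).full hκ).mono subset_rfl Finset.sdiff_subset)
      (((P.A₀A₂.union_left P.B₀A₂).full hκ).mono subset_rfl Finset.sdiff_subset).fullCol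
      ((P.A₁A₂.full hκ).mono Finset.sdiff_subset Finset.sdiff_subset).fullCol
      (x := t - 1200 * δ) (by linarith) (by linarith) (by linarith) (by linarith)
    have := hP'.le
    push_cast at this
    linarith
  · have hmN : (m : ℝ) ≤ N := by exact_mod_cast hm.le
    have e3 := Finset.cast_card_union_le X Y
    rw [cX, cY] at e3
    refine ⟨A₁ \ (X ∪ Y), Finset.sdiff_subset, ?_, ?_⟩
    · linarith [Finset.cast_card_sdiff_ge A₁ (X ∪ Y)]
    · intro x hx y hy j d hE
      by_contra hj
      rw [EdgeColour.eq_other_of_ne hj] at hE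
      obtain ⟨w, hw, w1, w2, w3⟩ := Finset.exists_mem_notMem₃ (A := A₂) (B := S.bad x)
        (C := S.bad y) (D := Z) (by rw [cZ']; linarith [S.card_bad x, S.card_bad y])
      rw [mem_bad, not_not] at w1 w2
      simp only [Finset.mem_sdiff, Finset.mem_union, not_or] at hx hy
      have q1 := P.A₁A₂ x hx.1 w hw w1
      have q2 := P.A₁A₂ y hy.1 w hw w2
      have hd := (S.tri hE q1 q2).1
      subst hd
      have f1 := Finset.disjoint_left.1 d12 hx.1
      have f2 := Finset.disjoint_left.1 d12 hy.1
      have := hmax x hx.1 y hy.1 w hw ⟨hE, q1, q2⟩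
      simp only [Finset.mem_union, Finset.notMem_empty, false_or] at this
      have g1 := @hX w
      have g2 := @hY w
      have g3 := @hZ x
      have g4 := @hZ y
      have g5 : w ∉ A₁ := fun h => Finset.disjoint_left.1 d12 h hw
      tauto

variable (S) in
/-- The extremal colouring, with `m` as the error in the sizes of the parts. -/
structure IsExtremal (k : EdgeColour) (m : ℝ) (A₁ A₂ B₁ B₂ Z : Finset V) : Prop where
  dA : Disjoint A₁ A₂
  dB : Disjoint B₁ B₂
  dAB : Disjoint (A₁ ∪ A₂) (B₁ ∪ B₂)
  dZ : Disjoint (A₁ ∪ A₂ ∪ (B₁ ∪ B₂)) Z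
  cA₁ : 2 * t - m ≤ A₁.card ∧ (A₁.card : ℝ) ≤ 2 * t + m
  cA₂ : 2 * t - m ≤ A₂.card ∧ (A₂.card : ℝ) ≤ 2 * t + m
  cB₁ : 2 * t - m ≤ B₁.card ∧ (B₁.card : ℝ) ≤ 2 * t + m
  cB₂ : 2 * t - m ≤ B₂.card ∧ (B₂.card : ℝ) ≤ 2 * t + m
  cZ : t - m ≤ Z.card ∧ (Z.card : ℝ) ≤ t + m
  A₁A₁ : S.Only k A₁ A₁
  A₂A₂ : S.Only k A₂ A₂
  B₁B₁ : S.Only k.other B₁ B₁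
  B₂B₂ : S.Only k.other B₂ B₂
  A₁B₁ : S.Only k.other A₁ B₁
  A₂B₂ : S.Only k.other A₂ B₂
  A₁B₂ : S.Only k A₁ B₂
  A₂B₁ : S.Only k A₂ B₁
  A₁Z : S.Only k.other A₁ Z
  A₂Z : S.Only k.other A₂ Z
  B₁Z : S.Only k B₁ Z
  B₂Z : S.Only k B₂ Z
  A₁A₂ : S.FullCol k.other A₁ A₂
  A₂A₁ : S.FullCol k.other A₂ A₁
  B₁B₂ : S.FullCol k B₁ B₂
  B₂B₁ : S.FullCol k B₂ B₁

theorem exists_isExtremal [Nonempty ι] (S : CleanColouring V ι t κ) (hκ : 10 ≤ κ)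
    (hδ : 1000 * κ ≤ δ) (ht : 2000000 * δ ≤ t) (hδ' : 100 * κ * t ≤ δ ^ 2) :
    ∃ k A₁ A₂ B₁ B₂ Z, S.IsExtremal k (6000 * δ) A₁ A₂ B₁ B₂ Z := by
  obtain ⟨k, hr⟩ : ∃ k, S.Rich k (10000 * δ) := by
    rcases rich_or_rich S hκ hδ ht .red with h | h
    · exact ⟨_, h⟩
    · exact ⟨_, h⟩
  have ht' : 1000000 * δ ≤ t := by linarith
  obtain ⟨a, b, c, h₁, h₂, Q, A₁, A₂, A₀, B₁, B₂, B₀, P, m₁, m₂, tot⟩ :=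
    exists_pure S hκ hδ ht' hδ' hr
  obtain ⟨u1, u2, u3, u4, u0⟩ := P.sizes hκ hδ ht' tot m₁ m₂
  have l1 : 2 * t - 1200 * δ ≤ A₁.card := by linarith
  have l2 : 2 * t - 1200 * δ ≤ A₂.card := by linarith
  have l3 : 2 * t - 1200 * δ ≤ B₁.card := by linarith
  have l4 : 2 * t - 1200 * δ ≤ B₂.card := by linarith
  have l0 : t - 1200 * δ ≤ (A₀.card : ℝ) + B₀.card := by linarith
  have l0' : t - 1200 * δ ≤ (B₀.card : ℝ) + A₀.card := by linarith
  obtain ⟨A₁', s1, c1, o1⟩ := P.exists_prune hκ hδ ht' l1 l2 l0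
  obtain ⟨A₂', s2, c2, o2⟩ := P.swap.exists_prune hκ hδ ht' l2 l1 l0
  obtain ⟨B₁', s3, c3, o3⟩ := P.flip.exists_prune hκ hδ ht' l3 l4 l0'
  obtain ⟨B₂', s4, c4, o4⟩ := P.flip.swap.exists_prune hκ hδ ht' l4 l3 l0'
  have oo := EdgeColour.other_other k
  have k1 : 2 * κ < A₁.card := by linarith
  have k2 : 2 * κ < A₂.card := by linarith
  have k3 : 2 * κ < B₁.card := by linarith
  have k4 : 2 * κ < B₂.card := by linarith
  have dis : ∀ {X Y : Finset V} {k : EdgeColour} {i j : ι}, X ⊆ S.U k i → Y ⊆ S.U k j → i ≠ j →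
      Disjoint X Y := fun hX hY h =>
    Finset.disjoint_of_subset_left hX (Finset.disjoint_of_subset_right hY (disjoint_U h))
  have dis' : ∀ {X Y : Finset V} {i j : ι}, X ⊆ S.U k i → Y ⊆ S.U k.other j → Disjoint X Y :=
    fun hX hY => disjoint_Cl_of (hX.trans (U_subset_Cl _ _)) (hY.trans (U_subset_Cl _ _))
  have t1 := s1.trans P.sA₁
  have t2 := s2.trans P.sA₂
  have t3 := s3.trans P.sB₁
  have t4 := s4.trans P.sB₂
  have cZ := Finset.cast_card_union_of_disjoint (dis' P.sA₀ P.sB₀)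
  have b1 := P.flip.only_A₁Z k1
  have b2 := P.flip.swap.only_A₁Z k2
  rw [oo, Finset.union_comm] at b1 b2
  refine ⟨k, A₁', A₂', B₁', B₂', A₀ ∪ B₀, dis t1 t2 P.ab, dis t3 t4 P.h12, ?_, ?_,
    ⟨by linarith, by linarith [Finset.cast_card_mono s1]⟩,
    ⟨by linarith, by linarith [Finset.cast_card_mono s2]⟩,
    ⟨by linarith, by linarith [Finset.cast_card_mono s3]⟩,
    ⟨by linarith, by linarith [Finset.cast_card_mono s4]⟩, ⟨by linarith, by linarith⟩,
    o1, o2, o3, o4, (P.only_A₁B₁ k4).mono s1 s3, (P.swap.only_A₁B₁ k3).mono s2 s4,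
    (P.only_A₁B₂ k2).mono s1 s4, (P.swap.only_A₁B₂ k1).mono s2 s3,
    (P.only_A₁Z k4).mono s1 subset_rfl, (P.swap.only_A₁Z k3).mono s2 subset_rfl,
    b1.mono s3 subset_rfl, b2.mono s4 subset_rfl, ((P.A₁A₂.mono s1 s2).full hκ).fullCol,
    ((P.A₁A₂.mono s1 s2).symm.full hκ).fullCol, ((P.B₁B₂.mono s3 s4).full hκ).fullCol,
    ((P.B₁B₂.mono s3 s4).symm.full hκ).fullCol⟩
  · simp only [Finset.disjoint_union_left, Finset.disjoint_union_right]
    exact ⟨⟨dis' t1 t3, dis' t2 t3⟩, dis' t1 t4, dis' t2 t4⟩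
  · simp only [Finset.disjoint_union_left, Finset.disjoint_union_right]
    exact ⟨⟨⟨dis t1 P.sA₀ P.ac, dis t2 P.sA₀ P.bc⟩, (dis' P.sA₀ t3).symm, (dis' P.sA₀ t4).symm⟩,
      ⟨dis' t1 P.sB₀, dis' t2 P.sB₀⟩, dis t3 P.sB₀ P.h1Q, dis t4 P.sB₀ P.h2Q⟩

end CleanColouring

/-! ### Triangle components of a graph. -/

section TriangleComponents

variable {V : Type*}

/-- The edges that are triangle-connected to `e`. -/
def triangleClass (H : SimpleGraph V) (e : H.edgeSet) : Set (Sym2 V) :=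
  Subtype.val '' {f | TriangleConnected H e f}

theorem triangleClass_eq {H : SimpleGraph V} {e f : H.edgeSet} (h : TriangleConnected H e f) :
    triangleClass H e = triangleClass H f := by
  have : {g | TriangleConnected H e g} = {g | TriangleConnected H f g} := by
    ext g
    exact ⟨fun hg => (h.symm _ _).trans _ _ _ hg, fun hg => h.trans _ _ _ hg⟩
  rw [triangleClass, triangleClass, this]

theorem triangleConnected_of_eq {H : SimpleGraph V} {e f : H.edgeSet}
    (h : triangleClass H e = triangleClass H f) : TriangleConnected H e f := by
  have : (f : Sym2 V) ∈ triangleClass H e := h ▸ ⟨f, Relation.EqvGen.refl f, rfl⟩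
  obtain ⟨g, hg, hgf⟩ := this
  rwa [Subtype.ext hgf] at hg

/-- `uv` is an edge of `H` in the triangle component `c`. -/
def CompAdj (H : SimpleGraph V) (c : Set (Sym2 V)) (u v : V) : Prop :=
  ∃ h : s(u, v) ∈ H.edgeSet, c = triangleClass H ⟨s(u, v), h⟩

variable {H : SimpleGraph V} {c d e : Set (Sym2 V)} {u v w : V}

theorem CompAdj.adj (h : CompAdj H c u v) : H.Adj u v := h.1

theorem exists_compAdj (h : H.Adj u v) : ∃ c, CompAdj H c u v := ⟨_, h, rfl⟩

theorem CompAdj.symm (h : CompAdj H c u v) : CompAdj H c v u := by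
  obtain ⟨h, rfl⟩ := h
  have e : s(u, v) = s(v, u) := Sym2.eq_swap
  exact ⟨e ▸ h, by congr 1; exact Subtype.ext e⟩

theorem CompAdj.unique (h : CompAdj H c u v) (h' : CompAdj H d u v) : c = d := by
  obtain ⟨h, rfl⟩ := h
  obtain ⟨h', rfl⟩ := h'
  rfl

theorem CompAdj.tri (h : CompAdj H c u v) (h' : CompAdj H d u w) (h'' : CompAdj H e v w) :
    c = d ∧ c = e := by
  obtain ⟨h, rfl⟩ := h
  obtain ⟨h', rfl⟩ := h'
  obtain ⟨h'', rfl⟩ := h''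
  exact ⟨triangleClass_eq (Relation.EqvGen.rel _ _ ⟨u, v, w, h, h', h'', rfl, rfl⟩),
    triangleClass_eq (Relation.EqvGen.rel _ _ ⟨v, u, w, SimpleGraph.Adj.symm h, h'', h', Sym2.eq_swap, rfl⟩)⟩

theorem exists_component_of_clique {K : Finset V} (hK : ∀ x ∈ K, ∀ y ∈ K, x ≠ y → H.Adj x y) :
    ∃ c, ∀ x ∈ K, ∀ y ∈ K, x ≠ y → CompAdj H c x y := by
  by_cases h : ∃ x ∈ K, ∃ y ∈ K, x ≠ y
  · obtain ⟨x, hx, y, hy, hxy⟩ := h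
    obtain ⟨c, hc⟩ := exists_compAdj (hK x hx y hy hxy)
    have star : ∀ z ∈ K, x ≠ z → CompAdj H c x z := by
      intro z hz hxz
      by_cases hyz : y = z
      · exact hyz ▸ hc
      · obtain ⟨d, hd⟩ := exists_compAdj (hK x hx z hz hxz)
        obtain ⟨e, he⟩ := exists_compAdj (hK y hy z hz hyz)
        rwa [(hc.tri hd he).1]
    refine ⟨c, fun z hz w hw hzw => ?_⟩
    by_cases h1 : x = z
    · subst h1; exact star w hw hzw
    by_cases h2 : x = w
    · subst h2; exact (star z hz h1).symm
    obtain ⟨e, he⟩ := exists_compAdj (hK z hz w hw hzw)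
    rwa [((star z hz h1).tri (star w hw h2) he).2]
  · push Not at h
    exact ⟨∅, fun x hx y hy hxy => absurd (h x hx y hy) hxy⟩

theorem isTCTF_of_compAdj [DecidableEq V] {F : Finset (Finset V)} (hF : F.Nonempty)
    (h : ∀ s ∈ F, ∃ x y z, CompAdj H c x y ∧ CompAdj H c x z ∧ CompAdj H c y z ∧ s = {x, y, z})
    (hd : (F : Set (Finset V)).PairwiseDisjoint id) : IsTCTF H F := by
  obtain ⟨s₀, hs₀⟩ := hF
  obtain ⟨x₀, y₀, z₀, ⟨h₀, hc⟩, -⟩ := h s₀ hs₀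
  refine ⟨⟨fun s hs => ?_, hd⟩, _, ⟨⟨s(x₀, y₀), h₀⟩, rfl⟩, fun s hs e he => ?_⟩
  · obtain ⟨x, y, z, h1, h2, h3, rfl⟩ := h s hs
    rw [SimpleGraph.is3Clique_triple_iff]
    exact ⟨h1.adj, h2.adj, h3.adj⟩
  · obtain ⟨x, y, z, h1, h2, h3, rfl⟩ := h s hs
    obtain ⟨e, hE⟩ := e
    induction e with
    | h p q =>
      have hp := he p (by simp)
      have hq := he q (by simp)
      have hpq : p ≠ q := H.ne_of_adj hE
      have : CompAdj H c p q := by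
        simp only [Finset.mem_insert, Finset.mem_singleton] at hp hq
        rcases hp with rfl | rfl | rfl <;> rcases hq with rfl | rfl | rfl <;>
          first
            | exact absurd rfl hpq
            | assumption
            | (apply CompAdj.symm; assumption)
      obtain ⟨_, hc'⟩ := this
      exact triangleConnected_of_eq (hc.symm.trans hc')

end TriangleComponents

/-! ### Covering by monochromatic cliques. -/

section Cliques

variable {V : Type*} [Fintype V]

/-- Ramsey's theorem for two colours on a nearly complete graph. -/
theorem exists_mono_clique (H : EdgeColour → SimpleGraph V) {s : ℝ} (hs : 0 < s)
    (hsp : ∀ v, ((Finset.univ.filter fun w => ¬ ∃ k, (H k).Adj v w).card : ℝ) ≤ s) (n : ℕ) :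
    ∀ p : EdgeColour → ℕ, p .red + p .blue = n → ∀ W : Finset V, (2 ^ n - 1) * s ≤ W.card →
      ∃ k, ∃ K ⊆ W, K.card = p k ∧ ∀ x ∈ K, ∀ y ∈ K, x ≠ y → (H k).Adj x y := by
  induction n with
  | zero => exact fun p hp W _ => ⟨.red, ∅, by simp, by simp; omega, by simp⟩
  | succ n ih =>
    intro p hp W hW
    by_cases h0 : ∃ k, p k = 0
    · obtain ⟨k, hk⟩ := h0
      exact ⟨k, ∅, by simp, by simp [hk], by simp⟩
    push Not at h0
    have hn : (1 : ℝ) ≤ 2 ^ n := one_le_pow₀ (by norm_num)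
    rw [pow_succ] at hW
    have hWpos : (0 : ℝ) < W.card := by nlinarith
    obtain ⟨v, hv⟩ : W.Nonempty := by
      rw [← Finset.card_pos]; exact_mod_cast hWpos
    set N : EdgeColour → Finset V := fun k => W.filter fun w => (H k).Adj v w with hN
    have hcov : W ⊆ (Finset.univ.filter fun w => ¬ ∃ k, (H k).Adj v w) ∪ (N .red ∪ N .blue) := by
      intro w hw
      by_cases h : ∃ k, (H k).Adj v w
      · obtain ⟨k, hk⟩ := h
        cases k <;> simp [hN, hw, hk]
      · simp only [Finset.mem_union, Finset.mem_filter, Finset.mem_univ, true_and]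
        exact Or.inl h
    have h1 := Finset.cast_card_mono hcov
    have h2 := Finset.cast_card_union_le (Finset.univ.filter fun w => ¬ ∃ k, (H k).Adj v w)
      (N .red ∪ N .blue)
    have h3 := Finset.cast_card_union_le (N .red) (N .blue)
    have h4 := hsp v
    -- Otherwise `W` has fewer than `2 * (2 ^ n - 1) * s + s = (2 ^ (n + 1) - 1) * s` vertices.
    obtain ⟨k, hk⟩ : ∃ k, (2 ^ n - 1) * s ≤ (N k).card := by
      by_contra hc
      push Not at hc
      have := hc .red
      have := hc .blue
      linarith
    obtain ⟨j, K, hK, cK, hadj⟩ := ih (Function.update p k (p k - 1)) (by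
      have := h0 k
      cases k <;> simp <;> omega) (N k) hk
    have hvK : v ∉ K := fun h => (H k).loopless.irrefl v (Finset.mem_filter.1 (hK h)).2
    by_cases hj : j = k
    · subst hj
      refine ⟨j, insert v K, Finset.insert_subset hv (hK.trans (Finset.filter_subset _ _)), ?_, ?_⟩
      · rw [Finset.card_insert_of_notMem hvK, cK, Function.update_self]
        have := h0 j
        omega
      · intro x hx y hy hxy
        rcases Finset.mem_insert.1 hx with rfl | hx' <;> rcases Finset.mem_insert.1 hy with rfl | hy'
        · exact absurd rfl hxy
        · exact (Finset.mem_filter.1 (hK hy')).2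
        · exact (Finset.mem_filter.1 (hK hx')).2.symm
        · exact hadj x hx' y hy' hxy
    · exact ⟨j, K, hK.trans (Finset.filter_subset _ _), by rw [cK, Function.update_of_ne hj], hadj⟩

/-- A family of disjoint monochromatic cliques that covers all but a few vertices. -/
theorem exists_clique_cover (H : EdgeColour → SimpleGraph V) {M : ℕ} (hM : 0 < M) {L : ℝ}
    (hL : ∀ W : Finset V, L ≤ W.card →
      ∃ k, ∃ K ⊆ W, K.card = M ∧ ∀ x ∈ K, ∀ y ∈ K, x ≠ y → (H k).Adj x y) :
    ∃ (cov : Finset V) (col : V → EdgeColour) (K : V → Finset V),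
      ((Finset.univ \ cov).card : ℝ) < L ∧ ∀ v ∈ cov, v ∈ K v ∧ K v ⊆ cov ∧ (K v).card = M ∧
        (∀ x ∈ K v, ∀ y ∈ K v, x ≠ y → (H (col v)).Adj x y) ∧
        ∀ w ∈ K v, K w = K v ∧ col w = col v := by
  set P : Finset V → Prop := fun cov => ∃ (col : V → EdgeColour) (K : V → Finset V),
    ∀ v ∈ cov, v ∈ K v ∧ K v ⊆ cov ∧ (K v).card = M ∧
      (∀ x ∈ K v, ∀ y ∈ K v, x ≠ y → (H (col v)).Adj x y) ∧
      ∀ w ∈ K v, K w = K v ∧ col w = col v with hP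
  obtain ⟨cov, hcov, hmax⟩ := Finset.exists_max_image (Finset.univ.powerset.filter P) Finset.card
    ⟨∅, by simp only [hP, Finset.mem_filter]; exact ⟨by simp, fun _ => .red, fun _ => ∅, by simp⟩⟩
  simp only [Finset.mem_filter, Finset.mem_powerset, Finset.subset_univ, true_and] at hcov hmax
  obtain ⟨col, K, hK⟩ := hcov
  refine ⟨cov, col, K, ?_, hK⟩
  by_contra hc
  push Not at hc
  obtain ⟨k, K₀, hK₀, cK₀, hadj⟩ := hL _ hc
  have hd : ∀ v ∈ cov, v ∉ K₀ := fun v hv h => (Finset.mem_sdiff.1 (hK₀ h)).2 hv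
  have := hmax (cov ∪ K₀) ⟨fun v => if v ∈ K₀ then k else col v,
    fun v => if v ∈ K₀ then K₀ else K v, by
    intro v hv
    by_cases h : v ∈ K₀
    · simp only [h, if_true]
      exact ⟨trivial, Finset.subset_union_right, cK₀, hadj, fun w hw => by simp [hw]⟩
    · have hv' : v ∈ cov := by simpa [h] using hv
      obtain ⟨h1, h2, h3, h4, h5⟩ := hK v hv'
      simp only [h, if_false]
      refine ⟨h1, h2.trans Finset.subset_union_left, h3, h4, fun w hw => ?_⟩
      simp only [hd w (h2 hw), if_false]
      exact h5 w hw⟩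
  rw [Finset.card_union_of_disjoint (Finset.disjoint_left.2 hd), cK₀] at this
  omega

end Cliques

/-! ### Construction of the clean colouring. -/

/-- An edge to a clique, in the clique's colour, can miss the clique's component only if it is the
vertex's sole edge of that colour to the clique (`Un`). For each vertex this happens at most once
per clique, and there are at most `9 * t / M` cliques. Vertices that are the exceptional end for too
many others are deleted. -/
theorem exists_cleanColouring {V : Type*} [Fintype V] (H : EdgeColour → SimpleGraph V)
    (hH : ∀ k j u v, (H k).Adj u v → (H j).Adj u v → k = j) {M : ℕ} (hM : 0 < M) {t κ L : ℝ}
    (hκ : 0 < κ) (ht : 0 < t) (hκt : κ ≤ t) (hMt : 1000 * t ^ 2 ≤ κ ^ 2 * M)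
    (hV : (Fintype.card V : ℝ) ≤ 9 * t) (hV' : 9 * t - κ / 4 ≤ Fintype.card V) (hLκ : L ≤ κ / 4)
    (hsp : ∀ v, ((Finset.univ.filter fun w => ¬ ∃ k, (H k).Adj v w).card : ℝ) ≤ κ / 4)
    (hL : ∀ W : Finset V, L ≤ W.card →
      ∃ k, ∃ K ⊆ W, K.card = M ∧ ∀ x ∈ K, ∀ y ∈ K, x ≠ y → (H k).Adj x y)
    (hpack : ∀ k c (F : Finset (Finset V)), (∀ s ∈ F, ∃ x y z, CompAdj (H k) c x y ∧
      CompAdj (H k) c x z ∧ CompAdj (H k) c y z ∧ s = {x, y, z}) →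
      (F : Set (Finset V)).PairwiseDisjoint id → (F.card : ℝ) ≤ t + κ) :
    ∃ (A : Finset V) (S : CleanColouring A (Set (Sym2 V)) t κ),
      ∀ k c u v, S.E k c u v ↔ CompAdj (H k) c u v := by
  obtain ⟨cov, col, K, hcov, hK⟩ := exists_clique_cover H hM hL
  have hc : ∀ v, ∃ c, v ∈ cov → ∀ x ∈ K v, ∀ y ∈ K v, x ≠ y → CompAdj (H (col v)) c x y := by
    intro v
    by_cases hv : v ∈ cov
    · obtain ⟨c, hc⟩ := exists_component_of_clique (hK v hv).2.2.2.1
      exact ⟨c, fun _ => hc⟩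
    · exact ⟨∅, fun h => absurd h hv⟩
  choose hm hhm using hc
  have hM0 : (0 : ℝ) < M := by exact_mod_cast hM
  have hMκ : 1000 * t ≤ κ * M := by
    have h1 : κ * (κ * M) ≤ t * (κ * M) := by gcongr
    have h2 : t * (1000 * t) ≤ t * (κ * M) := by nlinarith
    exact le_of_mul_le_mul_left h2 ht
  have count : ∀ F : Finset (Finset V), (∀ s ∈ F, ∃ v ∈ cov, s = K v) →
      (F.card : ℝ) * M ≤ 9 * t := by
    intro F hF
    have hd : (F : Set (Finset V)).PairwiseDisjoint id := by
      intro s hs s' hs' hne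
      obtain ⟨v, hv, rfl⟩ := hF s hs
      obtain ⟨v', hv', rfl⟩ := hF s' hs'
      refine Finset.disjoint_left.2 fun w hw hw' => hne ?_
      rw [← ((hK v hv).2.2.2.2 w hw).1, ← ((hK v' hv').2.2.2.2 w hw').1]
    have h1 : (F.biUnion id).card = F.card * M := by
      rw [Finset.card_biUnion (fun s hs s' hs' h => hd hs hs' h), Finset.sum_const_nat]
      intro s hs
      obtain ⟨v, hv, rfl⟩ := hF s hs
      exact (hK v hv).2.2.1
    have h2 := Finset.card_le_univ (F.biUnion id)
    have h3 : (F.card : ℝ) * M ≤ Fintype.card V := by rw [h1] at h2; exact_mod_cast h2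
    linarith
  have few : ∀ x : ℝ, x * M ≤ 9 * t → x ≤ κ / 100 := by
    intro x hx
    by_contra h
    push Not at h
    nlinarith
  set Un : V → V → Prop := fun v w => (H (col w)).Adj v w ∧
    ∀ w' ∈ K w, (H (col w)).Adj v w' → w' = w with hUn
  have out : ∀ v, ((cov.filter fun w => Un v w).card : ℝ) * M ≤ 9 * t := by
    intro v
    have h1 := count ((cov.filter fun w => Un v w).image K) (by
      intro s hs
      obtain ⟨w, hw, rfl⟩ := Finset.mem_image.1 hs
      exact ⟨w, (Finset.mem_filter.1 hw).1, rfl⟩)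
    rwa [Finset.card_image_of_injOn] at h1
    intro w hw w' hw' hww
    simp only [Finset.coe_filter, Set.mem_ofPred_eq, hUn] at hw hw'
    have h2 : w ∈ K w' := by
      have := (hK w hw.1).1
      rwa [hww] at this
    have h3 := ((hK w' hw'.1).2.2.2.2 w h2).2
    exact hw'.2.2 w h2 (h3 ▸ hw.2.1)
  have key : ∀ v ∈ cov, ∀ w ∈ cov, ∀ j, (H j).Adj v w → ¬ Un v w → ¬ Un w v →
      (col v = col w → hm v ≠ hm w → ∃ d, CompAdj (H (col v).other) d v w) ∧
      (col v ≠ col w → CompAdj (H (col v)) (hm v) v w ∨ CompAdj (H (col w)) (hm w) v w) := by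
    have aux : ∀ v, ∀ w ∈ cov, (H (col w)).Adj v w → ¬ Un v w → CompAdj (H (col w)) (hm w) v w := by
      intro v w hw hadj hn
      simp only [hUn, not_and, not_forall] at hn
      obtain ⟨w', hw', hadj', hne⟩ := hn hadj
      obtain ⟨d, hd⟩ := exists_compAdj hadj
      obtain ⟨e, he⟩ := exists_compAdj hadj'
      rwa [← (hd.tri he (hhm w hw w (hK w hw).1 w' hw' (Ne.symm hne))).2]
    intro v hv w hw j hj hn hn'
    have a1 := fun h => aux v w hw h hn
    have a2 := fun h => (aux w v hv h hn').symm
    refine ⟨fun h1 h2 => ?_, fun h => ?_⟩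
    · rcases (col v).eq_or_eq_other j with rfl | rfl
      · have e1 := a2 hj.symm
        have e2 := a1 (h1 ▸ hj)
        rw [← h1] at e2
        exact absurd (e1.unique e2) h2
      · exact exists_compAdj hj
    · rcases (col v).eq_or_eq_other j with rfl | rfl
      · exact Or.inl (a2 hj.symm)
      · rw [← EdgeColour.eq_other_of_ne (Ne.symm h)] at hj
        exact Or.inr (a1 hj)
  -- `out` bounds only the out-degrees of `Un`; double counting shows that few vertices have large
  -- in-degree.
  set R := cov.filter fun w => κ / 2 < ((cov.filter fun v => Un v w).card : ℝ) with hR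
  have cR : (R.card : ℝ) ≤ κ / 4 := by
    have h1 : ∑ v ∈ cov, ((R.filter fun w => Un v w).card : ℝ) =
        ∑ w ∈ R, ((cov.filter fun v => Un v w).card : ℝ) := by
      exact_mod_cast Finset.sum_card_bipartiteAbove_eq_sum_card_bipartiteBelow (fun v w => Un v w)
    have h2 : ∑ w ∈ R, (κ / 2) ≤ ∑ w ∈ R, ((cov.filter fun v => Un v w).card : ℝ) :=
      Finset.sum_le_sum fun w hw => (Finset.mem_filter.1 hw).2.le
    have h3 : ∑ v ∈ cov, ((R.filter fun w => Un v w).card : ℝ) ≤ ∑ v ∈ cov, 9 * t / M := by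
      refine Finset.sum_le_sum fun v _ => ?_
      rw [le_div_iff₀ hM0]
      have h4 := Finset.cast_card_mono (Finset.filter_subset_filter (fun w => Un v w)
        (Finset.filter_subset _ _ : R ⊆ cov))
      exact (mul_le_mul_of_nonneg_right h4 hM0.le).trans (out v)
    simp only [Finset.sum_const, nsmul_eq_mul] at h2 h3
    have h5 : (cov.card : ℝ) ≤ 9 * t := by
      have : (cov.card : ℝ) ≤ Fintype.card V := by exact_mod_cast Finset.card_le_univ cov
      linarith
    have h6 : (cov.card : ℝ) * (9 * t / M) ≤ 9 * t * (9 * t / M) := by gcongr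
    have h7 : 9 * t * (9 * t / M) ≤ κ / 4 * (κ / 2) := by
      rw [← mul_div_assoc, div_le_iff₀ hM0]
      nlinarith
    by_contra h
    push Not at h
    nlinarith
  have cA := Finset.cast_card_sdiff_ge cov R
  have cU : (Fintype.card V : ℝ) ≤ (Finset.univ \ cov).card + cov.card := by
    have := Finset.cast_card_sdiff_ge Finset.univ cov
    rw [Finset.card_univ] at this
    linarith
  set A := cov \ R with hA
  have hAc : ∀ v : A, (v : V) ∈ cov := fun v => (Finset.mem_sdiff.1 v.2).1
  refine ⟨A,
    { E := fun k c u v => CompAdj (H k) c u v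
      symm := fun h => h.symm
      uniq := ?_
      tri := fun h h' h'' => h.tri h' h''
      col := fun v => col v
      hm := fun v => hm v
      Good := fun v w => (col v = col w → hm v ≠ hm w → ∃ d, CompAdj (H (col v).other) d v w) ∧
        (col v ≠ col w → CompAdj (H (col v)) (hm v) v w ∨ CompAdj (H (col w)) (hm w) v w)
      good_symm := ?_
      good_same := fun h => h.1
      good_diff := fun h => h.2
      bad_le := ?_
      dense := ?_
      pack := ?_
      card_ge := ?_ }, fun k c u v => Iff.rfl⟩
  · intro k c j d u v h h'
    have := hH k j u v h.adj h'.adj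
    subst this
    exact ⟨rfl, h.unique h'⟩
  · intro u v h
    refine ⟨fun h1 h2 => ?_, fun h1 => ?_⟩
    · obtain ⟨d, hd⟩ := h.1 h1.symm h2.symm
      exact ⟨d, h1 ▸ hd.symm⟩
    · rcases h.2 h1.symm with h | h
      · exact Or.inr h.symm
      · exact Or.inl h.symm
  · intro v
    have hv := v.2
    simp only [hA, hR, Finset.mem_sdiff, Finset.mem_filter, not_and, not_lt] at hv
    have h1 := hv.2 hv.1
    have h2 := few _ (out v)
    have h3 := hsp v
    rw [← Finset.card_map (Function.Embedding.subtype (· ∈ A))]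
    refine (Finset.cast_card_mono (B := (Finset.univ.filter fun w => ¬ ∃ k, (H k).Adj v w) ∪
      ((cov.filter fun w => Un v w) ∪ (cov.filter fun w => Un w v))) ?_).trans ?_
    · intro w hw
      simp only [Finset.mem_map, Finset.mem_filter, Finset.mem_univ, true_and,
        Function.Embedding.subtype_apply] at hw
      obtain ⟨w, hw, rfl⟩ := hw
      by_contra hn
      simp only [Finset.mem_union, Finset.mem_filter, Finset.mem_univ, true_and, not_or, not_and,
        not_not] at hn
      obtain ⟨j, hj⟩ := hn.1
      exact hw (key v (hAc v) w (hAc w) j hj (hn.2.1 (hAc w)) (hn.2.2 (hAc w)))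
    · have e1 := Finset.cast_card_union_le (Finset.univ.filter fun w => ¬ ∃ k, (H k).Adj v w)
        ((cov.filter fun w => Un v w) ∪ (cov.filter fun w => Un w v))
      have e2 := Finset.cast_card_union_le (cov.filter fun w => Un v w) (cov.filter fun w => Un w v)
      linarith
  · intro k c B hB hBκ
    -- At most `κ / 100` cliques meet `B`, so three vertices of `B` share a clique.
    have hcount := few _ (count (B.image fun v : A => K v) (by
      intro s hs
      obtain ⟨w, hw, rfl⟩ := Finset.mem_image.1 hs
      exact ⟨w, hAc w, rfl⟩))
    obtain ⟨s, hs, hlt⟩ := Finset.exists_lt_card_fiber_of_mul_lt_card_of_maps_to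
      (fun v hv => Finset.mem_image_of_mem (fun v : A => K v) hv) (n := 2) (by
        have : ((B.image fun v : A => K v).card : ℝ) * 2 < B.card := by linarith
        exact_mod_cast this)
    obtain ⟨x, hx, y, hy, z, hz, hxy, hxz, hyz⟩ := Finset.two_lt_card.1 hlt
    simp only [Finset.mem_filter] at hx hy hz
    have kx := (hK x (hAc x)).1
    have ky := (hK y (hAc y)).1
    have kz := (hK z (hAc z)).1
    rw [hy.2, ← hx.2] at ky
    rw [hz.2, ← hx.2] at kz
    have hcx := hB x hx.1
    have hE := hhm x (hAc x)
    rw [hcx.1, hcx.2] at hE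
    have ne : ∀ {u v : A}, u ≠ v → (u : V) ≠ v := fun h e => h (Subtype.ext e)
    exact ⟨x, hx.1, y, hy.1, z, hz.1, hE x kx y ky (ne hxy), hE x kx z kz (ne hxz),
      hE y ky z kz (ne hyz)⟩
  · intro k c F hF hd
    have hinj := Finset.map_injective (Function.Embedding.subtype (· ∈ A))
    rw [← Finset.card_map ⟨_, hinj⟩]
    refine hpack k c _ ?_ ?_
    · intro s' hs'
      obtain ⟨s, hs, rfl⟩ := Finset.mem_map.1 hs'
      obtain ⟨x, y, z, h1, h2, h3, rfl⟩ := hF s hs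
      exact ⟨x, y, z, h1, h2, h3, by simp⟩
    · intro u hu u' hu' hne
      obtain ⟨s, hs, rfl⟩ := Finset.mem_map.1 (Finset.mem_coe.1 hu)
      obtain ⟨s', hs', rfl⟩ := Finset.mem_map.1 (Finset.mem_coe.1 hu')
      have := hd hs hs' (fun h => hne (by rw [h]))
      simpa [Function.onFun] using this
  · rw [Fintype.card_coe]
    linarith

/-! ### Return to the original graph. -/

theorem CleanColouring.IsExtremal.flip {V ι : Type*} [Fintype V] {t κ m : ℝ}
    {S : CleanColouring V ι t κ} {k : EdgeColour} {A₁ A₂ B₁ B₂ Z : Finset V}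
    (h : S.IsExtremal k m A₁ A₂ B₁ B₂ Z) : S.IsExtremal k.other m B₁ B₂ A₂ A₁ Z where
  dA := h.dB
  dB := h.dA.symm
  dAB := by rw [Finset.union_comm A₂]; exact h.dAB.symm
  dZ := by rw [Finset.union_comm A₂, Finset.union_comm]; exact h.dZ
  cA₁ := h.cB₁
  cA₂ := h.cB₂
  cB₁ := h.cA₂
  cB₂ := h.cA₁
  cZ := h.cZ
  A₁A₁ := h.B₁B₁
  A₂A₂ := h.B₂B₂
  B₁B₁ := by rw [EdgeColour.other_other]; exact h.A₂A₂
  B₂B₂ := by rw [EdgeColour.other_other]; exact h.A₁A₁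
  A₁B₁ := by rw [EdgeColour.other_other]; exact h.A₂B₁.symm
  A₂B₂ := by rw [EdgeColour.other_other]; exact h.A₁B₂.symm
  A₁B₂ := h.A₁B₁.symm
  A₂B₁ := h.A₂B₂.symm
  A₁Z := by rw [EdgeColour.other_other]; exact h.B₁Z
  A₂Z := by rw [EdgeColour.other_other]; exact h.B₂Z
  B₁Z := h.A₂Z
  B₂Z := h.A₁Z
  A₁A₂ := by rw [EdgeColour.other_other]; exact h.B₁B₂
  A₂A₁ := by rw [EdgeColour.other_other]; exact h.B₂B₁
  B₁B₂ := h.A₂A₁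
  B₂B₁ := h.A₁A₂

section Extremal

variable {V : Type*} {G : SimpleGraph V} {C : G.EdgeLabeling EdgeColour} {A : Finset V}
  {t κ : ℝ} {S : CleanColouring A (Set (Sym2 V)) t κ}

theorem allBetween_of_only (hE : ∀ k c u v, S.E k c u v ↔ CompAdj (colourGraph C k) c u v)
    {k : EdgeColour} {X Y : Finset A} (h : S.Only k X Y) :
    AllBetween C k (X.map (Function.Embedding.subtype _)) (Y.map (Function.Embedding.subtype _)) := by
  intro a ha b hb hab
  obtain ⟨a, ha', rfl⟩ := Finset.mem_map.1 ha
  obtain ⟨b, hb', rfl⟩ := Finset.mem_map.1 hb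
  have hadj : (colourGraph C (C ⟨s(_, _), hab⟩)).Adj _ _ :=
    (SimpleGraph.EdgeLabeling.labelGraph_adj _ _).2 ⟨hab, rfl⟩
  obtain ⟨d, hd⟩ := exists_compAdj hadj
  have := h a ha' b hb' _ d ((hE _ _ _ _).2 hd)
  rwa [this] at hadj

theorem vertexAlmostAll_of_fullCol
    (hE : ∀ k c u v, S.E k c u v ↔ CompAdj (colourGraph C k) c u v) {k : EdgeColour}
    {X Y : Finset A} (h : S.FullCol k X Y) {r : ℝ} (hr : 5 * κ ≤ r) {x : A} (hx : x ∈ X) :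
    VertexAlmostAll (colourGraph C k) r x (Y.map (Function.Embedding.subtype _)) := by
  have h1 := h x hx
  rw [← Finset.card_map (Function.Embedding.subtype (· ∈ A)), ← Set.ncard_coe_finset] at h1
  refine le_trans ?_ (h1.trans hr)
  have h2 : ((Y.map (Function.Embedding.subtype (· ∈ A)) : Finset V) : Set V) ∩
      {a | ¬ (colourGraph C k).Adj x a} ⊆
      ((Y.filter fun y => ¬ ∃ d, S.E k d x y).map (Function.Embedding.subtype (· ∈ A)) : Finset V) := by
    rintro y ⟨hy, hy'⟩
    obtain ⟨y, hyY, rfl⟩ := Finset.mem_map.1 (Finset.mem_coe.1 hy)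
    refine Finset.mem_coe.2 (Finset.mem_map.2 ⟨y, Finset.mem_filter.2 ⟨hyY, ?_⟩, rfl⟩)
    rintro ⟨d, hd⟩
    exact hy' ((hE _ _ _ _).1 hd).adj
  exact_mod_cast Set.ncard_le_ncard h2 (Finset.finite_toSet _)

theorem pairAlmostAll_of_fullCol
    (hE : ∀ k c u v, S.E k c u v ↔ CompAdj (colourGraph C k) c u v) {k : EdgeColour}
    {X Y : Finset A} (h : S.FullCol k X Y) (h' : S.FullCol k Y X) {r : ℝ} (hr : 5 * κ ≤ r)
    (hr0 : 0 ≤ r) :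
    PairAlmostAll (colourGraph C k) r (X.map (Function.Embedding.subtype _))
      (Y.map (Function.Embedding.subtype _)) := by
  have aux : ∀ {X Y : Finset A}, S.FullCol k X Y →
      (((X.map (Function.Embedding.subtype _) : Finset V) : Set V) ∩
        {a | ¬ VertexAlmostAll (colourGraph C k) r a (Y.map (Function.Embedding.subtype _))}).ncard
          ≤ r := by
    intro X Y h
    have : ((X.map (Function.Embedding.subtype _) : Finset V) : Set V) ∩
        {a | ¬ VertexAlmostAll (colourGraph C k) r a (Y.map (Function.Embedding.subtype _))} = ∅ := by
      refine Set.eq_empty_iff_forall_notMem.2 ?_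
      rintro x ⟨hx, hx'⟩
      obtain ⟨x, hxX, rfl⟩ := Finset.mem_map.1 (Finset.mem_coe.1 hx)
      exact hx' (vertexAlmostAll_of_fullCol hE h hr hxX)
    rw [this]
    simpa using hr0
  exact ⟨aux h, aux h'⟩

theorem exists_isExtremalPartition [Fintype V]
    (hE : ∀ k c u v, S.E k c u v ↔ CompAdj (colourGraph C k) c u v) {m h lam : ℝ}
    {R₁ R₂ B₁ B₂ Z : Finset A} (H : S.IsExtremal .red m R₁ R₂ B₁ B₂ Z)
    (hV : (Fintype.card V : ℝ) ≤ 9 * t) (hm : 5 * m ≤ h * t) (hm0 : 0 ≤ m)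
    (hlam : 5 * κ ≤ lam * t) (hκ : 0 ≤ κ) :
    ∃ B₁ B₂ R₁ R₂ Z T : Finset V, IsExtremalPartition C h lam t B₁ B₂ R₁ R₂ Z T := by
  set e : Finset A → Finset V := fun X => X.map (Function.Embedding.subtype _) with he
  have ce : ∀ X, ((e X).card : ℝ) = X.card := fun X => by simp [he]
  have de : ∀ {X Y}, Disjoint X Y → Disjoint (e X) (e Y) := fun h =>
    (Finset.disjoint_map _).2 h
  have ab : ∀ {k X Y}, S.Only k X Y → AllBetween C k (e X) (e Y) := fun h =>
    allBetween_of_only hE h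
  have dAB := H.dAB
  have dZ := H.dZ
  simp only [Finset.disjoint_union_left, Finset.disjoint_union_right] at dAB dZ
  set W := e B₁ ∪ (e B₂ ∪ (e R₁ ∪ (e R₂ ∪ e Z))) with hW
  have dT : ∀ {X}, X ⊆ W → Disjoint X (Finset.univ \ W) := fun hX =>
    Finset.disjoint_of_subset_left hX Finset.disjoint_sdiff
  have cW : (W.card : ℝ) = B₁.card + (B₂.card + (R₁.card + (R₂.card + Z.card))) := by
    rw [hW, Finset.cast_card_union_of_disjoint, Finset.cast_card_union_of_disjoint,
      Finset.cast_card_union_of_disjoint, Finset.cast_card_union_of_disjoint, ce, ce, ce, ce, ce]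
    · exact de dZ.1.2
    · rw [Finset.disjoint_union_right]
      exact ⟨de H.dA, de dZ.1.1⟩
    · simp only [Finset.disjoint_union_right]
      exact ⟨(de dAB.2.1).symm, (de dAB.2.2).symm, de dZ.2.2⟩
    · simp only [Finset.disjoint_union_right]
      exact ⟨de H.dB, (de dAB.1.1).symm, (de dAB.1.2).symm, de dZ.2.1⟩
  have cT : ((Finset.univ \ W).card : ℝ) + W.card = Fintype.card V := by
    rw [← Finset.card_univ]
    exact_mod_cast Finset.card_sdiff_add_card_eq_card (Finset.subset_univ W)
  have hcA₁ := H.cA₁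
  have hcA₂ := H.cA₂
  have hcB₁ := H.cB₁
  have hcB₂ := H.cB₂
  have hcZ := H.cZ
  refine ⟨e B₁, e B₂, e R₁, e R₂, e Z, Finset.univ \ W,
    { disjoint := ?_
      cover := fun v => by
        by_cases hv : v ∈ W
        · simp only [hW, Finset.mem_union] at hv
          tauto
        · exact Or.inr (Or.inr (Or.inr (Or.inr (Or.inr (by simp [hv])))))
      card_B₁ := by rw [ce]; constructor <;> linarith
      card_B₂ := by rw [ce]; constructor <;> linarith
      card_R₁ := by rw [ce]; constructor <;> linarith
      card_R₂ := by rw [ce]; constructor <;> linarith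
      card_Z := by rw [ce]; constructor <;> linarith
      card_T := by linarith
      inside_B₁ := ab H.B₁B₁
      inside_B₂ := ab H.B₂B₂
      inside_R₁ := ab H.A₁A₁
      inside_R₂ := ab H.A₂A₂
      between_B₁_R₁ := ab H.A₁B₁.symm
      between_B₂_R₂ := ab H.A₂B₂.symm
      between_R₁_Z := ab H.A₁Z
      between_R₂_Z := ab H.A₂Z
      between_B₁_R₂ := ab H.A₂B₁.symm
      between_B₂_R₁ := ab H.A₁B₂.symm
      between_B₁_Z := ab H.B₁Z
      between_B₂_Z := ab H.B₂Z
      pair_B₁_B₂ := pairAlmostAll_of_fullCol hE H.B₁B₂ H.B₂B₁ hlam (by linarith)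
      pair_R₁_R₂ := pairAlmostAll_of_fullCol hE H.A₁A₂ H.A₂A₁ hlam (by linarith) }⟩
  have w1 : e B₁ ⊆ W := Finset.subset_union_left
  have w2 : e B₂ ⊆ W := fun v hv => by simp [hW, hv]
  have w3 : e R₁ ⊆ W := fun v hv => by simp [hW, hv]
  have w4 : e R₂ ⊆ W := fun v hv => by simp [hW, hv]
  have w5 : e Z ⊆ W := fun v hv => by simp [hW, hv]
  simp only [List.pairwise_cons, List.mem_cons, List.not_mem_nil, or_false, forall_eq_or_imp,
    forall_eq, List.Pairwise.nil, and_true, false_imp_iff, implies_true]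
  exact ⟨⟨de H.dB, (de dAB.1.1).symm, (de dAB.1.2).symm, de dZ.2.1, dT w1⟩,
    ⟨(de dAB.2.1).symm, (de dAB.2.2).symm, de dZ.2.2, dT w2⟩, ⟨de H.dA, de dZ.1.1, dT w3⟩,
    ⟨de dZ.1.2, dT w4⟩, dT w5⟩

end Extremal

/-! ### Choice of the parameters. -/

/-- The scales are `κ = κ₀ * t` and `δ = d * t`, so `100 * κ₀ = d ^ 2` is exactly the relation
needed between `κ * t` and `δ ^ 2`. The factor `2 ^ (M + M)` is the Ramsey bound for cliques of size
`M`. -/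
theorem hasTCTFOn_or_exists_partition {V : Type*} [Fintype V] [instD : DecidableEq V]
    (G : SimpleGraph V) [DecidableRel G.Adj] (C : G.EdgeLabeling EdgeColour)
    {h lam t ε d κ₀ : ℝ} {M : ℕ} (hd : 0 < d) (hd1 : 10000000 * d ≤ 1) (hdh : 30000 * d ≤ h)
    (hdl : d ≤ lam) (hκ₀ : 100 * κ₀ = d ^ 2) (hM : 1000 ≤ κ₀ ^ 2 * M) (hε : 0 < ε)
    (hεM : ε * 2 ^ (M + M) ≤ κ₀ / 4) (htM : 40 * 2 ^ (M + M) ≤ κ₀ * t)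
    (hcard : (Fintype.card V : ℝ) = (9 - ε) * t) (hdeg : (9 - 2 * ε) * t ≤ (G.minDegree : ℝ)) :
    (∃ k : EdgeColour, HasTCTFOn (colourGraph C k) (3 * (1 + ε) * t)) ∨
      ∃ B₁ B₂ R₁ R₂ Z T : Finset V, IsExtremalPartition C h lam t B₁ B₂ R₁ R₂ Z T := by
  obtain rfl : instD = fun a b => Classical.propDecidable (a = b) := Subsingleton.elim _ _
  by_contra hc
  push Not at hc
  obtain ⟨hno, hpart⟩ := hc
  have hκ0 : 0 < κ₀ := by nlinarith [pow_pos hd 2]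
  have hκ1 : 1000 * κ₀ ≤ d := by nlinarith
  have hp : (1 : ℝ) ≤ 2 ^ (M + M) := one_le_pow₀ (by norm_num)
  have ht : 0 < t := by
    by_contra h
    push Not at h
    nlinarith
  have hεκ : ε ≤ κ₀ / 4 := le_trans (by nlinarith) hεM
  have hεt : ε * t ≤ κ₀ * t / 4 := by nlinarith
  have hadj : ∀ u v, (∃ k, (colourGraph C k).Adj u v) ↔ G.Adj u v := fun u v =>
    ⟨fun ⟨k, hk⟩ => ((SimpleGraph.EdgeLabeling.labelGraph_adj _ _).1 hk).1, fun hk =>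
      ⟨_, (SimpleGraph.EdgeLabeling.labelGraph_adj _ _).2 ⟨hk, rfl⟩⟩⟩
  have hsp : ∀ v, ((Finset.univ.filter fun w => ¬ ∃ k, (colourGraph C k).Adj v w).card : ℝ) ≤
      ε * t := by
    intro v
    have h1 := Finset.card_filter_add_card_filter_not (s := (Finset.univ : Finset V))
      (fun w => ∃ k, (colourGraph C k).Adj v w)
    have h2 : (Finset.univ.filter fun w => ∃ k, (colourGraph C k).Adj v w) =
        G.neighborFinset v := by
      ext w
      simp [hadj]
    rw [h2, SimpleGraph.card_neighborFinset_eq_degree, Finset.card_univ] at h1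
    have h3 : (G.degree v : ℝ) +
        (Finset.univ.filter fun w => ¬ ∃ k, (colourGraph C k).Adj v w).card = Fintype.card V := by
      exact_mod_cast h1
    have h4 : (G.minDegree : ℝ) ≤ G.degree v := by exact_mod_cast G.minDegree_le_degree v
    linarith
  set s : ℝ := max (ε * t) 1 with hs
  have hsκ : 2 ^ (M + M) * s ≤ κ₀ * t / 4 := by
    rcases max_choice (ε * t) 1 with h | h <;> rw [hs, h] <;> nlinarith
  have hM0 : 0 < M := by
    rcases Nat.eq_zero_or_pos M with h | h
    · rw [h] at hM; norm_num at hM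
    · exact h
  obtain ⟨A, S, hE⟩ := exists_cleanColouring (fun k => colourGraph C k) (by
      intro k j u v h h'
      obtain ⟨_, h⟩ := (SimpleGraph.EdgeLabeling.labelGraph_adj _ _).1 h
      obtain ⟨_, h'⟩ := (SimpleGraph.EdgeLabeling.labelGraph_adj _ _).1 h'
      exact h.symm.trans h') hM0 (t := t) (κ := κ₀ * t) (L := 2 ^ (M + M) * s) (by positivity) ht
    (by nlinarith) (by
      have : 1000 * t ^ 2 ≤ κ₀ ^ 2 * M * t ^ 2 := by gcongr
      nlinarith) (by nlinarith) (by linarith) hsκ (fun v => (hsp v).trans hεt)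
    (fun W hW => exists_mono_clique (fun k => colourGraph C k) (s := s)
      (lt_of_lt_of_le one_pos (le_max_right _ _)) (fun v => (hsp v).trans (le_max_left _ _))
      (M + M) (fun _ => M) rfl W (by
        have : 0 < s := lt_of_lt_of_le one_pos (le_max_right _ _)
        linarith)) (by
      -- Since `ε ≤ κ₀ / 4`, more than `t + κ₀ * t` triangles in one component would form a TCTF of
      -- the excluded size.
      intro k c F hF hd
      by_contra hlt
      push Not at hlt
      have hne : F.Nonempty := by
        rw [← Finset.card_pos]
        have : (0 : ℝ) < F.card := by nlinarith
        exact_mod_cast this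
      have hT := isTCTF_of_compAdj hne hF hd
      refine hno k ⟨F, hT, ?_⟩
      have hsum : ∑ u ∈ F, (id u).card = F.card * 3 :=
        Finset.sum_const_nat fun s hs => (hT.1.1 s hs).card_eq
      rw [Finset.card_biUnion (fun s hs s' hs' h => hd hs hs' h), hsum]
      push_cast
      nlinarith)
  have e1 : 10 ≤ κ₀ * t := by linarith
  have e2 : 1000 * (κ₀ * t) ≤ d * t := by nlinarith
  obtain ⟨k, A₁, A₂, B₁, B₂, Z, H⟩ := CleanColouring.exists_isExtremal S (δ := d * t) e1 e2
    (by nlinarith) (by nlinarith)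
  have fin : ∀ {A₁ A₂ B₁ B₂ Z}, ¬ S.IsExtremal .red (6000 * (d * t)) A₁ A₂ B₁ B₂ Z := by
    intro A₁ A₂ B₁ B₂ Z H
    obtain ⟨B₁, B₂, R₁, R₂, Z, T, hP⟩ := exists_isExtremalPartition (h := h) (lam := lam) hE H
      (by nlinarith) (by nlinarith) (by positivity) (by nlinarith) (by positivity)
    exact hpart B₁ B₂ R₁ R₂ Z T hP
  cases k
  · exact fin H
  · exact fin H.flip

end Auxiliary

theorem mainTheorem3 :
    ∃ δ₀ : ℝ, 0 < δ₀ ∧ ∀ h lam : ℝ, 0 < h → h < δ₀ → 0 < lam → lam < δ₀ →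
      ∃ ε₀ : ℝ, 0 < ε₀ ∧ ∃ t₀ : ℕ, ∀ t : ℝ, (t₀ : ℝ) ≤ t → ∀ ε : ℝ, 0 < ε → ε < ε₀ →
        ∀ (V : Type*) [Fintype V] [DecidableEq V] (G : SimpleGraph V) [DecidableRel G.Adj]
          (C : G.EdgeLabeling EdgeColour),
          (Fintype.card V : ℝ) = (9 - ε) * t →
          (9 - 2 * ε) * t ≤ (G.minDegree : ℝ) →
          (∃ k : EdgeColour, HasTCTFOn (colourGraph C k) (3 * (1 + ε) * t)) ∨
          ∃ B₁ B₂ R₁ R₂ Z T : Finset V, IsExtremalPartition C h lam t B₁ B₂ R₁ R₂ Z T := by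
  -- The value `1` suffices because the working scale `d` is a tiny multiple of `min h lam`.
  refine ⟨1, one_pos, fun h lam hh0 hh1 hl0 hl1 => ?_⟩
  set d : ℝ := min h lam / 10000000 with hd
  have hmin : 0 < min h lam := lt_min hh0 hl0
  have hd0 : 0 < d := by positivity
  have hdh : 10000000 * d ≤ h := by
    have := min_le_left h lam
    linarith
  have hdl : 10000000 * d ≤ lam := by
    have := min_le_right h lam
    linarith
  have hκ : 0 < d ^ 2 / 100 := by positivity
  set κ₀ : ℝ := d ^ 2 / 100 with hκ₀
  -- With cliques this large, their number is negligible compared with `κ₀ * t`.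
  obtain ⟨M, hM⟩ := exists_nat_ge (1000 / κ₀ ^ 2)
  obtain ⟨t₀, ht₀⟩ := exists_nat_ge (40 * 2 ^ (M + M) / κ₀)
  refine ⟨κ₀ / (4 * 2 ^ (M + M)), by positivity, t₀, ?_⟩
  intro t ht ε hε hε₀ V _ _ G _ C hcard hdeg
  rw [lt_div_iff₀ (by positivity)] at hε₀
  rw [div_le_iff₀ (by positivity)] at hM ht₀
  refine hasTCTFOn_or_exists_partition G C hd0 (M := M) (κ₀ := κ₀) (by linarith) (by linarith)
    (by linarith) (by linarith) (by linarith) hε (by linarith) ?_ hcard hdeg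
  calc 40 * 2 ^ (M + M) ≤ (t₀ : ℝ) * κ₀ := ht₀
    _ ≤ t * κ₀ := by gcongr
    _ = κ₀ * t := mul_comm _ _
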